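/- **Setting.** Let $\Omega=(-\frac12,\frac12)$, $X=[-\frac12,\frac12]$, let $L$ be the Lebesgue measure, and let $K=\{(\alpha,\zeta)\in\mathbb R^2:|\alpha|+|\zeta|\le 2\}$, with Euclidean projection $P_K$ and support function $H(\xi,\theta)=2\max(|\xi|,|\theta|)$. Let $V\in C^2(\mathbb R)$ be even, with $-M\le V''\le 0$ for some $M\ge0$ and $V'(\theta)=-1$ if and only if $\theta\ge1$. Let $\mathcal Q(e)=\frac12\int_\Omega e^2\,dy$, $\mathcal V(z)=\int_\Omega V(z)\,dy$, $\{V\}(\theta,\eta)=\eta V(\theta/\eta)$ for $\eta>0$, and $\{V\}(\theta,\eta)=\lim_{s\to+\infty}V(s\theta)/s$ for $\eta\le0$. The boundary datum is $w(t,y)=ty$ and the stress is $\sigma=e$. *Regularized evolutions.* For $\varepsilon>0$ a solution of the $\varepsilon$-regularized problem with initial condition $(0,0,0,z_0)$ is a quadruple with $u_\varepsilon\in H^1_{loc}([0,\infty);H^1(\Omega))$, $e_\varepsilon,p_\varepsilon,z_\varepsilon\in H^1_{loc}([0,\infty);L^2(\Omega))$ taking the value $(0,0,0,z_0)$ at $t=0$,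 such that for every $t>0$ one has $Du_\varepsilon(t)=e_\varepsilon(t)+p_\varepsilon(t)$ a.e. in $\Omega$, $u_\varepsilon(t)=w(t)$ at $\pm\frac12$, $De_\varepsilon(t)=0$ in $\Omega$, and for a.e. $t>0$ $(\dot p_\varepsilon,\dot z_\varepsilon)=\frac1\varepsilon\big((\sigma_\varepsilon,\zeta_\varepsilon)-P_K(\sigma_\varepsilon,\zeta_\varepsilon)\big)$ a.e. in $\Omega$, where $\sigma_\varepsilon=e_\varepsilon$ and $\zeta_\varepsilon=-V'(z_\varepsilon)$. *Generalized Young measures.* Let $C^{hom}_m$ be the space of continuous functions $f(x,\xi,\eta)$ on $X\times(\mathbb R\times\mathbb R)^m\times\mathbb R$ that are positively homogeneous of degree one in $(\xi,\eta)$. A generalized Young measure on $X$ with values in $(\mathbb R\times\mathbb R)^m$ is a positive linear functional on $C^{hom}_m$ that vanishes on every $f$ with $f=0$ on $\{\eta\ge0\}$ and maps $\varphi(x)\eta$ to $\int_\Omega\varphi\,dx$ for every $\varphi\in C(X)$; weak* convergence is pointwise convergence on $C^{hom}_m$. For a bounded measure $q$ on $X$ with values in $(\mathbb R\times\mathbb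 R)^m$, $\langle f,\delta_q\rangle=\int_X f(x,\frac{dq}{d\lambda},\frac{dL}{d\lambda})\,d\lambda$, where $\lambda$ is any nonnegative bounded measure with $L\ll\lambda$, $q\ll\lambda$; functions in $L^1(\Omega)$ are identified with absolutely continuous measures. The barycentre of $\mu$ (for $m=1$) is the measure $(p,z)$ with $\int\varphi\,dp+\int\psi\,dz=\langle\varphi(x)\xi+\psi(x)\theta,\mu(x,\xi,\theta,\eta)\rangle$ for all $\varphi,\psi\in C(X)$. A compatible system is a family $\boldsymbol\mu=(\boldsymbol\mu_{t_1\dots t_m})$, $0\le t_1<\dots<t_m$, of such measures which is stable under the projections that forget some of the times. Its dissipation is $$\mathcal D_H(\boldsymbol\mu;0,T)=\sup\sum_{i=1}^k\langle H(\xi_i-\xi_{i-1},\theta_i-\theta_{i-1}),\boldsymbol\mu_{t_0\dots t_k}(x,\xi_0,\theta_0,\dots,\xi_k,\theta_k,\eta)\rangle$$ over all $0=t_0<\dots<t_k=T$; for measure-valued functions $p,z$, $$\mathcal D_H(p,z;0,T)=\sup\sum_{i=1}^k\int_X H\Big(\frac{d(p(t_i)-p(t_{i-1}))}{d\lambda},\frac{d(z(t_i)-z(t_{i-1}))}{d\lambda}\Big)d\lambda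 .$$ *Approximable evolutions.* An approximable quasistatic evolution with boundary datum $w$ and initial condition $(0,0,0,z_0)$ is a triple $(u,e,\boldsymbol\mu)$ with $u\in L^\infty_{loc}([0,\infty);BV(\Omega))$, $e\in L^\infty_{loc}([0,\infty);L^2(\Omega))$ and $\boldsymbol\mu$ a compatible system, all weakly* left-continuous, for which there are $\varepsilon_k\to0^+$ and $\Theta\subset[0,\infty)$ of full measure containing $0$ such that the solutions of the $\varepsilon_k$-regularized problems satisfy $u_{\varepsilon_k}(t)\rightharpoonup u(t)$ weakly* in $BV(\Omega)$ and $e_{\varepsilon_k}(t)\rightharpoonup e(t)$ weakly in $L^2(\Omega)$ for $t\in\Theta$, and $\delta_{((p_{\varepsilon_k}(t_1),z_{\varepsilon_k}(t_1)),\dots,(p_{\varepsilon_k}(t_m),z_{\varepsilon_k}(t_m)))}\rightharpoonup\boldsymbol\mu_{t_1\dots t_m}$ weakly* for all $t_1<\dots<t_m$ in $\Theta$. **Theorem.** Let $z_0\colon[-\frac12,\frac12]\to\mathbb R$ be odd, continuous on $[-\frac12,0)\cup(0,\frac12]$, with $z_0(0+)=1$ and $0\le z_0(y)<1$ for every $y\in(0,\frac12]$.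 Let $(u,e,\boldsymbol\mu)$ be an approximable quasistatic evolution with boundary datum $w$ and initial condition $(0,0,0,z_0)$. Then for every $t\ge0$, with $\boldsymbol p(t):=(t-1)^+\delta_0$, $$u(t,y)=\begin{cases}ty& t\in[0,1],\\ y+\frac{t-1}2& t>1,\ y\in(0,\frac12],\\ y-\frac{t-1}2& t>1,\ y\in[-\frac12,0),\end{cases}\qquad e(t)=\min(t,1)$$ (for a.e. $y$), and $$\boldsymbol\mu_t=\tfrac12\delta_{(\boldsymbol p(t),\,z_0+\boldsymbol p(t))}+\tfrac12\delta_{(\boldsymbol p(t),\,z_0-\boldsymbol p(t))},$$ where the two measures that are averaged are different if $t>1$; the barycentre of $\boldsymbol\mu_t$ is $(\boldsymbol p(t),z_0)$. For every $T>0$, $\mathcal D_H(\boldsymbol\mu;0,T)=2(T-1)^+$ and $$\mathcal Q(e(T))+\mathcal D_H(\boldsymbol\mu;0,T)+\langle\{V\}(\theta,\eta),\boldsymbol\mu_T(x,\xi,\theta,\eta)\rangle=\mathcal Q(0)+\mathcal V(z_0)+\int_0^T\langle\sigma(t),D\dot w(t)\rangle\,dt .$$ On the other hand, for every $T>1$ the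 barycentres $\boldsymbol p$ and $\boldsymbol z(t):=z_0$ satisfy $\mathcal D_H(\boldsymbol p,\boldsymbol z;0,T)=2(T-1)$ and $$\mathcal Q(e(T))+\mathcal D_H(\boldsymbol p,\boldsymbol z;0,T)+\mathcal V(\boldsymbol z(T))>\mathcal Q(0)+\mathcal V(z_0)+\int_0^T\langle\sigma(t),D\dot w(t)\rangle\,dt .$$ -/

import Mathlib

open MeasureTheory Set Filter Topology
open scoped ContDiff ENNReal

noncomputable section

/-! ### The reference configuration -/

/-- The closed segment `[-1/2, 1/2]`, with its Lebesgue measure `volume`. The open segment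
`Ω = (-1/2, 1/2)` differs from it by a null set, so that `L²(Ω) = L²(Seg)`. -/
abbrev Seg : Type := Icc (-1 / 2 : ℝ) (1 / 2)

instance Seg.measureSpace : MeasureSpace Seg := Measure.Subtype.measureSpace

def Seg.left : Seg := ⟨-1 / 2, by norm_num⟩

def Seg.right : Seg := ⟨1 / 2, by norm_num⟩

def Seg.origin : Seg := ⟨0, by norm_num⟩

instance Seg.isFiniteMeasure : IsFiniteMeasure (volume : Measure Seg) :=
  ⟨by rw [Measure.Subtype.volume_univ nullMeasurableSet_Icc]; exact measure_Icc_lt_top⟩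

/-- `L²(Ω)`. -/
abbrev L2 : Type := Lp ℝ 2 (volume : Measure Seg)

/-! ### Sobolev and BV functions -/

/-- `φ ∈ C_c^∞(Ω)`. -/
def IsTest (φ : ℝ → ℝ) : Prop :=
  ContDiff ℝ ∞ φ ∧ HasCompactSupport φ ∧ tsupport φ ⊆ Ioo (-1 / 2) (1 / 2)

/-- `v` is the distributional derivative of `u` in `Ω`. -/
def IsWeakDeriv (u v : Seg → ℝ) : Prop :=
  ∀ φ, IsTest φ → ∫ y : Seg, u y * deriv φ y = -∫ y : Seg, v y * φ y

/-- Two Sobolev functions have the same traces on `Γ₀ = {-1/2, 1/2}`: in dimension one the trace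
is the boundary value of the continuous representative. -/
def SameTrace (u w : Seg → ℝ) : Prop :=
  ∃ ũ w' : C(Seg, ℝ), u =ᵐ[volume] ũ ∧ w =ᵐ[volume] w' ∧
    ũ Seg.left = w' Seg.left ∧ ũ Seg.right = w' Seg.right

/-- `f ∈ H¹_loc([0,∞); E)` with time derivative `f' ∈ L²_loc([0,∞); E)`, where `f` is the
absolutely continuous representative, so that its value at every time is meaningful. -/
def HasTimeDeriv {E : Type*} [NormedAddCommGroup E] [NormedSpace ℝ E] (f f' : ℝ → E) : Prop :=
  (∀ T > 0, MemLp f' 2 (volume.restrict (Ioc 0 T))) ∧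
    ∀ t, 0 ≤ t → f t = f 0 + ∫ s in (0 : ℝ)..t, f' s

/-- A function `w ∈ H¹_loc([0,∞); H¹(Ω))`, together with its space derivative `Dw` and the time
derivatives of `w` and `Dw`. -/
structure BoundaryDatum where
  w : ℝ → L2
  Dw : ℝ → L2
  wDot : ℝ → L2
  DwDot : ℝ → L2
  timeDeriv : HasTimeDeriv w wDot
  timeDeriv_grad : HasTimeDeriv Dw DwDot
  weakDeriv : ∀ t, 0 ≤ t → IsWeakDeriv (w t) (Dw t)

/-- `ν ∈ M_b(Ω)` is the distributional derivative of `u ∈ L¹(Ω)`; that is, `u ∈ BV(Ω)` and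
`Du = ν`. -/
def IsBVDeriv (u : Seg → ℝ) (ν : SignedMeasure Seg) : Prop :=
  Integrable u ∧ ν {Seg.left} = 0 ∧ ν {Seg.right} = 0 ∧
    ∀ φ, IsTest φ → ∫ y : Seg, u y * deriv φ y = -∫ᵛ y, φ y ∂•ν

/-- Weak* convergence in `BV(Ω)` along the filter `l`: weak convergence in `L¹(Ω)` of the functions
and weak* convergence in `M_b(Ω) = C₀(Ω)'` of their derivatives. -/
def BVWeakStar {α : Type*} (l : Filter α) (U : α → Seg → ℝ) (u : Seg → ℝ) : Prop :=
  ∃ (N : α → SignedMeasure Seg) (ν : SignedMeasure Seg),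
    (∀ᶠ a in l, IsBVDeriv (U a) (N a)) ∧ IsBVDeriv u ν ∧
    (∀ g : Seg → ℝ, MemLp g ∞ → Tendsto (fun a => ∫ y, U a y * g y) l (𝓝 (∫ y, u y * g y))) ∧
    ∀ φ : C(Seg, ℝ), φ Seg.left = 0 → φ Seg.right = 0 →
      Tendsto (fun a => ∫ᵛ y, φ y ∂•(N a)) l (𝓝 (∫ᵛ y, φ y ∂•ν))

/-- Weak convergence in `L²(Ω)` along the filter `l`. -/
def L2Weak {α : Type*} (l : Filter α) (F : α → L2) (f : L2) : Prop :=
  ∀ g : L2, Tendsto (fun a => inner ℝ (F a) g) l (𝓝 (inner ℝ f g))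

/-! ### Generalized Young measures on `Seg` -/

/-- `C^hom(Seg × Ξ × ℝ)`: continuous functions `f(x, ξ, η)`, positively homogeneous of degree one
in `(ξ, η)`. -/
def Chom (Ξ : Type*) [NormedAddCommGroup Ξ] [NormedSpace ℝ Ξ] :
    Submodule ℝ C(Seg × Ξ × ℝ, ℝ) where
  carrier := {f | ∀ (x : Seg) (ξ : Ξ) (η c : ℝ), 0 < c → f (x, c • ξ, c * η) = c * f (x, ξ, η)}
  add_mem' := by
    intro f g hf hg x ξ η c hc
    simp only [ContinuousMap.add_apply, hf x ξ η c hc, hg x ξ η c hc]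
    ring
  zero_mem' := by
    intro x ξ η c _
    simp
  smul_mem' := by
    intro a f hf x ξ η c hc
    simp only [ContinuousMap.smul_apply, hf x ξ η c hc, smul_eq_mul]
    ring

/-- The space `GY(Seg; Ξ)` of generalized Young measures: the linear functionals on
`C^hom(Seg × Ξ × ℝ)` with the positivity, support, and projection properties. (By positivity they
are continuous, hence elements of the dual space, see `GY.abs_le` below.) -/
structure GY (Ξ : Type*) [NormedAddCommGroup Ξ] [NormedSpace ℝ Ξ] where
  toFun : Chom Ξ →ₗ[ℝ] ℝ
  positivity : ∀ f : Chom Ξ, (∀ q, 0 ≤ f.1 q) → 0 ≤ toFun f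
  support : ∀ f : Chom Ξ,
    (∀ (x : Seg) (ξ : Ξ) (η : ℝ), 0 ≤ η → f.1 (x, ξ, η) = 0) → toFun f = 0
  projection : ∀ (φ : C(Seg, ℝ)) (f : Chom Ξ),
    (∀ (x : Seg) (ξ : Ξ) (η : ℝ), f.1 (x, ξ, η) = φ x * η) → toFun f = ∫ x, φ x

/-- The function `(x, ξ, η) ↦ ‖(ξ, η)‖`. -/
def Chom.norm (Ξ : Type*) [NormedAddCommGroup Ξ] [NormedSpace ℝ Ξ] : Chom Ξ :=
  ⟨⟨fun q => ‖q.2‖, by fun_prop⟩, by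
    intro x ξ η c hc
    change ‖(c • ξ, c * η)‖ = c * ‖(ξ, η)‖
    have h : ((c • ξ, c * η) : Ξ × ℝ) = c • (ξ, η) := rfl
    rw [h, norm_smul, Real.norm_of_nonneg hc.le]⟩

/-- A generalized Young measure is a bounded functional. -/
theorem GY.abs_le {Ξ : Type*} [NormedAddCommGroup Ξ] [NormedSpace ℝ Ξ] (μ : GY Ξ) (f : Chom Ξ)
    (M : ℝ) (hM : ∀ q, |f.1 q| ≤ M * ‖q.2‖) : |μ.toFun f| ≤ M * μ.toFun (Chom.norm Ξ) := by
  have h1 := μ.positivity (M • Chom.norm Ξ - f) (fun q => by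
    have := (_root_.abs_le.1 (hM q)).2
    change 0 ≤ M * ‖q.2‖ - f.1 q
    linarith)
  have h2 := μ.positivity (M • Chom.norm Ξ + f) (fun q => by
    have := (_root_.abs_le.1 (hM q)).1
    change 0 ≤ M * ‖q.2‖ + f.1 q
    linarith)
  rw [map_sub, map_smul, smul_eq_mul] at h1
  rw [map_add, map_smul, smul_eq_mul] at h2
  exact _root_.abs_le.2 ⟨by linarith, by linarith⟩

open Classical in
/-- The duality `⟨F, μ⟩` for a function `F` that belongs to `C^hom` (and `0` otherwise). -/
def GY.pair {Ξ : Type*} [NormedAddCommGroup Ξ] [NormedSpace ℝ Ξ] (μ : GY Ξ)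
    (F : Seg × Ξ × ℝ → ℝ) : ℝ :=
  if h : ∃ f : Chom Ξ, ∀ q, f.1 q = F q then μ.toFun h.choose else 0

/-- `(p, z) = bar μ` for `μ ∈ GY(Seg; ℝ × ℝ)` (with `ℝ × ℝ` written as `Fin 1 → ℝ × ℝ`). -/
def IsBarycentre (μ : GY (Fin 1 → ℝ × ℝ)) (p z : SignedMeasure Seg) : Prop :=
  ∀ φ ψ : C(Seg, ℝ), μ.pair (fun q => φ q.1 * (q.2.1 0).1 + ψ q.1 * (q.2.1 0).2) =
    (∫ᵛ y, φ y ∂•p) + ∫ᵛ y, ψ y ∂•z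

/-- `⟨f, δ_q⟩ = ∫ f(x, dq/dλ, dL/dλ) dλ`, for a measure `q` on `Seg` with values in `(ℝ × ℝ)^m`;
`L` is the Lebesgue measure and `λ` is the sum of `L` and of the variations of the components of
`q` (by homogeneity any `λ` with `L ≪ λ` and `q ≪ λ` gives the same value). -/
def youngDelta {m : ℕ} (q : Fin m → SignedMeasure Seg × SignedMeasure Seg)
    (f : Chom (Fin m → ℝ × ℝ)) : ℝ :=
  let lam : Measure Seg :=
    volume + ∑ i, ((q i).1.totalVariation + (q i).2.totalVariation)
  ∫ x, f.1 (x, fun i => ((q i).1.rnDeriv lam x, (q i).2.rnDeriv lam x),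
    ((volume : Measure Seg).rnDeriv lam x).toReal) ∂lam

/-- The same functional for a measure with density `g` with respect to the Lebesgue measure, for
which one can take `λ = L`. -/
def youngDeltaFun {m : ℕ} (g : Seg → Fin m → ℝ × ℝ) (f : Chom (Fin m → ℝ × ℝ)) : ℝ :=
  ∫ x, f.1 (x, g x, 1)

/-- `SGY([0,∞), Seg; ℝ × ℝ)`: compatible systems of generalized Young measures. The value
`meas m t` is relevant only if `0 ≤ t 0 < t 1 < ... < t (m-1)`. An increasing finite sequence whose
elements are among those of `t` is of the form `t ∘ r` with `r` strictly increasing. -/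
structure SGY where
  meas : (m : ℕ) → (Fin m → ℝ) → GY (Fin m → ℝ × ℝ)
  compat : ∀ (n m : ℕ) (t : Fin m → ℝ) (r : Fin n → Fin m), StrictMono t → (∀ i, 0 ≤ t i) →
    StrictMono r → ∀ (f : Chom (Fin n → ℝ × ℝ)) (g : Chom (Fin m → ℝ × ℝ)),
      (∀ x ξ η, g.1 (x, ξ, η) = f.1 (x, fun i => ξ (r i), η)) →
      (meas n fun i => t (r i)).toFun f = (meas m t).toFun g

/-- Weak* left-continuity of a system of generalized Young measures. -/
def SGY.LeftContinuous (μ : SGY) : Prop :=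
  ∀ (m : ℕ) (t : Fin m → ℝ), StrictMono t → (∀ i, 0 ≤ t i) → ∀ f : Chom (Fin m → ℝ × ℝ),
    Tendsto (fun s => (μ.meas m s).toFun f)
      (𝓝[{s | StrictMono s ∧ ∀ i, 0 ≤ s i ∧ s i ≤ t i}] t) (𝓝 ((μ.meas m t).toFun f))

/-! ### Constitutive functions and energies -/

/-- The support function `H` of `K`. -/
def supportFn (K : Set (ℝ × ℝ)) (x : ℝ × ℝ) : ℝ :=
  sSup ((fun k : ℝ × ℝ => k.1 * x.1 + k.2 * x.2) '' K)

/-- `q = P_K x`, the Euclidean projection of `x` onto `K`. -/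
def IsProjection (K : Set (ℝ × ℝ)) (x q : ℝ × ℝ) : Prop :=
  q ∈ K ∧ ∀ k ∈ K, (x.1 - q.1) ^ 2 + (x.2 - q.2) ^ 2 ≤ (x.1 - k.1) ^ 2 + (x.2 - k.2) ^ 2

/-- `ν = N_K^ε x = (x - P_K x) / ε`. -/
def IsViscousFlow (K : Set (ℝ × ℝ)) (ε : ℝ) (x ν : ℝ × ℝ) : Prop :=
  ∃ q, IsProjection K x q ∧ ν = (1 / ε) • (x - q)

/-- The recession function `V^∞(θ) = lim V(sθ)/s` as `s → +∞`. -/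
def recession (V : ℝ → ℝ) (θ : ℝ) : ℝ := limUnder atTop fun s : ℝ => V (s * θ) / s

/-- The homogeneous function `{V}(θ, η)`. -/
def homogenized (V : ℝ → ℝ) (θ η : ℝ) : ℝ :=
  if 0 < η then η * V (θ / η) else recession V θ

/-- The stored elastic energy `½ ⟨2G e, e⟩`, where `G` is the shear modulus. -/
def elasticEnergy (G : ℝ) (e : Seg → ℝ) : ℝ := ∫ y, 1 / 2 * (2 * G * e y) * e y

/-- `∫ V(z)`. -/
def softeningEnergy (V : ℝ → ℝ) (z : Seg → ℝ) : ℝ := ∫ y, V (z y)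

/-- The work `∫₀ᵀ ⟨σ(t), Dẇ(t)⟩ dt` of the stress `σ = 2G e`. -/
def work (G : ℝ) (e : ℝ → L2) (w : BoundaryDatum) (T : ℝ) : ℝ :=
  ∫ t in (0 : ℝ)..T, inner ℝ ((2 * G) • e t) (w.DwDot t)

/-- The set of sums whose supremum is the dissipation `D_H(μ; a, b)` of a system of generalized
Young measures. -/
def SGY.dissipationSums (μ : SGY) (K : Set (ℝ × ℝ)) (a b : ℝ) : Set ℝ :=
  {S | ∃ (k : ℕ) (t : Fin (k + 1) → ℝ), StrictMono t ∧ t 0 = a ∧ t (Fin.last k) = b ∧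
    S = ∑ i : Fin k, (μ.meas (k + 1) t).pair
      (fun q => supportFn K (q.2.1 i.succ - q.2.1 i.castSucc))}

/-- `D_H(μ; a, b)`. -/
def SGY.dissipation (μ : SGY) (K : Set (ℝ × ℝ)) (a b : ℝ) : ℝ := sSup (μ.dissipationSums K a b)

/-- The functional `∫ H(dp/dλ, dz/dλ) dλ` on pairs of measures, with `λ = |p| + |z|`. -/
def dissipationFunctional (K : Set (ℝ × ℝ)) (p z : SignedMeasure Seg) : ℝ :=
  ∫ x, supportFn K (p.rnDeriv (p.totalVariation + z.totalVariation) x,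
    z.rnDeriv (p.totalVariation + z.totalVariation) x) ∂(p.totalVariation + z.totalVariation)

/-- The set of sums whose supremum is the dissipation `D_H(p, z; a, b)` of a pair of measure-valued
functions. -/
def pathDissipationSums (K : Set (ℝ × ℝ)) (p z : ℝ → SignedMeasure Seg) (a b : ℝ) : Set ℝ :=
  {S | ∃ (k : ℕ) (t : Fin (k + 1) → ℝ), StrictMono t ∧ t 0 = a ∧ t (Fin.last k) = b ∧
    S = ∑ i : Fin k, dissipationFunctional K (p (t i.succ) - p (t i.castSucc))
      (z (t i.succ) - z (t i.castSucc))}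

/-- `D_H(p, z; a, b)`. -/
def pathDissipation (K : Set (ℝ × ℝ)) (p z : ℝ → SignedMeasure Seg) (a b : ℝ) : ℝ :=
  sSup (pathDissipationSums K p z a b)

/-! ### Regularized and approximable evolutions in dimension one -/

/-- `(u, e, p, z)` is a solution of the `ε`-regularized evolution problem in dimension one, with
shear modulus `G` (so that `σ = 2G e`), constraint set `K`, softening potential `V`, boundary datum
`w`, and initial condition `(u₀, e₀, p₀, z₀)`. Here `Γ₀ = {-1/2, 1/2}` and `Γ₁ = ∅`. -/
def IsRegularizedEvolution (G : ℝ) (K : Set (ℝ × ℝ)) (V : ℝ → ℝ) (w : BoundaryDatum)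
    (u₀ e₀ p₀ z₀ : Seg → ℝ) (ε : ℝ) (u e p z : ℝ → L2) : Prop :=
  ∃ Du uDot DuDot eDot pDot zDot : ℝ → L2,
    -- regularity
    HasTimeDeriv u uDot ∧ HasTimeDeriv Du DuDot ∧ (∀ t, 0 ≤ t → IsWeakDeriv (u t) (Du t)) ∧
    HasTimeDeriv e eDot ∧ HasTimeDeriv p pDot ∧ HasTimeDeriv z zDot ∧
    -- initial condition
    u 0 =ᵐ[volume] u₀ ∧ e 0 =ᵐ[volume] e₀ ∧ p 0 =ᵐ[volume] p₀ ∧ z 0 =ᵐ[volume] z₀ ∧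
    -- kinematic admissibility
    (∀ t, 0 < t → Du t = e t + p t ∧ SameTrace (u t) (w.w t)) ∧
    -- equilibrium
    (∀ t, 0 < t → IsWeakDeriv (fun y => 2 * G * e t y) 0) ∧
    -- regularized flow rule
    ∀ᵐ t ∂(volume.restrict (Ioi (0 : ℝ))), ∀ᵐ y : Seg,
      IsViscousFlow K ε (2 * G * e t y, -deriv V (z t y)) (pDot t y, zDot t y)

/-- `(u, e, μ)` is an approximable quasistatic evolution in dimension one. Local boundedness in time
is required for every `t`; together with weak* left-continuity, this is membership in `L^∞_loc` of
weakly* left-continuous functions. -/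
structure IsApproximableEvolution (G : ℝ) (K : Set (ℝ × ℝ)) (V : ℝ → ℝ) (w : BoundaryDatum)
    (u₀ e₀ p₀ z₀ : Seg → ℝ) (u : ℝ → Seg → ℝ) (e : ℝ → L2) (μ : SGY) : Prop where
  memLp_initial : MemLp u₀ 2 ∧ MemLp e₀ 2 ∧ MemLp p₀ 2 ∧ MemLp z₀ 2
  /-- kinematic admissibility and equilibrium of the initial condition -/
  admissible_initial : IsWeakDeriv u₀ (fun y => e₀ y + p₀ y) ∧ SameTrace u₀ (w.w 0) ∧
    IsWeakDeriv (fun y => 2 * G * e₀ y) 0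
  u_bounded : ∀ T > 0, ∃ C : ℝ, ∀ t ∈ Icc 0 T, ∃ ν : SignedMeasure Seg, IsBVDeriv (u t) ν ∧
    (∫ y, |u t y|) + ν.totalVariation.real univ ≤ C
  e_bounded : ∀ T > 0, ∃ C : ℝ, ∀ t ∈ Icc 0 T, ‖e t‖ ≤ C
  u_leftContinuous : ∀ t, 0 ≤ t → BVWeakStar (𝓝[Icc 0 t] t) u (u t)
  e_leftContinuous : ∀ t, 0 ≤ t → L2Weak (𝓝[Icc 0 t] t) e (e t)
  μ_leftContinuous : μ.LeftContinuous
  approximable : ∃ (ε : ℕ → ℝ) (Θ : Set ℝ) (uε eε pε zε : ℕ → ℝ → L2),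
    (∀ k, 0 < ε k) ∧ Tendsto ε atTop (𝓝 0) ∧
    Θ ⊆ Ici 0 ∧ 0 ∈ Θ ∧ volume (Ici 0 \ Θ) = 0 ∧
    (∀ k, IsRegularizedEvolution G K V w u₀ e₀ p₀ z₀ (ε k) (uε k) (eε k) (pε k) (zε k)) ∧
    (∀ t ∈ Θ, BVWeakStar atTop (fun k => (uε k t : Seg → ℝ)) (u t)) ∧
    (∀ t ∈ Θ, L2Weak atTop (fun k => eε k t) (e t)) ∧
    ∀ (m : ℕ) (t : Fin m → ℝ), StrictMono t → (∀ i, t i ∈ Θ) → ∀ f : Chom (Fin m → ℝ × ℝ),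
      Tendsto (fun k => youngDeltaFun (fun y i => (pε k (t i) y, zε k (t i) y)) f) atTop
        (𝓝 ((μ.meas m t).toFun f))

/-! ### The data of the example -/

/-- `{(α, ζ) : |α| + |ζ| ≤ 2}`. -/
def diamond : Set (ℝ × ℝ) := {x | |x.1| + |x.2| ≤ 2}

/-- The function `y ↦ y` and the constant `1` in `L²(Ω)`. -/
def idL2 : L2 := ContinuousMap.toLp 2 volume ℝ ⟨fun y : Seg => (y : ℝ), by fun_prop⟩

def oneL2 : L2 := ContinuousMap.toLp 2 volume ℝ (1 : C(Seg, ℝ))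

theorem idL2_ae : idL2 =ᵐ[volume] fun y : Seg => (y : ℝ) :=
  ContinuousMap.coeFn_toLp (p := 2) (𝕜 := ℝ) volume _

theorem oneL2_ae : oneL2 =ᵐ[volume] fun _ : Seg => (1 : ℝ) :=
  ContinuousMap.coeFn_toLp (p := 2) (𝕜 := ℝ) volume (1 : C(Seg, ℝ))

theorem hasTimeDeriv_smul (f : L2) : HasTimeDeriv (fun t : ℝ => t • f) (fun _ => f) := by
  refine ⟨fun T _ => memLp_const f, fun t _ => ?_⟩
  simp

theorem isWeakDeriv_smul (t : ℝ) : IsWeakDeriv (t • idL2 : L2) (t • oneL2 : L2) := by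
  intro φ hφ
  have hI : (Icc (-1 / 2 : ℝ) (1 / 2)) =ᵐ[volume] Ioc (-1 / 2 : ℝ) (1 / 2) := Ioc_ae_eq_Icc.symm
  have h1 : ∫ y : Seg, (t • idL2 : L2) y * deriv φ y = ∫ y : Seg, t * (y : ℝ) * deriv φ y := by
    apply integral_congr_ae
    filter_upwards [Lp.coeFn_smul t idL2, idL2_ae] with y h h'
    rw [h, Pi.smul_apply, h', smul_eq_mul]
  have h2 : ∫ y : Seg, (t • oneL2 : L2) y * φ y = ∫ y : Seg, t * φ y := by
    apply integral_congr_ae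
    filter_upwards [Lp.coeFn_smul t oneL2, oneL2_ae] with y h h'
    rw [h, Pi.smul_apply, h', smul_eq_mul, mul_one]
  have hz : ∀ y : ℝ, y ∉ Ioo (-1 / 2 : ℝ) (1 / 2) → φ y = 0 := fun y hy =>
    image_eq_zero_of_notMem_tsupport fun h => hy (hφ.2.2 h)
  rw [h1, h2, integral_subtype measurableSet_Icc (fun y : ℝ => t * y * deriv φ y),
    integral_subtype measurableSet_Icc (fun y : ℝ => t * φ y), setIntegral_congr_set hI,
    setIntegral_congr_set hI, ← intervalIntegral.integral_of_le (by norm_num),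
    ← intervalIntegral.integral_of_le (by norm_num)]
  have hd : ∀ x ∈ uIcc (-1 / 2 : ℝ) (1 / 2), HasDerivAt φ (deriv φ x) x := fun x _ =>
    ((hφ.1.differentiable (by simp)) x).hasDerivAt
  have hc : Continuous (deriv φ) := hφ.1.continuous_deriv (by simp)
  have := intervalIntegral.integral_mul_deriv_eq_deriv_mul (a := (-1 / 2 : ℝ)) (b := 1 / 2)
    (u := fun y => t * y) (u' := fun _ => t) (v := φ) (v' := deriv φ)
    (fun x _ => by simpa using (hasDerivAt_id x).const_mul t) hd
    (continuous_const.intervalIntegrable _ _) (hc.intervalIntegrable _ _)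
  rw [this, hz (1 / 2) (by simp), hz (-1 / 2) (by simp)]
  simp

/-- The boundary datum `w(t, y) = t y`, with `Dw(t, y) = t`. -/
def linearDatum : BoundaryDatum where
  w t := t • idL2
  Dw t := t • oneL2
  wDot _ := idL2
  DwDot _ := oneL2
  timeDeriv := hasTimeDeriv_smul idL2
  timeDeriv_grad := hasTimeDeriv_smul oneL2
  weakDeriv t _ := isWeakDeriv_smul t

/-- The plastic strain `(t - 1)⁺ δ₀`. -/
def slip (t : ℝ) : SignedMeasure Seg := VectorMeasure.dirac Seg.origin (max (t - 1) 0)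

/-- The absolutely continuous measure with density `z`. -/
def densityMeasure (z : Seg → ℝ) : SignedMeasure Seg := (volume : Measure Seg).withDensityᵥ z

/-- The displacement at time `t`. -/
def displacement (t : ℝ) (y : Seg) : ℝ :=
  if t ≤ 1 then t * (y : ℝ)
  else if 0 < (y : ℝ) then (y : ℝ) + (t - 1) / 2 else (y : ℝ) - (t - 1) / 2

end

/-!
The problem is one-dimensional, so equilibrium makes the stress of a regularized evolution
constant in space, and the boundary condition gives its value `c(t) = t - ∫ p(t)`
(`IsRegularizedEvolution.exists_reduced`). What remains is, at each point `y`, an ordinary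
differential equation for `(p, z)`, coupled only through `c`. The force `g = -V'` is odd,
nondecreasing, Lipschitz, and equal to `1` exactly on `[1, ∞)`, so that `|ζ| = |g(z)| ≤ 1`. In
this range the viscous flow of the diamond is explicit (`viscousFlow_diamond`): for `0 ≤ c ≤ 2`,
`ṗ` is the positive part of `(c + |ζ| - 2) / (2ε)`, and `ż = sgn(ζ) ṗ`.

Consequences, for `ε` small (`exists_forall_reduced`):
* nothing flows while `c ≤ 1`, so the response is elastic up to `t = 1`, and afterwards `c ≥ 1`;
* since `|z|` does not decrease and `g(z₀(y)) → 1` as `y → 0+`, a set of positive measure flows at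
  a rate of order `1 / ε` as soon as `c` exceeds `1` by a fixed amount; hence `c(t) → min t 1`
  uniformly, and the total slip `∫ p(t) = t - c(t)` tends to `(t - 1)⁺`;
* away from the origin `|g(z₀)|` is bounded away from `1`, and there `p` stays equal to `0`: all
  the slip concentrates at the origin;
* `z = z₀ + p` on the right and `z = z₀ - p` on the left of the origin, and `p` is even because
  `z₀` is odd, so that each side carries half of the slip.

The pointwise comparisons are done in `L²` (`HasTimeDeriv.nonpos_on`). By
homogeneity a function in `C^hom` evaluated at `(p, z₀ ± p, 1)`, for large `p` near the origin, is
close to `p` times its value at `(1, ±1, 0)`. The two sides therefore contribute the two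
concentrated slips `½ (t - 1)⁺ (1, ±1)` to the limit Young measure
(`IsSymmetricSlip.abs_integral_sub_le`, `tendsto_reduced`), and `youngDelta_slip` identifies this
limit with the average of two functionals `δ_q`. The limits hold first at the times in the set of
full measure where the regularized evolutions converge, and extend to all times by left
continuity.

Since `p` is nondecreasing in time and `|Δz| = Δp`, each term of a dissipation sum is `2 ∫ Δp`,
whose limit is `2 Δ(t - 1)⁺`. Every sum over a subdivision is then telescopic, and equals
`2 (T - 1)⁺` (`IsApproximableEvolution.dissipationSums_eq`). The recession function of `V` is `-|θ|`, so
the two concentrated slips lower the stored energy by `(T - 1)⁺` (`averageSlip_homogenized`). This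
is what balances the energy; the barycentre `z₀` misses exactly this term.
-/

noncomputable section

/-! ### The constraint set and the viscous flow -/

theorem mul_self_of_sign {j : ℝ} (hj : j = 1 ∨ j = -1) : j * j = 1 := by
  rcases hj with rfl | rfl <;> norm_num

theorem abs_of_sign {j : ℝ} (hj : j = 1 ∨ j = -1) : |j| = 1 := by
  rcases hj with rfl | rfl <;> norm_num

theorem supportFn_diamond (x : ℝ × ℝ) : supportFn diamond x = 2 * max |x.1| |x.2| := by
  apply IsGreatest.csSup_eq
  constructor
  · rcases le_total |x.1| |x.2| with h | h
    · rw [max_eq_right h]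
      rcases abs_cases x.2 with ⟨h2, -⟩ | ⟨h2, -⟩
      · exact ⟨(0, 2), by simp [diamond], by simp [h2]⟩
      · exact ⟨(0, -2), by simp [diamond], by simp [h2]⟩
    · rw [max_eq_left h]
      rcases abs_cases x.1 with ⟨h2, -⟩ | ⟨h2, -⟩
      · exact ⟨(2, 0), by simp [diamond], by simp [h2]⟩
      · exact ⟨(-2, 0), by simp [diamond], by simp [h2]⟩
  · rintro _ ⟨k, hk, rfl⟩
    change |k.1| + |k.2| ≤ 2 at hk
    have h1 : k.1 * x.1 ≤ |k.1| * max |x.1| |x.2| := by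
      refine (le_abs_self _).trans ?_
      rw [abs_mul]
      gcongr
      exact le_max_left _ _
    have h2 : k.2 * x.2 ≤ |k.2| * max |x.1| |x.2| := by
      refine (le_abs_self _).trans ?_
      rw [abs_mul]
      gcongr
      exact le_max_right _ _
    have h3 : 0 ≤ max |x.1| |x.2| := le_max_of_le_left (abs_nonneg _)
    change k.1 * x.1 + k.2 * x.2 ≤ 2 * max |x.1| |x.2|
    nlinarith

/-- The variational inequality characterizes the projection. -/
theorem IsProjection.eq_of_variational {K : Set (ℝ × ℝ)} {x q c : ℝ × ℝ} (hq : IsProjection K x q)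
    (hc : c ∈ K)
    (h : ∀ k ∈ K, (x.1 - c.1) * (k.1 - c.1) + (x.2 - c.2) * (k.2 - c.2) ≤ 0) : q = c := by
  have h1 := hq.2 c hc
  have h2 := h q hq.1
  have h3 : (q.1 - c.1) ^ 2 + (q.2 - c.2) ^ 2 ≤ 0 := by nlinarith
  have h4 : q.1 - c.1 = 0 := by
    have := sq_nonneg (q.2 - c.2)
    exact pow_eq_zero_iff (two_ne_zero) |>.1 (le_antisymm (by linarith) (sq_nonneg _))
  have h5 : q.2 - c.2 = 0 := by
    have := sq_nonneg (q.1 - c.1)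
    exact pow_eq_zero_iff (two_ne_zero) |>.1 (le_antisymm (by linarith) (sq_nonneg _))
  exact Prod.ext (by linarith) (by linarith)

/-- The length by which the projection onto the diamond shortens the first coordinate of
`(s, r)`, when `0 ≤ s` and `0 ≤ r ≤ 1`. It vanishes inside the diamond, is `(s + r - 2) / 2` where
`(s, r)` projects onto a side, and `s - 2` where it projects onto the vertex `(2, 0)`. -/
def flowRate (s r : ℝ) : ℝ := max 0 (max ((s + r - 2) / 2) (s - 2))

theorem flowRate_nonneg (s r : ℝ) : 0 ≤ flowRate s r := le_max_left _ _

theorem continuous_flowRate : Continuous fun q : ℝ × ℝ => flowRate q.1 q.2 := by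
  unfold flowRate
  fun_prop

theorem flowRate_eq_zero {s r : ℝ} (hs : s ≤ 1) (hr : r ≤ 1) : flowRate s r = 0 := by
  unfold flowRate
  rw [max_eq_left]
  exact max_le (by linarith) (by linarith)

theorem flowRate_of_le_two {s r : ℝ} (hs : s ≤ 2) : flowRate s r = max 0 ((s + r - 2) / 2) := by
  unfold flowRate
  rw [← max_assoc, max_eq_left]
  exact le_max_of_le_left (by linarith)

theorem abs_flowRate_sub_le (s s' r r' : ℝ) :
    |flowRate s r - flowRate s' r'| ≤ |s - s'| + |r - r'| := by
  have h1 := abs_max_sub_max_le_max 0 (max ((s + r - 2) / 2) (s - 2)) 0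
    (max ((s' + r' - 2) / 2) (s' - 2))
  have h2 := abs_max_sub_max_le_max ((s + r - 2) / 2) (s - 2) ((s' + r' - 2) / 2) (s' - 2)
  refine h1.trans (max_le (by rw [sub_self, abs_zero]; positivity) (h2.trans (max_le ?_ ?_)))
  · rw [show (s + r - 2) / 2 - (s' + r' - 2) / 2 = (s - s') / 2 + (r - r') / 2 by ring]
    refine (abs_add_le _ _).trans ?_
    rw [abs_div, abs_div, abs_two]
    have := abs_nonneg (s - s')
    have := abs_nonneg (r - r')
    linarith
  · rw [show s - 2 - (s' - 2) = s - s' by ring]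
    have := abs_nonneg (r - r')
    linarith

theorem flowRate_sub_le {s r r' : ℝ} (hs : s ≤ 2) :
    flowRate s r - flowRate s r' ≤ max (r - r') 0 / 2 := by
  rw [flowRate_of_le_two hs, flowRate_of_le_two hs]
  have h1 := le_max_left (r - r') 0
  have h2 := le_max_right (r - r') 0
  have h3 := le_max_left 0 ((s + r' - 2) / 2)
  have h4 := le_max_right 0 ((s + r' - 2) / 2)
  rcases max_cases 0 ((s + r - 2) / 2) with ⟨h, -⟩ | ⟨h, -⟩ <;> rw [h] <;> linarith

/-- The first component of `x - P x`, for the projection `P` onto the diamond, at a point `x` whose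
second coordinate has absolute value `r ≤ 1`. -/
def signedFlowRate (s r : ℝ) : ℝ := flowRate s r - flowRate (-s) r

theorem abs_signedFlowRate_sub_le (s s' r r' : ℝ) :
    |signedFlowRate s r - signedFlowRate s' r'| ≤ 2 * |s - s'| + 2 * |r - r'| := by
  have h1 := abs_flowRate_sub_le s s' r r'
  have h2 := abs_flowRate_sub_le (-s) (-s') r r'
  have h3 : |-s - -s'| = |s - s'| := by rw [← abs_neg]; congr 1; ring
  rw [h3] at h2
  unfold signedFlowRate
  rw [show flowRate s r - flowRate (-s) r - (flowRate s' r' - flowRate (-s') r') =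
    (flowRate s r - flowRate s' r') - (flowRate (-s) r - flowRate (-s') r') by ring]
  refine (abs_sub _ _).trans ?_
  linarith

theorem signedFlowRate_of_nonneg {s r : ℝ} (hs : 0 ≤ s) (hr : r ≤ 1) :
    signedFlowRate s r = flowRate s r := by
  rw [signedFlowRate, flowRate_eq_zero (s := -s) (by linarith) hr, sub_zero]

theorem signedFlowRate_neg (s r : ℝ) : signedFlowRate (-s) r = -signedFlowRate s r := by
  simp [signedFlowRate]

theorem signedFlowRate_eq_zero {s r : ℝ} (hs : |s| ≤ 1) (hr : r ≤ 1) : signedFlowRate s r = 0 := by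
  rw [signedFlowRate, flowRate_eq_zero (le_of_abs_le hs) hr,
    flowRate_eq_zero ((neg_le_abs s).trans hs) hr, sub_self]

/-- The viscous flow of the diamond up to the symmetries, which are encoded by the signs `i`
and `j`. The second component, of size `b`, agrees with the first one in size unless the point
projects onto a vertex. -/
theorem viscousFlow_diamond_of_sign {ε a r i j : ℝ} {ν : ℝ × ℝ} (ha : 0 ≤ a) (hr : 0 ≤ r)
    (hr1 : r ≤ 1) (hi : i = 1 ∨ i = -1) (hj : j = 1 ∨ j = -1)
    (h : IsViscousFlow diamond ε (i * a, j * r) ν) :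
    ∃ b, 0 ≤ b ∧ b ≤ r ∧ (a ≤ 2 → b = flowRate a r) ∧ ν.1 = 1 / ε * (i * flowRate a r) ∧
      ν.2 = 1 / ε * (j * b) := by
  obtain ⟨q, hq, rfl⟩ := h
  have habs : ∀ k ∈ diamond, k.1 + k.2 ≤ 2 ∧ k.1 - k.2 ≤ 2 ∧ -k.1 + k.2 ≤ 2 ∧ -k.1 - k.2 ≤ 2 := by
    intro k hk
    change |k.1| + |k.2| ≤ 2 at hk
    have h1 := le_abs_self k.1
    have h2 := neg_le_abs k.1
    have h3 := le_abs_self k.2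
    have h4 := neg_le_abs k.2
    refine ⟨?_, ?_, ?_, ?_⟩ <;> linarith
  have hmem : ∀ a' r' : ℝ, 0 ≤ a' → 0 ≤ r' → a' + r' ≤ 2 → (i * a', j * r') ∈ diamond := by
    intro a' r' h1 h2 h3
    change |i * a'| + |j * r'| ≤ 2
    rw [abs_mul, abs_mul, abs_of_sign hi, abs_of_sign hj, abs_of_nonneg h1, abs_of_nonneg h2]
    linarith
  -- The point lies inside the diamond, or projects onto a side, or onto the vertex `(2, 0)`.
  rcases le_total (a + r) 2 with h0 | h0
  · have hf : flowRate a r = 0 := by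
      rw [flowRate, max_eq_left]
      exact max_le (by linarith) (by linarith)
    have hqe : q = (i * a, j * r) :=
      hq.eq_of_variational (hmem a r ha hr h0) fun k _ => by simp
    exact ⟨0, le_rfl, hr, fun _ => hf.symm, by simp [hqe, hf], by simp [hqe]⟩
  rcases le_total (a - r) 2 with h1 | h1
  · have hf : flowRate a r = (a + r - 2) / 2 := by
      rw [flowRate, max_eq_left (by linarith : a - 2 ≤ (a + r - 2) / 2),
        max_eq_right (by linarith)]
    have hqe : q = (i * (a - (a + r - 2) / 2), j * (r - (a + r - 2) / 2)) := by
      refine hq.eq_of_variational (hmem _ _ (by linarith) (by linarith) (by linarith)) fun k hk => ?_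
      obtain ⟨k1, k2, k3, k4⟩ := habs k hk
      rcases hi with rfl | rfl <;> rcases hj with rfl | rfl <;> dsimp only <;> nlinarith
    refine ⟨(a + r - 2) / 2, by linarith, by linarith, fun _ => hf.symm, ?_, ?_⟩
    · simp only [hqe, hf, Prod.smul_fst, Prod.fst_sub, smul_eq_mul]
      ring
    · simp only [hqe, Prod.smul_snd, Prod.snd_sub, smul_eq_mul]
      ring
  · have hf : flowRate a r = a - 2 := by
      rw [flowRate, max_eq_right (by linarith : (a + r - 2) / 2 ≤ a - 2),
        max_eq_right (by linarith)]
    have hqe : q = (i * 2, j * 0) := by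
      refine hq.eq_of_variational (hmem _ _ (by linarith) (by linarith) (by linarith)) fun k hk => ?_
      obtain ⟨k1, k2, k3, k4⟩ := habs k hk
      rcases hi with rfl | rfl <;> rcases hj with rfl | rfl <;> dsimp only <;> nlinarith
    refine ⟨r, hr, le_rfl, fun ha2 => ?_, ?_, ?_⟩
    · rw [hf]
      linarith
    · simp only [hqe, hf, Prod.smul_fst, Prod.fst_sub, smul_eq_mul]
      ring
    · simp only [hqe, Prod.smul_snd, Prod.snd_sub, smul_eq_mul]
      ring

/-- The viscous flow of the diamond at `(σ, ζ)` with `|ζ| ≤ 1`: the second component has the sign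
of `ζ`, and for `0 ≤ σ ≤ 2` the two components have the same absolute value. The sign `j` of `ζ` is
arbitrary if `ζ = 0`, and then `b = 0`. -/
theorem viscousFlow_diamond {ε σ ζ : ℝ} {ν : ℝ × ℝ} (hζ : |ζ| ≤ 1)
    (h : IsViscousFlow diamond ε (σ, ζ) ν) :
    ν.1 = 1 / ε * signedFlowRate σ |ζ| ∧
    (∀ j : ℝ, (j = 1 ∨ j = -1) → 0 ≤ j * ζ → ∃ b, 0 ≤ b ∧ b ≤ j * ζ ∧
      (0 ≤ σ → σ ≤ 2 → b = flowRate σ |ζ|) ∧ ν.2 = 1 / ε * (j * b)) := by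
  obtain ⟨i, hi, hσ⟩ : ∃ i : ℝ, (i = 1 ∨ i = -1) ∧ σ = i * |σ| := by
    rcases le_or_gt 0 σ with h0 | h0
    · exact ⟨1, Or.inl rfl, by rw [abs_of_nonneg h0, one_mul]⟩
    · exact ⟨-1, Or.inr rfl, by rw [abs_of_neg h0]; ring⟩
  have key : ∀ j : ℝ, (j = 1 ∨ j = -1) → 0 ≤ j * ζ → ζ = j * |ζ| ∧ j * ζ = |ζ| := by
    rintro j (rfl | rfl) h0
    · rw [one_mul] at h0
      simp [abs_of_nonneg h0]
    · rw [abs_of_nonpos (by linarith)]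
      exact ⟨by ring, by ring⟩
  have hN : i * flowRate |σ| |ζ| = signedFlowRate σ |ζ| := by
    rw [← signedFlowRate_of_nonneg (abs_nonneg σ) hζ]
    rcases hi with rfl | rfl
    · rw [one_mul] at hσ
      rw [one_mul, ← hσ]
    · rw [neg_one_mul, ← signedFlowRate_neg]
      congr 1
      linarith
  have main : ∀ j : ℝ, (j = 1 ∨ j = -1) → 0 ≤ j * ζ → ν.1 = 1 / ε * signedFlowRate σ |ζ| ∧
      ∃ b, 0 ≤ b ∧ b ≤ j * ζ ∧
      (0 ≤ σ → σ ≤ 2 → b = flowRate σ |ζ|) ∧ ν.2 = 1 / ε * (j * b) := by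
    intro j hj h0
    obtain ⟨h1, h2⟩ := key j hj h0
    rw [hσ, h1] at h
    obtain ⟨b, hb, hb', hb2, hν1, hν2⟩ :=
      viscousFlow_diamond_of_sign (abs_nonneg σ) (abs_nonneg ζ) hζ hi hj h
    refine ⟨by rw [hν1, hN], b, hb, h2 ▸ hb', fun h3 h4 => ?_, hν2⟩
    rw [abs_of_nonneg h3] at hb2
    exact hb2 h4
  refine ⟨?_, fun j hj h0 => (main j hj h0).2⟩
  rcases le_total 0 ζ with h0 | h0
  · exact (main 1 (Or.inl rfl) (by linarith)).1
  · exact (main (-1) (Or.inr rfl) (by linarith)).1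

/-! ### The softening potential -/

/-- The properties of the thermodynamic force `ζ = -V'(z)`, as a function of `z`, that follow from
the assumptions on the softening potential `V`. -/
structure IsSofteningForce (g : ℝ → ℝ) (M : ℝ) : Prop where
  nonneg : 0 ≤ M
  mono : Monotone g
  odd : ∀ θ, g (-θ) = -g θ
  lipschitz : ∀ θ θ', |g θ - g θ'| ≤ M * |θ - θ'|
  eq_one_iff : ∀ θ, g θ = 1 ↔ 1 ≤ θ

namespace IsSofteningForce

variable {g : ℝ → ℝ} {M : ℝ}

theorem zero (hg : IsSofteningForce g M) : g 0 = 0 := by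
  have := hg.odd 0
  rw [neg_zero] at this
  linarith

theorem continuous (hg : IsSofteningForce g M) : Continuous g := by
  refine (LipschitzWith.of_dist_le_mul (K := ⟨M, hg.nonneg⟩) fun x y => ?_).continuous
  exact hg.lipschitz x y

theorem le_one (hg : IsSofteningForce g M) (θ : ℝ) : g θ ≤ 1 :=
  (hg.mono (le_max_left θ 1)).trans_eq ((hg.eq_one_iff _).2 (le_max_right θ 1))

theorem abs_le_one (hg : IsSofteningForce g M) (θ : ℝ) : |g θ| ≤ 1 := by
  have h1 := hg.le_one θ
  have h2 := hg.le_one (-θ)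
  rw [hg.odd] at h2
  exact abs_le.2 ⟨by linarith, h1⟩

theorem apply_nonneg (hg : IsSofteningForce g M) {θ : ℝ} (h : 0 ≤ θ) : 0 ≤ g θ :=
  hg.zero.symm.le.trans (hg.mono h)

theorem abs_apply (hg : IsSofteningForce g M) (θ : ℝ) : |g θ| = g |θ| := by
  rcases le_total 0 θ with h | h
  · rw [abs_of_nonneg h, abs_of_nonneg (hg.apply_nonneg h)]
  · rw [abs_of_nonpos h, hg.odd, abs_of_nonpos]
    have := hg.apply_nonneg (neg_nonneg.2 h)
    rw [hg.odd] at this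
    linarith

theorem lt_one (hg : IsSofteningForce g M) {θ : ℝ} (h : θ < 1) : g θ < 1 :=
  lt_of_le_of_ne (hg.le_one θ) fun h1 => absurd ((hg.eq_one_iff θ).1 h1) h.not_ge

/-- The action of a sign `j` on the force. -/
theorem sign_mul (hg : IsSofteningForce g M) {j : ℝ} (hj : j = 1 ∨ j = -1) (θ : ℝ) :
    j * g θ = g (j * θ) := by
  rcases hj with rfl | rfl
  · simp
  · rw [neg_one_mul, neg_one_mul, hg.odd]

end IsSofteningForce

theorem isSofteningForce_neg_deriv {V : ℝ → ℝ} (hV : ContDiff ℝ 2 V) {M : ℝ} (hM : 0 ≤ M)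
    (hV2 : ∀ θ, -M ≤ deriv (deriv V) θ ∧ deriv (deriv V) θ ≤ 0)
    (hVeven : ∀ θ, V θ = V (-θ)) (hV1 : ∀ θ, deriv V θ = -1 ↔ 1 ≤ θ) :
    IsSofteningForce (fun θ => -deriv V θ) M := by
  have hd : Differentiable ℝ (deriv V) :=
    (contDiff_succ_iff_deriv.1 (by exact_mod_cast hV : ContDiff ℝ (1 + 1) V)).2.2.differentiable
      (by simp)
  refine ⟨hM, fun a b hab => neg_le_neg (antitone_of_deriv_nonpos hd (fun θ => (hV2 θ).2) hab),
    fun θ => ?_, fun θ θ' => ?_, fun θ => by rw [neg_eq_iff_eq_neg]; exact hV1 θ⟩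
  · have h : V = fun θ => V (-θ) := funext hVeven
    have h2 := congrArg (fun f => deriv f (-θ)) h
    rw [deriv_comp_neg V (-θ), neg_neg] at h2
    rw [h2, neg_neg]
  · have := Convex.norm_image_sub_le_of_norm_deriv_le (f := deriv V) (C := M) (s := univ)
      (x := θ') (y := θ) (fun x _ => hd x) (fun x _ => by
        rw [Real.norm_eq_abs]
        exact abs_le.2 ⟨(hV2 x).1, (hV2 x).2.trans hM⟩) convex_univ (mem_univ _) (mem_univ _)
    rw [Real.norm_eq_abs, Real.norm_eq_abs] at this
    rw [show -deriv V θ - -deriv V θ' = -(deriv V θ - deriv V θ') by ring, abs_neg]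
    exact this

/-- Beyond `1` the potential is affine with slope `-1`, so that `V(θ) + |θ|` is bounded. -/
theorem softening_eq_of_one_le {V : ℝ → ℝ} (hV : ContDiff ℝ 2 V)
    (hV1 : ∀ θ, deriv V θ = -1 ↔ 1 ≤ θ) {θ : ℝ} (h : 1 ≤ θ) : V θ = V 1 + 1 - θ := by
  have hd : Differentiable ℝ V := hV.differentiable (by simp)
  have h2 : ∫ s in (1 : ℝ)..θ, deriv V s = V θ - V 1 :=
    intervalIntegral.integral_deriv_eq_sub (fun x _ => hd x)
      ((hV.continuous_deriv (by simp)).intervalIntegrable _ _)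
  have h3 : ∫ s in (1 : ℝ)..θ, deriv V s = ∫ _ in (1 : ℝ)..θ, (-1 : ℝ) := by
    refine intervalIntegral.integral_congr fun s hs => ?_
    rw [uIcc_of_le h] at hs
    exact (hV1 s).2 hs.1
  rw [h3, intervalIntegral.integral_const, smul_eq_mul] at h2
  linarith

/-! ### Integrals over the segment -/

theorem neg_half_le_half : (-1 / 2 : ℝ) ≤ 1 / 2 := by norm_num

/-- The extension to `ℝ` of a function on `Seg`, constant on both sides of the segment. -/
abbrev segExtend (g : Seg → ℝ) : ℝ → ℝ := IccExtend neg_half_le_half g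

theorem segExtend_coe (g : Seg → ℝ) (y : Seg) : segExtend g y = g y := IccExtend_val _ _ _

theorem integral_seg (f : ℝ → ℝ) : ∫ y : Seg, f y = ∫ y in (-1 / 2 : ℝ)..(1 / 2), f y := by
  rw [integral_subtype measurableSet_Icc f, intervalIntegral.integral_of_le neg_half_le_half,
    setIntegral_congr_set Ioc_ae_eq_Icc.symm]

theorem integral_seg_extend (g : Seg → ℝ) :
    ∫ y : Seg, g y = ∫ y in (-1 / 2 : ℝ)..(1 / 2), segExtend g y := by
  rw [← integral_seg]
  simp_rw [segExtend_coe]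

theorem ae_seg_iff {P : ℝ → Prop} :
    (∀ᵐ y : Seg, P y) ↔ ∀ᵐ y ∂volume.restrict (Icc (-1 / 2 : ℝ) (1 / 2)), P y :=
  (ae_restrict_iff_subtype measurableSet_Icc).symm

theorem integrable_seg_iff {f : ℝ → ℝ} :
    Integrable (fun y : Seg => f y) ↔ IntegrableOn f (Icc (-1 / 2 : ℝ) (1 / 2)) :=
  (integrableOn_iff_comap_subtypeVal measurableSet_Icc).symm

theorem intervalIntegrable_segExtend {g : Seg → ℝ} (hg : Integrable g) :
    IntervalIntegrable (segExtend g) volume (-1 / 2) (1 / 2) := by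
  rw [intervalIntegrable_iff_integrableOn_Icc_of_le neg_half_le_half, ← integrable_seg_iff]
  simpa only [segExtend_coe] using hg

theorem integrable_seg_of_continuous {f : Seg → ℝ} (hf : Continuous f) : Integrable f :=
  hf.integrable_of_hasCompactSupport (HasCompactSupport.of_compactSpace f)

theorem continuous_primitive {f : Seg → ℝ} (hf : Integrable f) :
    Continuous fun y : Seg => ∫ s in (-1 / 2 : ℝ)..y, segExtend f s := by
  have h := intervalIntegral.continuousOn_primitive_interval'
    (intervalIntegrable_segExtend hf) left_mem_uIcc
  rw [uIcc_of_le neg_half_le_half] at h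
  exact continuousOn_iff_continuous_domRestrict.1 h

/-- Integration by parts for two absolutely continuous functions that vanish at the left endpoint. -/
theorem integral_primitive_mul {a b : ℝ → ℝ} {x y : ℝ}
    (ha : IntervalIntegrable a volume x y) (hb : IntervalIntegrable b volume x y) :
    ∫ s in x..y, (∫ r in x..s, a r) * b s =
      (∫ s in x..y, a s) * (∫ s in x..y, b s) - ∫ s in x..y, a s * ∫ r in x..s, b r := by
  have hA := ha.absolutelyContinuousOnInterval_intervalIntegral (c := x) left_mem_uIcc
  have hB := hb.absolutelyContinuousOnInterval_intervalIntegral (c := x) left_mem_uIcc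
  have h := hA.integral_mul_deriv_eq_deriv_mul hB
  have e1 : ∫ s in x..y, (∫ r in x..s, a r) * deriv (fun s => ∫ r in x..s, b r) s =
      ∫ s in x..y, (∫ r in x..s, a r) * b s := by
    apply intervalIntegral.integral_congr_ae
    filter_upwards [hb.ae_hasDerivAt_integral] with s hs hs'
    rw [(hs (uIoc_subset_uIcc hs') x left_mem_uIcc).deriv]
  have e2 : ∫ s in x..y, deriv (fun s => ∫ r in x..s, a r) s * (∫ r in x..s, b r) =
      ∫ s in x..y, a s * (∫ r in x..s, b r) := by
    apply intervalIntegral.integral_congr_ae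
    filter_upwards [ha.ae_hasDerivAt_integral] with s hs hs'
    rw [(hs (uIoc_subset_uIcc hs') x left_mem_uIcc).deriv]
  rw [e1, e2] at h
  rw [h]
  simp

/-! ### Weak derivatives on the segment -/

theorem IsTest.eq_zero {φ : ℝ → ℝ} (hφ : IsTest φ) {y : ℝ} (hy : y ∉ Ioo (-1 / 2 : ℝ) (1 / 2)) :
    φ y = 0 :=
  image_eq_zero_of_notMem_tsupport fun h => hy (hφ.2.2 h)

theorem IsTest.exists_support_subset {φ : ℝ → ℝ} (hφ : IsTest φ) :
    ∃ r < (1 / 2 : ℝ), 0 ≤ r ∧ ∀ y, r < |y| → φ y = 0 := by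
  rcases (tsupport φ).eq_empty_or_nonempty with h | h
  · refine ⟨0, by norm_num, le_rfl, fun y _ => image_eq_zero_of_notMem_tsupport ?_⟩
    rw [h]
    exact notMem_empty y
  · obtain ⟨x, hx, hmax⟩ := IsCompact.exists_isMaxOn (f := fun y : ℝ => |y|) hφ.2.1 h
      continuous_abs.continuousOn
    have hx' := hφ.2.2 hx
    refine ⟨|x|, abs_lt.2 ⟨by linarith [hx'.1], hx'.2⟩, abs_nonneg x, fun y hy => ?_⟩
    exact image_eq_zero_of_notMem_tsupport fun h' => (hmax h').not_gt hy

theorem isTest_of_support {φ : ℝ → ℝ} (hφ : ContDiff ℝ ∞ φ) {r : ℝ} (hr : r < 1 / 2)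
    (h : ∀ y, r < |y| → φ y = 0) : IsTest φ := by
  have hsub : tsupport φ ⊆ Icc (-r) r := by
    refine closure_minimal (fun y hy => ?_) isClosed_Icc
    by_contra hy'
    refine hy (h y ?_)
    by_contra h2
    exact hy' (abs_le.1 (not_lt.1 h2))
  refine ⟨hφ, isCompact_Icc.of_isClosed_subset (isClosed_tsupport φ) hsub, hsub.trans ?_⟩
  exact Icc_subset_Ioo (by linarith) hr

/-- A test function with mean zero is the derivative of a test function. -/
theorem IsTest.exists_primitive {ψ : ℝ → ℝ} (hψ : IsTest ψ)
    (h0 : ∫ y in (-1 / 2 : ℝ)..(1 / 2), ψ y = 0) : ∃ φ, IsTest φ ∧ deriv φ = ψ := by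
  obtain ⟨r, hr, hr0, hsupp⟩ := hψ.exists_support_subset
  have hc : Continuous ψ := hψ.1.continuous
  have hd : ∀ y, HasDerivAt (fun y => ∫ s in (-1 / 2 : ℝ)..y, ψ s) (ψ y) y := fun y =>
    intervalIntegral.integral_hasDerivAt_right (hc.intervalIntegrable _ _)
      hc.aestronglyMeasurable.stronglyMeasurableAtFilter hc.continuousAt
  have hderiv : deriv (fun y => ∫ s in (-1 / 2 : ℝ)..y, ψ s) = ψ := funext fun y => (hd y).deriv
  refine ⟨fun y => ∫ s in (-1 / 2 : ℝ)..y, ψ s, isTest_of_support ?_ hr fun y hy => ?_, hderiv⟩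
  · rw [contDiff_infty_iff_deriv, hderiv]
    exact ⟨fun y => (hd y).differentiableAt, hψ.1⟩
  · rcases lt_abs.1 hy with h | h
    · have h1 := intervalIntegral.integral_add_adjacent_intervals
        (hc.intervalIntegrable (μ := volume) (-1 / 2) y) (hc.intervalIntegrable y (1 / 2))
      have h2 : ∫ s in y..(1 / 2), ψ s = ∫ s in y..(1 / 2), (0 : ℝ) := by
        refine intervalIntegral.integral_congr fun s hs => ?_
        refine hsupp s (lt_abs.2 (Or.inl ?_))
        have := hs.1
        have : r < min y (1 / 2) := lt_min h hr
        exact this.trans_le hs.1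
      rw [h2, h0, intervalIntegral.integral_zero, add_zero] at h1
      exact h1
    · have h2 : ∫ s in (-1 / 2 : ℝ)..y, ψ s = ∫ s in (-1 / 2 : ℝ)..y, (0 : ℝ) := by
        refine intervalIntegral.integral_congr fun s hs => ?_
        refine hsupp s (lt_abs.2 (Or.inr ?_))
        have : max (-1 / 2) y < -r := max_lt (by linarith) (by linarith)
        linarith [hs.2]
      change ∫ s in (-1 / 2 : ℝ)..y, ψ s = 0
      rw [h2, intervalIntegral.integral_zero]

theorem exists_isTest_integral_eq_one :
    ∃ ρ, IsTest ρ ∧ ∫ y in (-1 / 2 : ℝ)..(1 / 2), ρ y = 1 := by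
  let b : ContDiffBump (0 : ℝ) := ⟨1 / 8, 1 / 4, by norm_num, by norm_num⟩
  have hz : ∀ y : ℝ, 1 / 4 < |y| → b.normed volume y = 0 := by
    intro y hy
    have : y ∉ Function.support (b.normed volume) := by
      rw [b.support_normed_eq]
      simp only [Metric.mem_ball, dist_zero_right, Real.norm_eq_abs, not_lt]
      exact hy.le
    simpa using this
  have ht : IsTest (b.normed volume) := isTest_of_support b.contDiff_normed (by norm_num) hz
  refine ⟨b.normed volume, ht, ?_⟩
  rw [intervalIntegral.integral_of_le neg_half_le_half]
  refine (setIntegral_eq_integral_of_forall_compl_eq_zero fun y hy =>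
    ht.eq_zero fun h => hy ?_).trans (b.integral_normed (μ := volume))
  exact Ioo_subset_Ioc_self h

/-- The lemma of du Bois-Reymond: a function with vanishing weak derivative is constant. -/
theorem IsWeakDeriv.ae_eq_const {f : Seg → ℝ} (hf : Integrable f) (h : IsWeakDeriv f 0) :
    ∃ C : ℝ, f =ᵐ[volume] fun _ => C := by
  -- A test function `ψ` differs by a derivative from `(∫ ψ) ρ`, where `∫ ρ = 1`.
  obtain ⟨ρ, hρ, hρ1⟩ := exists_isTest_integral_eq_one
  have hF : IntervalIntegrable (segExtend f) volume (-1 / 2) (1 / 2) :=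
    intervalIntegrable_segExtend hf
  have hI : ∀ φ, IsTest φ → ∫ y in (-1 / 2 : ℝ)..(1 / 2), segExtend f y * deriv φ y = 0 := by
    intro φ hφ
    have := h φ hφ
    simp only [Pi.zero_apply, zero_mul, integral_zero, neg_zero] at this
    rw [← integral_seg]
    simpa only [segExtend_coe] using this
  set C := ∫ y in (-1 / 2 : ℝ)..(1 / 2), segExtend f y * ρ y with hC
  have key : ∀ ψ, IsTest ψ →
      ∫ y in (-1 / 2 : ℝ)..(1 / 2), ψ y • (segExtend f y - C) = 0 := by
    intro ψ hψ
    have hψc := hψ.1.continuous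
    have hρc := hρ.1.continuous
    set m := ∫ y in (-1 / 2 : ℝ)..(1 / 2), ψ y with hm
    have ht : IsTest fun y => ψ y - m * ρ y := by
      obtain ⟨r, hr, -, hr'⟩ := hψ.exists_support_subset
      obtain ⟨s, hs, -, hs'⟩ := hρ.exists_support_subset
      refine isTest_of_support (hψ.1.sub (contDiff_const.mul hρ.1)) (max_lt hr hs) fun y hy => ?_
      rw [hr' y ((le_max_left _ _).trans_lt hy), hs' y ((le_max_right _ _).trans_lt hy)]
      ring
    obtain ⟨φ, hφ, hφ'⟩ := ht.exists_primitive (by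
      rw [intervalIntegral.integral_sub (hψc.intervalIntegrable _ _)
        ((hρc.intervalIntegrable _ _).const_mul m), intervalIntegral.integral_const_mul, hρ1, ← hm]
      ring)
    have h1 := hI φ hφ
    rw [hφ'] at h1
    have e : ∀ y, ψ y • (segExtend f y - C) =
        segExtend f y * (ψ y - m * ρ y) + (m * (segExtend f y * ρ y) - C * ψ y) := by
      intro y
      rw [smul_eq_mul]
      ring
    simp_rw [e]
    have hi1 : IntervalIntegrable (fun y => segExtend f y * (ψ y - m * ρ y)) volume
        (-1 / 2) (1 / 2) := hF.mul_continuousOn (by fun_prop)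
    rw [intervalIntegral.integral_add hi1 (((hF.mul_continuousOn hρc.continuousOn).const_mul m).sub
        ((hψc.intervalIntegrable _ _).const_mul C)), h1,
      intervalIntegral.integral_sub ((hF.mul_continuousOn hρc.continuousOn).const_mul m)
        ((hψc.intervalIntegrable _ _).const_mul C), intervalIntegral.integral_const_mul,
      intervalIntegral.integral_const_mul, ← hm, ← hC]
    ring
  refine ⟨C, ?_⟩
  have hloc : LocallyIntegrableOn (fun y => segExtend f y - C) (Ioo (-1 / 2 : ℝ) (1 / 2)) := by
    refine IntegrableOn.locallyIntegrableOn ?_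
    have := hF.sub (intervalIntegrable_const (c := C))
    rw [intervalIntegrable_iff_integrableOn_Ioo_of_le neg_half_le_half] at this
    exact this
  have hae := isOpen_Ioo.ae_eq_zero_of_integral_contDiff_smul_eq_zero hloc fun g hg hc hs => by
    have ht : IsTest g := ⟨hg, hc, hs⟩
    rw [← key g ht, intervalIntegral.integral_of_le neg_half_le_half]
    refine (setIntegral_eq_integral_of_forall_compl_eq_zero fun y hy => ?_).symm
    rw [ht.eq_zero fun h => hy (Ioo_subset_Ioc_self h), zero_smul]
  have h2 : ∀ᵐ y : Seg, segExtend f y - C = 0 := by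
    rw [ae_seg_iff (P := fun y => segExtend f y - C = 0), ← restrict_Ioo_eq_restrict_Icc,
      ae_restrict_iff' measurableSet_Ioo]
    exact hae
  filter_upwards [h2] with y hy
  rw [segExtend_coe] at hy
  linarith

/-- A function with integrable weak derivative is absolutely continuous. -/
theorem IsWeakDeriv.ae_eq_primitive {u v : Seg → ℝ} (hu : Integrable u) (hv : Integrable v)
    (h : IsWeakDeriv u v) :
    ∃ C : ℝ, u =ᵐ[volume] fun y : Seg => C + ∫ s in (-1 / 2 : ℝ)..y, segExtend v s := by
  have hv' := intervalIntegrable_segExtend hv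
  have hWc : Continuous fun y : Seg => ∫ s in (-1 / 2 : ℝ)..y, segExtend v s :=
    continuous_primitive hv
  have hW : Integrable fun y : Seg => ∫ s in (-1 / 2 : ℝ)..y, segExtend v s :=
    integrable_seg_of_continuous hWc
  have hweak : IsWeakDeriv (fun y : Seg => u y - ∫ s in (-1 / 2 : ℝ)..y, segExtend v s) 0 := by
    intro φ hφ
    have hdc : Continuous (deriv φ) := hφ.1.continuous_deriv (by simp)
    have hb : Continuous fun y : Seg => deriv φ y := hdc.comp continuous_subtype_val
    have h1 := integral_primitive_mul hv' (hdc.intervalIntegrable (-1 / 2) (1 / 2))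
    have h2 : ∀ y : ℝ, ∫ r in (-1 / 2 : ℝ)..y, deriv φ r = φ y := by
      intro y
      rw [intervalIntegral.integral_deriv_eq_sub
        (fun x _ => (hφ.1.differentiable (by simp)) x) (hdc.intervalIntegrable _ _),
        hφ.eq_zero (y := -1 / 2) (by simp), sub_zero]
    simp_rw [h2] at h1
    rw [hφ.eq_zero (y := 1 / 2) (by simp), mul_zero, zero_sub, ← integral_seg, ← integral_seg] at h1
    simp_rw [segExtend_coe] at h1
    have e : ∀ y : Seg, (u y - ∫ s in (-1 / 2 : ℝ)..y, segExtend v s) * deriv φ y =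
      u y * deriv φ y - (∫ s in (-1 / 2 : ℝ)..y, segExtend v s) * deriv φ y := fun y => by ring
    simp_rw [e]
    obtain ⟨B, hB⟩ : ∃ B, ∀ y : Seg, ‖deriv φ y‖ ≤ B := by
      obtain ⟨B, hB⟩ := isCompact_univ.exists_bound_of_continuousOn hb.continuousOn
      exact ⟨B, fun y => hB y (mem_univ y)⟩
    have hi : Integrable fun y : Seg => (∫ s in (-1 / 2 : ℝ)..y, segExtend v s) * deriv φ y :=
      integrable_seg_of_continuous (hWc.mul hb)
    rw [integral_sub (hu.mul_bdd hb.aestronglyMeasurable (ae_of_all _ hB)) hi, h φ hφ, h1]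
    simp
  obtain ⟨C, hC⟩ := hweak.ae_eq_const (hu.sub hW)
  refine ⟨C, ?_⟩
  filter_upwards [hC] with y hy
  rw [Pi.sub_apply] at hy
  linarith

/-- A Sobolev function `u` with derivative `v` and boundary values `∓t/2`: the mean value of `v`,
and integration by parts against the primitive of an integrable function. -/
theorem IsWeakDeriv.of_sameTrace {u : Seg → ℝ} {v : Seg → ℝ} {t : ℝ} (hu : Integrable u)
    (hv : Integrable v) (h : IsWeakDeriv u v) (htr : SameTrace u (t • idL2 : L2)) :
    ∫ y, v y = t ∧ ∀ g : Seg → ℝ, Integrable g →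
      ∫ y, u y * g y = t / 2 * (∫ y, g y) -
        ∫ y : Seg, v y * ∫ s in (-1 / 2 : ℝ)..y, segExtend g s := by
  obtain ⟨C, hC⟩ := h.ae_eq_primitive hu hv
  have hv' := intervalIntegrable_segExtend hv
  obtain ⟨ũ, w, h1, h2, h3, h4⟩ := htr
  have hWc : ContinuousOn (fun y => C + ∫ s in (-1 / 2 : ℝ)..y, segExtend v s)
      (Icc (-1 / 2) (1 / 2)) := by
    have := intervalIntegral.continuousOn_primitive_interval' hv' left_mem_uIcc
    rw [uIcc_of_le neg_half_le_half] at this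
    exact continuousOn_const.add this
  have e1 : EqOn (segExtend ũ) (fun y => C + ∫ s in (-1 / 2 : ℝ)..y, segExtend v s)
      (Icc (-1 / 2) (1 / 2)) := by
    refine Measure.eqOn_Icc_of_ae_eq volume (by norm_num) ?_
      (ũ.continuous.Icc_extend' (h := neg_half_le_half)).continuousOn hWc
    refine (ae_seg_iff (P := fun y => segExtend ũ y =
      C + ∫ s in (-1 / 2 : ℝ)..y, segExtend v s)).1 ?_
    filter_upwards [hC, h1] with y hy hy'
    rw [segExtend_coe, ← hy', hy]
  have e2 : EqOn (segExtend w) (fun y => t * y) (Icc (-1 / 2) (1 / 2)) := by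
    refine Measure.eqOn_Icc_of_ae_eq volume (by norm_num) ?_
      (w.continuous.Icc_extend' (h := neg_half_le_half)).continuousOn (by fun_prop)
    refine (ae_seg_iff (P := fun y => segExtend w y = t * y)).1 ?_
    filter_upwards [h2, Lp.coeFn_smul t idL2, idL2_ae] with y hy hy' hy''
    rw [segExtend_coe, ← hy, hy', Pi.smul_apply, hy'', smul_eq_mul]
  have hl : (-1 / 2 : ℝ) ∈ Icc (-1 / 2 : ℝ) (1 / 2) := by norm_num
  have hr : (1 / 2 : ℝ) ∈ Icc (-1 / 2 : ℝ) (1 / 2) := by norm_num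
  have c1 := e1 hl
  have c2 := e1 hr
  have c3 := e2 hl
  have c4 := e2 hr
  have d1 : segExtend ũ (-1 / 2) = ũ Seg.left := segExtend_coe ũ Seg.left
  have d2 : segExtend ũ (1 / 2) = ũ Seg.right := segExtend_coe ũ Seg.right
  have d3 : segExtend w (-1 / 2) = w Seg.left := segExtend_coe w Seg.left
  have d4 : segExtend w (1 / 2) = w Seg.right := segExtend_coe w Seg.right
  simp only [intervalIntegral.integral_same, add_zero] at c1 c2 c3 c4
  have hCt : C = -t / 2 := by linarith
  have hvt : ∫ y, v y = t := by
    rw [integral_seg_extend]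
    linarith
  refine ⟨hvt, fun g hg => ?_⟩
  have hg' := intervalIntegrable_segExtend hg
  have hp := integral_primitive_mul hv' hg'
  have f1 : ∫ y, u y * g y =
      ∫ y in (-1 / 2 : ℝ)..(1 / 2), (C * segExtend g y +
        (∫ s in (-1 / 2 : ℝ)..y, segExtend v s) * segExtend g y) := by
    rw [← integral_seg]
    refine integral_congr_ae ?_
    filter_upwards [hC] with y hy
    rw [hy, segExtend_coe]
    ring
  rw [f1, intervalIntegral.integral_add (hg'.const_mul C) (hg'.continuousOn_mul
    (intervalIntegral.continuousOn_primitive_interval' hv' left_mem_uIcc)),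
    intervalIntegral.integral_const_mul, hp, ← integral_seg_extend, ← integral_seg_extend, hvt,
    hCt, ← integral_seg (fun s => segExtend v s * ∫ r in (-1 / 2 : ℝ)..s, segExtend g r)]
  simp_rw [segExtend_coe]
  ring

/-! ### Evolutions in `L²` -/

/-- The integral form of the lemma of Gronwall, with zero initial value. -/
theorem gronwall_integral {n : ℝ → ℝ} (hn : Continuous n) {L : ℝ} (hL : 0 ≤ L)
    (h0 : ∀ t, 0 ≤ t → 0 ≤ n t) (h : ∀ t, 0 ≤ t → n t ≤ L * ∫ s in (0 : ℝ)..t, n s) {t : ℝ}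
    (ht : 0 ≤ t) : n t = 0 := by
  have hd : ∀ x, HasDerivAt (fun y => ∫ s in (0 : ℝ)..y, n s) (n x) x := fun x =>
    intervalIntegral.integral_hasDerivAt_right (hn.intervalIntegrable _ _)
      hn.aestronglyMeasurable.stronglyMeasurableAtFilter hn.continuousAt
  have hz := eq_zero_of_abs_deriv_le_mul_abs_self_of_eq_zero_right (K := L) (a := 0) (b := t)
    (f := fun y => ∫ s in (0 : ℝ)..y, n s) (f' := n)
    (fun x _ => (hd x).continuousAt.continuousWithinAt)
    (fun x _ => (hd x).hasDerivWithinAt) intervalIntegral.integral_same (fun x hx => by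
      rw [Real.norm_eq_abs, Real.norm_eq_abs, abs_of_nonneg (h0 x hx.1)]
      exact (h x hx.1).trans (mul_le_mul_of_nonneg_left (le_abs_self _) hL)) t ⟨ht, le_rfl⟩
  have := h t ht
  rw [hz, mul_zero] at this
  exact le_antisymm this (h0 t ht)

namespace HasTimeDeriv

variable {E F : Type*} [NormedAddCommGroup E] [NormedSpace ℝ E] [NormedAddCommGroup F]
  [NormedSpace ℝ F]

theorem intervalIntegrable {f f' : ℝ → E} (h : HasTimeDeriv f f') {a b : ℝ} (ha : 0 ≤ a)
    (hb : 0 ≤ b) : IntervalIntegrable f' volume a b := by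
  have key : ∀ T, 0 ≤ T → IntervalIntegrable f' volume 0 T := by
    intro T hT
    rcases hT.eq_or_lt with rfl | hT'
    · exact IntervalIntegrable.refl
    · rw [intervalIntegrable_iff_integrableOn_Ioc_of_le hT]
      exact (h.1 T hT').integrable one_le_two
  exact (key a ha).symm.trans (key b hb)

theorem sub_eq_integral {f f' : ℝ → E} (h : HasTimeDeriv f f') {a b : ℝ} (ha : 0 ≤ a)
    (hb : 0 ≤ b) : f b - f a = ∫ s in a..b, f' s := by
  rw [h.2 a ha, h.2 b hb, add_sub_add_left_eq_sub, intervalIntegral.integral_interval_sub_left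
    (h.intervalIntegrable le_rfl hb) (h.intervalIntegrable le_rfl ha)]

theorem continuousOn {f f' : ℝ → E} (h : HasTimeDeriv f f') : ContinuousOn f (Ici 0) := by
  intro t ht
  have h1 : ContinuousOn f (Icc 0 (t + 1)) := by
    have h2 := intervalIntegral.continuousOn_primitive_interval'
      (h.intervalIntegrable le_rfl (by linarith [mem_Ici.1 ht] : (0 : ℝ) ≤ t + 1)) left_mem_uIcc
    rw [uIcc_of_le (by linarith [mem_Ici.1 ht])] at h2
    exact (continuousOn_const (c := f 0)).add h2 |>.congr fun s hs => h.2 s hs.1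
  have h3 := h1 t ⟨ht, by linarith⟩
  refine h3.mono_of_mem_nhdsWithin ?_
  rw [← Ici_inter_Iic]
  exact inter_mem self_mem_nhdsWithin (mem_nhdsWithin_of_mem_nhds (Iic_mem_nhds (by linarith)))

theorem continuous_max {f f' : ℝ → E} (h : HasTimeDeriv f f') :
    Continuous fun t => f (max t 0) :=
  h.continuousOn.comp_continuous (by fun_prop) fun t => le_max_right t 0

theorem const_sub {f f' : ℝ → E} (h : HasTimeDeriv f f') (c : E) :
    HasTimeDeriv (fun t => c - f t) (fun t => -f' t) := by
  refine ⟨fun T hT => (h.1 T hT).neg, fun t ht => ?_⟩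
  beta_reduce
  rw [h.2 t ht, intervalIntegral.integral_neg]
  abel

theorem sub {f f' g g' : ℝ → E} (hf : HasTimeDeriv f f') (hg : HasTimeDeriv g g') :
    HasTimeDeriv (fun t => f t - g t) (fun t => f' t - g' t) := by
  refine ⟨fun T hT => (hf.1 T hT).sub (hg.1 T hT), fun t ht => ?_⟩
  beta_reduce
  rw [hf.2 t ht, hg.2 t ht, intervalIntegral.integral_sub (hf.intervalIntegrable le_rfl ht)
    (hg.intervalIntegrable le_rfl ht)]
  abel

theorem clm [CompleteSpace E] [CompleteSpace F] {f f' : ℝ → E} (h : HasTimeDeriv f f')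
    (L : E →L[ℝ] F) : HasTimeDeriv (fun t => L (f t)) (fun t => L (f' t)) := by
  refine ⟨fun T hT => L.comp_memLp' (h.1 T hT), fun t ht => ?_⟩
  beta_reduce
  rw [h.2 t ht, map_add, L.intervalIntegral_comp_comm (h.intervalIntegrable le_rfl ht)]

theorem const_smul [CompleteSpace E] {f f' : ℝ → E} (h : HasTimeDeriv f f') (c : ℝ) :
    HasTimeDeriv (fun t => c • f t) (fun t => c • f' t) :=
  h.clm (c • ContinuousLinearMap.id ℝ E)

end HasTimeDeriv

theorem L2.inner_eq (f g : L2) : inner ℝ f g = ∫ y, f y * g y := by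
  rw [L2.inner_def]
  refine integral_congr_ae (ae_of_all _ fun y => ?_)
  simp only [RCLike.inner_apply, conj_trivial]
  ring

theorem L2.integrable (f : L2) : Integrable (f : Seg → ℝ) := (Lp.memLp f).integrable one_le_two

theorem L2.integrable_mul (f g : L2) : Integrable fun y => f y * g y :=
  (Lp.memLp f).integrable_mul (Lp.memLp g)

theorem L2.inner_one (f : L2) : inner ℝ oneL2 f = ∫ y, f y := by
  rw [L2.inner_eq]
  refine integral_congr_ae ?_
  filter_upwards [oneL2_ae] with y hy
  rw [hy, one_mul]

/-- The mean value of an evolution in `L²` is an evolution in `ℝ`. -/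
theorem HasTimeDeriv.integral {f f' : ℝ → L2} (h : HasTimeDeriv f f') :
    HasTimeDeriv (fun t => ∫ y, f t y) (fun t => ∫ y, f' t y) := by
  simpa only [innerSL_apply_apply, L2.inner_one] using h.clm (innerSL ℝ oneL2)

/-- Comparison principle in `L²`: if `x ≤ 0` on `A` at the initial time, and `ẋ ≤ L x⁺` on `A`,
then `x ≤ 0` on `A` at all times. The norm of `1_A x⁺` satisfies the inequality of Gronwall. -/
theorem HasTimeDeriv.nonpos_on {x f : ℝ → L2} (hx : HasTimeDeriv x f) {A : Set Seg}
    (hA : MeasurableSet A) {L : ℝ} (hL : 0 ≤ L) (h0 : ∀ᵐ y, y ∈ A → x 0 y ≤ 0)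
    (hf : ∀ᵐ t ∂volume.restrict (Ioi (0 : ℝ)), ∀ᵐ y, y ∈ A → f t y ≤ L * max (x t y) 0)
    {t : ℝ} (ht : 0 ≤ t) : ∀ᵐ y, y ∈ A → x t y ≤ 0 := by
  have hmem : ∀ v : L2, MemLp (A.indicator fun y => max (v y) 0) 2 := fun v =>
    (Lp.memLp v).pos_part.indicator hA
  let h : L2 → L2 := fun v => (hmem v).toLp
  have hae : ∀ v, h v =ᵐ[volume] A.indicator fun y => max (v y) 0 := fun v => (hmem v).coeFn_toLp
  have hlip : ∀ v w, ‖h v - h w‖ ≤ ‖v - w‖ := by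
    intro v w
    refine Lp.norm_le_norm_of_ae_le ?_
    filter_upwards [hae v, hae w, Lp.coeFn_sub (h v) (h w), Lp.coeFn_sub v w] with y h1 h2 h3 h4
    rw [h3, h4, Pi.sub_apply, Pi.sub_apply, h1, h2]
    by_cases hy : y ∈ A
    · rw [indicator_of_mem hy, indicator_of_mem hy]
      exact abs_max_sub_max_le_abs _ _ _
    · rw [indicator_of_notMem hy, indicator_of_notMem hy]
      simp
  have hcont : Continuous h :=
    (LipschitzWith.of_dist_le_mul (K := 1) fun v w => by
      rw [dist_eq_norm, dist_eq_norm, NNReal.coe_one, one_mul]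
      exact hlip v w).continuous
  have hself : ∀ v, inner ℝ (h v) v = ‖h v‖ ^ 2 := by
    intro v
    rw [← real_inner_self_eq_norm_sq, L2.inner_eq, L2.inner_eq]
    refine integral_congr_ae ?_
    filter_upwards [hae v] with y h1
    rw [h1]
    by_cases hy : y ∈ A
    · rw [indicator_of_mem hy]
      rcases max_cases (v y) 0 with ⟨h2, -⟩ | ⟨h2, -⟩ <;> rw [h2]
      simp
    · rw [indicator_of_notMem hy]
      simp
  have hn : Continuous fun s => ‖h (x (max s 0))‖ := (hcont.comp hx.continuous_max).norm
  have main : ∀ t, 0 ≤ t → ‖h (x (max t 0))‖ ≤ L * ∫ s in (0 : ℝ)..t, ‖h (x (max s 0))‖ := by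
    intro t ht
    have h1 := (hx.clm (innerSL ℝ (h (x t)))).2 t ht
    simp only [innerSL_apply_apply] at h1
    rw [hself] at h1
    have h2 : inner ℝ (h (x t)) (x 0) ≤ 0 := by
      rw [L2.inner_eq]
      refine integral_nonpos_of_ae ?_
      filter_upwards [hae (x t), h0] with y h3 h4
      rw [h3]
      by_cases hy : y ∈ A
      · rw [indicator_of_mem hy]
        exact mul_nonpos_of_nonneg_of_nonpos (le_max_right _ _) (h4 hy)
      · rw [indicator_of_notMem hy]
        simp
    have h3 : ∫ s in (0 : ℝ)..t, inner ℝ (h (x t)) (f s) ≤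
        ∫ s in (0 : ℝ)..t, L * ‖h (x t)‖ * ‖h (x (max s 0))‖ := by
      refine intervalIntegral.integral_mono_ae_restrict ht
        ((hx.clm (innerSL ℝ (h (x t)))).intervalIntegrable le_rfl ht)
        ((hn.const_mul _).intervalIntegrable _ _) ?_
      have hf' : ∀ᵐ s ∂volume.restrict (Icc (0 : ℝ) t),
          ∀ᵐ y, y ∈ A → f s y ≤ L * max (x s y) 0 := by
        rw [← restrict_Ioc_eq_restrict_Icc]
        exact ae_restrict_of_ae_restrict_of_subset (fun s hs => hs.1) hf
      filter_upwards [hf', ae_restrict_mem measurableSet_Icc] with s hs hs0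
      rw [max_eq_left hs0.1]
      have h4 : inner ℝ (h (x t)) (f s) ≤ L * inner ℝ (h (x t)) (h (x s)) := by
        rw [L2.inner_eq, L2.inner_eq, ← integral_const_mul]
        refine integral_mono_ae (L2.integrable_mul _ _) ((L2.integrable_mul _ _).const_mul L) ?_
        filter_upwards [hae (x t), hae (x s), hs] with y h5 h6 h7
        rw [h5, h6]
        by_cases hy : y ∈ A
        · rw [indicator_of_mem hy, indicator_of_mem hy]
          calc max (x t y) 0 * f s y ≤ max (x t y) 0 * (L * max (x s y) 0) :=
                mul_le_mul_of_nonneg_left (h7 hy) (le_max_right _ _)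
            _ = _ := by ring
        · rw [indicator_of_notMem hy]
          simp
      refine h4.trans ?_
      rw [mul_assoc]
      exact mul_le_mul_of_nonneg_left (real_inner_le_norm _ _) hL
    rw [intervalIntegral.integral_const_mul] at h3
    rw [max_eq_left ht]
    rcases (norm_nonneg (h (x t))).eq_or_lt with h5 | h5
    · rw [← h5]
      exact mul_nonneg hL (intervalIntegral.integral_nonneg ht fun s _ => norm_nonneg _)
    · refine le_of_mul_le_mul_left ?_ h5
      calc ‖h (x t)‖ * ‖h (x t)‖ = ‖h (x t)‖ ^ 2 := by ring
        _ ≤ L * ‖h (x t)‖ * ∫ s in (0 : ℝ)..t, ‖h (x (max s 0))‖ := by linarith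
        _ = _ := by ring
  have hz := gronwall_integral hn hL (fun s _ => norm_nonneg _) main ht
  rw [max_eq_left ht, norm_eq_zero] at hz
  have h1 := hae (x t)
  rw [hz] at h1
  filter_upwards [h1, Lp.coeFn_zero ℝ 2 (volume : Measure Seg)] with y h2 h3 hy
  rw [h3, indicator_of_mem hy] at h2
  exact (le_max_left _ _).trans h2.symm.le

instance L2.isOrderedModule : IsOrderedModule ℝ L2 :=
  IsOrderedModule.of_smul_nonneg fun a ha f hf => by
    rw [← Lp.coeFn_nonneg] at hf ⊢
    filter_upwards [hf, Lp.coeFn_smul a f] with y h1 h2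
    rw [h2]
    exact mul_nonneg ha h1

theorem HasTimeDeriv.mono {x f : ℝ → L2} (hx : HasTimeDeriv x f)
    (hf : ∀ᵐ t ∂volume.restrict (Ioi (0 : ℝ)), ∀ᵐ y, 0 ≤ f t y) {s t : ℝ} (hs : 0 ≤ s)
    (hst : s ≤ t) : ∀ᵐ y, x s y ≤ x t y := by
  have h1 : 0 ≤ x t - x s := by
    rw [hx.sub_eq_integral hs (hs.trans hst), intervalIntegral.integral_of_le hst]
    refine integral_nonneg_of_ae ?_
    have := ae_restrict_of_ae_restrict_of_subset
      (show Ioc s t ⊆ Ioi 0 from fun r hr => hs.trans_lt hr.1) hf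
    filter_upwards [this] with r hr
    rw [Pi.zero_apply, ← Lp.coeFn_nonneg]
    exact hr
  exact (Lp.coeFn_le _ _).2 (sub_nonneg.1 h1)

/-! ### The initial profile -/

/-- The assumptions on the initial value `z₀` of the internal variable. -/
structure IsInitialProfile (z₀ : ℝ → ℝ) : Prop where
  odd : ∀ y ∈ Icc (-1 / 2 : ℝ) (1 / 2), z₀ (-y) = -z₀ y
  continuousOn : ContinuousOn z₀ (Ico (-1 / 2 : ℝ) 0 ∪ Ioc 0 (1 / 2))
  tendsto : Tendsto z₀ (𝓝[>] 0) (𝓝 1)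
  range : ∀ y ∈ Ioc (0 : ℝ) (1 / 2), 0 ≤ z₀ y ∧ z₀ y < 1

theorem volume_seg_univ : volume.real (univ : Set Seg) = 1 := by
  have h : (volume (univ : Set Seg)) = 1 := by
    rw [Measure.Subtype.volume_univ nullMeasurableSet_Icc, Real.volume_Icc]
    norm_num
  rw [measureReal_def, h, ENNReal.toReal_one]

theorem ae_seg_ne_zero : ∀ᵐ y : Seg, (y : ℝ) ≠ 0 := by
  rw [ae_seg_iff (P := fun y => y ≠ 0)]
  exact ae_restrict_of_ae (compl_mem_ae_iff.2 (measure_singleton (0 : ℝ)))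

/-- The part of the segment where `y` has the sign `j`. -/
def Seg.side (j : ℝ) : Set Seg := {y | 0 < j * (y : ℝ)}

theorem Seg.measurableSet_side (j : ℝ) : MeasurableSet (Seg.side j) :=
  measurableSet_lt measurable_const (measurable_const.mul measurable_subtype_coe)

theorem Seg.exists_mem_side {y : Seg} (hy : (y : ℝ) ≠ 0) :
    ∃ j : ℝ, (j = 1 ∨ j = -1) ∧ y ∈ Seg.side j := by
  rcases lt_or_gt_of_ne hy with h | h
  · exact ⟨-1, Or.inr rfl, by change 0 < -1 * (y : ℝ); linarith⟩
  · exact ⟨1, Or.inl rfl, by change 0 < 1 * (y : ℝ); linarith⟩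

theorem ae_seg_of_side {P : Seg → Prop}
    (h : ∀ j : ℝ, (j = 1 ∨ j = -1) → ∀ᵐ y, y ∈ Seg.side j → P y) : ∀ᵐ y, P y := by
  filter_upwards [ae_seg_ne_zero, h 1 (Or.inl rfl), h (-1) (Or.inr rfl)] with y h0 h1 h2
  obtain ⟨j, rfl | rfl, hy⟩ := Seg.exists_mem_side h0
  · exact h1 hy
  · exact h2 hy

theorem integral_eq_add_side {v : Seg → ℝ} (hv : Integrable v) :
    ∫ y, v y = (∫ y in Seg.side 1, v y) + ∫ y in Seg.side (-1), v y := by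
  rw [← integral_add_compl (Seg.measurableSet_side 1) hv]
  congr 1
  refine setIntegral_congr_set ?_
  filter_upwards [ae_seg_ne_zero] with y hy
  refine propext (show ¬ (0 < 1 * (y : ℝ)) ↔ 0 < -1 * (y : ℝ) from
    ⟨fun h => ?_, fun h => by linarith⟩)
  have := lt_of_le_of_ne (not_lt.1 h) (by rwa [one_mul])
  linarith

theorem IsInitialProfile.side {z₀ : ℝ → ℝ} (h : IsInitialProfile z₀) {j : ℝ}
    (hj : j = 1 ∨ j = -1) {y : Seg} (hy : y ∈ Seg.side j) :
    0 ≤ j * z₀ y ∧ j * z₀ y < 1 ∧ |z₀ y| = j * z₀ y := by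
  have hy' : 0 < j * (y : ℝ) := hy
  have key : 0 ≤ j * z₀ y ∧ j * z₀ y < 1 := by
    rcases hj with rfl | rfl
    · rw [one_mul] at hy' ⊢
      exact h.range y ⟨hy', y.2.2⟩
    · have := h.range (-y) ⟨by linarith, by linarith [y.2.1]⟩
      rw [h.odd y y.2] at this
      rwa [neg_one_mul]
  refine ⟨key.1, key.2, ?_⟩
  rcases hj with rfl | rfl
  · rw [one_mul] at key ⊢
    exact abs_of_nonneg key.1
  · rw [neg_one_mul] at key ⊢
    exact abs_of_nonpos (by linarith)

theorem IsInitialProfile.abs_lt_one {z₀ : ℝ → ℝ} (h : IsInitialProfile z₀) {y : Seg}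
    (hy : (y : ℝ) ≠ 0) : |z₀ y| < 1 := by
  obtain ⟨j, hj, hy'⟩ := Seg.exists_mem_side hy
  obtain ⟨-, h2, h3⟩ := h.side hj hy'
  rwa [h3]

/-! ### The regularized evolutions -/

/-- The regularized evolution, for the spatially constant stress `c(t)`, reduced to the flow of
the plastic strain `p` and of the internal variable `z`. In `flow`, the sign `j` of the force `g(z)`
is also the sign of `zDot`, whose size `b / ε` is that of `pDot` if `0 ≤ c ≤ 2`; the bound `b ≤ |g(z)|`
holds for every stress. -/
structure IsReducedEvolution (g : ℝ → ℝ) (z₀ : ℝ → ℝ) (ε : ℝ) (c : ℝ → ℝ)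
    (p z pDot zDot : ℝ → L2) : Prop where
  p_deriv : HasTimeDeriv p pDot
  z_deriv : HasTimeDeriv z zDot
  p_zero : p 0 =ᵐ[volume] 0
  z_zero : z 0 =ᵐ[volume] fun y => z₀ y
  c_eq : ∀ t, 0 ≤ t → c t = t - ∫ y, p t y
  flow : ∀ᵐ t ∂volume.restrict (Ioi (0 : ℝ)), ∀ᵐ y,
    pDot t y = 1 / ε * signedFlowRate (c t) |g (z t y)| ∧
    (∀ j : ℝ, (j = 1 ∨ j = -1) → 0 ≤ j * g (z t y) → ∃ b, 0 ≤ b ∧ b ≤ j * g (z t y) ∧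
      (0 ≤ c t → c t ≤ 2 → b = flowRate (c t) |g (z t y)|) ∧ zDot t y = 1 / ε * (j * b))

/-- Equilibrium forces the stress to be constant in space, and the boundary condition determines
the constant. -/
theorem IsRegularizedEvolution.exists_reduced {V : ℝ → ℝ} {M : ℝ} {z₀ : ℝ → ℝ}
    (hg : IsSofteningForce (fun θ => -deriv V θ) M) {ε : ℝ} {u e p z : ℝ → L2}
    (h : IsRegularizedEvolution (1 / 2) diamond V linearDatum 0 0 0 (fun y => z₀ y) ε u e p z) :
    ∃ (c : ℝ → ℝ) (pDot zDot : ℝ → L2),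
      IsReducedEvolution (fun θ => -deriv V θ) z₀ ε c p z pDot zDot ∧
      (∀ t, 0 ≤ t → e t = c t • oneL2) ∧
      ∀ t, 0 < t → ∀ f : Seg → ℝ, Integrable f → ∫ y, u t y * f y = t / 2 * (∫ y, f y) -
        ∫ y : Seg, (c t + p t y) * ∫ s in (-1 / 2 : ℝ)..y, segExtend f s := by
  obtain ⟨Du, uDot, DuDot, eDot, pDot, zDot, -, -, hDu, he, hp, hz, u0, e0, p0, z0, hk, heq, hflow⟩ :=
    h
  have h0 : ∫ y, p 0 y = 0 := integral_eq_zero_of_ae p0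
  have hconst : ∀ t, 0 < t → ∃ C : ℝ, e t =ᵐ[volume] fun _ => C := by
    intro t ht
    have h1 := heq t ht
    simp only [mul_one_div_cancel (two_ne_zero' ℝ), one_mul] at h1
    exact h1.ae_eq_const (L2.integrable _)
  have hDue : ∀ t, 0 < t → (Du t : Seg → ℝ) =ᵐ[volume] fun y => e t y + p t y := by
    intro t ht
    rw [(hk t ht).1]
    exact Lp.coeFn_add _ _
  have hcst : ∀ t, 0 < t → e t =ᵐ[volume] fun _ => t - ∫ y, p t y := by
    intro t ht
    obtain ⟨C, hC⟩ := hconst t ht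
    have h1 := ((hDu t ht.le).of_sameTrace (L2.integrable _) (L2.integrable _) (hk t ht).2).1
    rw [integral_congr_ae (hDue t ht), integral_add (L2.integrable _) (L2.integrable _),
      integral_congr_ae hC, integral_const, volume_seg_univ, one_smul] at h1
    rw [show t - ∫ y, p t y = C by linarith]
    exact hC
  have hcst' : ∀ t, 0 ≤ t → e t =ᵐ[volume] fun _ => t - ∫ y, p t y := by
    intro t ht
    rcases ht.eq_or_lt with rfl | ht'
    · rw [h0, sub_zero]
      exact e0
    · exact hcst t ht'
  refine ⟨fun t => t - ∫ y, p t y, pDot, zDot, ⟨hp, hz, p0, z0, fun _ _ => rfl, ?_⟩,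
    fun t ht => ?_, fun t ht f hf => ?_⟩
  · filter_upwards [hflow, ae_restrict_mem measurableSet_Ioi] with t h1 ht
    filter_upwards [h1, hcst t ht] with y h2 h3
    rw [mul_one_div_cancel (two_ne_zero' ℝ), one_mul, h3] at h2
    exact viscousFlow_diamond (hg.abs_le_one _) h2
  · refine Lp.ext ?_
    filter_upwards [hcst' t ht, Lp.coeFn_smul (t - ∫ y, p t y) oneL2, oneL2_ae] with y h1 h2 h3
    rw [h1, h2, Pi.smul_apply, h3, smul_eq_mul, mul_one]
  · rw [((hDu t ht.le).of_sameTrace (L2.integrable _) (L2.integrable _) (hk t ht).2).2 f hf]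
    congr 1
    refine integral_congr_ae ?_
    filter_upwards [hDue t ht, hcst t ht] with y h1 h2
    rw [h1, h2]

theorem L2.integral_abs_le (v : L2) : ∫ y, |v y| ≤ ‖v‖ := by
  have h1 : ∫ y, |v y| = inner ℝ oneL2 |v| := by
    rw [L2.inner_one]
    exact integral_congr_ae (Lp.coeFn_abs v).symm
  have h2 : ‖oneL2‖ ≤ 1 := by
    have h3 : inner ℝ oneL2 oneL2 = (1 : ℝ) := by
      rw [L2.inner_one, integral_congr_ae oneL2_ae, integral_const, volume_seg_univ, one_smul]
    rw [real_inner_self_eq_norm_sq] at h3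
    nlinarith [norm_nonneg oneL2]
  rw [h1]
  refine (real_inner_le_norm _ _).trans ?_
  rw [norm_abs_eq_norm]
  exact mul_le_of_le_one_left (norm_nonneg v) h2

namespace IsReducedEvolution

variable {g : ℝ → ℝ} {M : ℝ} {z₀ : ℝ → ℝ} {ε : ℝ} {c : ℝ → ℝ} {p z pDot zDot : ℝ → L2}

theorem flow_integrable (hg : IsSofteningForce g M) (s : ℝ) (v : L2) :
    Integrable fun y => signedFlowRate s |g (v y)| := by
  have hc : Continuous fun r : ℝ => signedFlowRate s |g r| := by
    have h1 : Continuous fun r : ℝ => (s, |g r|) :=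
      continuous_const.prodMk (continuous_abs.comp hg.continuous)
    have h2 : Continuous fun r : ℝ => (-s, |g r|) :=
      continuous_const.prodMk (continuous_abs.comp hg.continuous)
    exact (continuous_flowRate.comp h1).sub (continuous_flowRate.comp h2)
  refine Integrable.of_bound (hc.comp_aestronglyMeasurable (Lp.aestronglyMeasurable v))
    (2 * |s| + 2) (ae_of_all _ fun y => ?_)
  have h1 := abs_signedFlowRate_sub_le s 0 |g (v y)| 0
  rw [signedFlowRate_eq_zero (s := 0) (by simp) zero_le_one, sub_zero, sub_zero, sub_zero,
    abs_abs] at h1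
  rw [Real.norm_eq_abs]
  linarith [hg.abs_le_one (v y)]

/-- The stress solves `ċ = 1 - ∫ N(c, |g(z)|) / ε`, with `N` the first component of the flow. The
function `D` extends `c`, which is determined only for nonnegative times, so that two-sided
derivatives make sense at `0`. -/
theorem exists_hasDerivAt (h : IsReducedEvolution g z₀ ε c p z pDot zDot)
    (hg : IsSofteningForce g M) :
    ∃ D : ℝ → ℝ, (∀ t, 0 ≤ t → D t = c t) ∧
      ∀ t, 0 ≤ t → HasDerivAt D (1 - 1 / ε * ∫ y, signedFlowRate (c t) |g (z t y)|) t := by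
  let H : ℝ → ℝ := fun t =>
    1 / ε * ∫ y, signedFlowRate (max t 0 - ∫ y, p (max t 0) y) |g (z (max t 0) y)|
  have hHc : Continuous H := by
    refine continuous_const.mul ?_
    have key : ∀ a b : ℝ, ∀ v w : L2, dist (∫ y, signedFlowRate a |g (v y)|)
        (∫ y, signedFlowRate b |g (w y)|) ≤ 2 * |a - b| + 2 * M * ‖v - w‖ := by
      intro a b v w
      have hM := hg.nonneg
      rw [Real.dist_eq, ← integral_sub (flow_integrable hg a v) (flow_integrable hg b w)]
      refine (abs_integral_le_integral_abs).trans ?_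
      have h1 : ∫ y, |signedFlowRate a (|g (v y)|) - signedFlowRate b (|g (w y)|)| ≤
          ∫ y, (2 * |a - b| + 2 * M * |(v - w) y|) := by
        refine integral_mono_ae
          ((flow_integrable hg a v).sub (flow_integrable hg b w)).abs
          ((integrable_const _).add ((L2.integrable _).abs.const_mul _)) ?_
        filter_upwards [Lp.coeFn_sub v w] with y hy
        rw [hy, Pi.sub_apply]
        refine (abs_signedFlowRate_sub_le _ _ _ _).trans ?_
        have h2 := abs_abs_sub_abs_le_abs_sub (g (v y)) (g (w y))
        have h3 := hg.lipschitz (v y) (w y)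
        linarith
      refine h1.trans ?_
      rw [integral_add (integrable_const _) ((L2.integrable _).abs.const_mul _), integral_const,
        volume_seg_univ, one_smul, integral_const_mul]
      have := L2.integral_abs_le (v - w)
      gcongr
    have hcc : Continuous fun t => max t 0 - ∫ y, p (max t 0) y :=
      (by fun_prop : Continuous fun t : ℝ => max t 0).sub h.p_deriv.integral.continuous_max
    have hzc := h.z_deriv.continuous_max
    rw [continuous_iff_continuousAt]
    intro t
    rw [ContinuousAt, tendsto_iff_dist_tendsto_zero]
    refine squeeze_zero (fun _ => dist_nonneg) (fun s => key _ _ _ _) ?_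
    have h1 : Tendsto (fun s => 2 * |(max s 0 - ∫ y, p (max s 0) y) -
        (max t 0 - ∫ y, p (max t 0) y)| + 2 * M * ‖z (max s 0) - z (max t 0)‖) (𝓝 t)
        (𝓝 (2 * |(max t 0 - ∫ y, p (max t 0) y) -
        (max t 0 - ∫ y, p (max t 0) y)| + 2 * M * ‖z (max t 0) - z (max t 0)‖)) :=
      ((((hcc.sub continuous_const).abs).const_mul 2).add
        (((hzc.sub continuous_const).norm).const_mul (2 * M))).tendsto t
    simpa using h1
  refine ⟨fun t => t - ∫ s in (0 : ℝ)..t, H s, fun t ht => ?_, fun t ht => ?_⟩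
  · have hpt : (∫ y, p t y) = (∫ y, p 0 y) + ∫ s in (0 : ℝ)..t, ∫ y, pDot s y :=
      h.p_deriv.integral.2 t ht
    rw [h.c_eq t ht, hpt]
    have h0 : ∫ y, p 0 y = 0 := integral_eq_zero_of_ae h.p_zero
    rw [h0, zero_add]
    refine congrArg (fun x => t - x) (intervalIntegral.integral_congr_ae ?_)
    have h1 := (ae_restrict_iff' measurableSet_Ioi).1 h.flow
    filter_upwards [h1] with s hs hs'
    rw [uIoc_of_le ht] at hs'
    change 1 / ε * ∫ y, signedFlowRate (max s 0 - ∫ y, p (max s 0) y) |g (z (max s 0) y)| = _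
    rw [max_eq_left hs'.1.le, ← h.c_eq s hs'.1.le, ← integral_const_mul]
    refine integral_congr_ae ?_
    filter_upwards [hs hs'.1] with y hy
    exact hy.1.symm
  · have h1 : 1 / ε * ∫ y, signedFlowRate (c t) |g (z t y)| = H t := by
      change _ = 1 / ε * ∫ y, signedFlowRate (max t 0 - ∫ y, p (max t 0) y) |g (z (max t 0) y)|
      rw [max_eq_left ht, ← h.c_eq t ht]
    rw [h1]
    exact (hasDerivAt_id t).sub (intervalIntegral.integral_hasDerivAt_right
      (hHc.intervalIntegrable _ _) hHc.aestronglyMeasurable.stronglyMeasurableAtFilter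
      hHc.continuousAt)

/-- Up to time `1` the response is elastic: the flow vanishes at stress `s ≤ 1`, hence it is at most
`2 |s - c(s)|`, and the lemma of Gronwall gives `s - c(s) = 0`. -/
theorem stress_eq (h : IsReducedEvolution g z₀ ε c p z pDot zDot) (hg : IsSofteningForce g M)
    (hε : 0 < ε) {t : ℝ} (ht : t ∈ Icc (0 : ℝ) 1) : c t = t := by
  obtain ⟨D, hD, hD'⟩ := h.exists_hasDerivAt hg
  have h0 : ∫ y, p 0 y = 0 := integral_eq_zero_of_ae h.p_zero
  have hd : ∀ s, 0 ≤ s → HasDerivAt (fun s => s - D s)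
      (1 / ε * ∫ y, signedFlowRate (c s) |g (z s y)|) s := fun s hs => by
    have := (hasDerivAt_id s).sub (hD' s hs)
    rwa [sub_sub_cancel] at this
  have hz := eq_zero_of_abs_deriv_le_mul_abs_self_of_eq_zero_right (K := 1 / ε * 2) (a := 0)
    (b := 1) (f := fun s => s - D s)
    (fun s hs => (hd s hs.1).continuousAt.continuousWithinAt)
    (fun s hs => (hd s hs.1).hasDerivWithinAt)
    (by rw [hD 0 le_rfl, h.c_eq 0 le_rfl, h0]; simp) (fun s hs => by
      rw [norm_mul, Real.norm_of_nonneg (by positivity : 0 ≤ 1 / ε), mul_assoc]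
      refine mul_le_mul_of_nonneg_left ?_ (by positivity)
      have h1 := norm_integral_le_of_norm_le_const (μ := (volume : Measure Seg))
        (f := fun y => signedFlowRate (c s) |g (z s y)|) (C := 2 * ‖s - D s‖)
        (ae_of_all _ fun y => by
          have h2 := abs_signedFlowRate_sub_le (c s) s |g (z s y)| |g (z s y)|
          rw [signedFlowRate_eq_zero (s := s) (abs_le.2 ⟨by linarith [hs.1], hs.2.le⟩)
            (hg.abs_le_one _), sub_zero, sub_self, abs_zero, mul_zero, add_zero] at h2
          rw [Real.norm_eq_abs, Real.norm_eq_abs, abs_sub_comm s, hD s hs.1]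
          exact h2)
      rwa [volume_seg_univ, mul_one] at h1) t ht
  have := hD t ht.1
  have h3 : t - D t = 0 := hz
  linarith

/-- The value `1` is a barrier from below: where the stress is `1` nothing flows, and the stress
increases at unit rate. -/
theorem one_le_stress (h : IsReducedEvolution g z₀ ε c p z pDot zDot) (hg : IsSofteningForce g M)
    (hε : 0 < ε) {t : ℝ} (ht : 1 ≤ t) : 1 ≤ c t := by
  obtain ⟨D, hD, hD'⟩ := h.exists_hasDerivAt hg
  have hd : ∀ s, 0 ≤ s → HasDerivAt (fun s => -D s)
      (-(1 - 1 / ε * ∫ y, signedFlowRate (c s) |g (z s y)|)) s := fun s hs => (hD' s hs).neg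
  have h1 := image_le_of_deriv_right_lt_deriv_boundary (f := fun s => -D s) (a := 1) (b := t)
    (B := fun _ => -1) (B' := fun _ => 0)
    (fun s hs => (hd s (by linarith [hs.1])).continuousAt.continuousWithinAt)
    (fun s hs => (hd s (by linarith [hs.1])).hasDerivWithinAt)
    (by rw [hD 1 zero_le_one, h.stress_eq hg hε ⟨zero_le_one, le_rfl⟩])
    (fun s => hasDerivAt_const s (-1 : ℝ)) (fun s hs hs' => by
      have h2 : c s = 1 := by
        have h3 : -D s = -1 := hs'
        rw [hD s (by linarith [hs.1])] at h3
        linarith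
      have h3 : ∫ y, signedFlowRate (c s) |g (z s y)| = 0 :=
        integral_eq_zero_of_ae (ae_of_all _ fun y =>
          signedFlowRate_eq_zero (by rw [h2, abs_one]) (hg.abs_le_one _))
      rw [h3]
      norm_num) ⟨ht, le_rfl⟩
  have h2 : -D t ≤ -1 := h1
  rw [hD t (by linarith)] at h2
  linarith

theorem stress_nonneg (h : IsReducedEvolution g z₀ ε c p z pDot zDot)
    (hg : IsSofteningForce g M) (hε : 0 < ε) {t : ℝ} (ht : 0 ≤ t) : 0 ≤ c t := by
  rcases le_total t 1 with h1 | h1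
  · rw [h.stress_eq hg hε ⟨ht, h1⟩]
    exact ht
  · linarith [h.one_le_stress hg hε h1]

/-- The internal variable moves away from `0`: its rate has the sign of `z`, so that `j z` could
decrease only where `j z < 0`, but there the rate is `O(|z|)`, and `z` cannot cross `0`. -/
theorem sign_mul_le (h : IsReducedEvolution g z₀ ε c p z pDot zDot) (hg : IsSofteningForce g M)
    (hz₀ : IsInitialProfile z₀) (hε : 0 < ε) {j : ℝ} (hj : j = 1 ∨ j = -1) {t : ℝ} (ht : 0 ≤ t) :
    ∀ᵐ y, y ∈ Seg.side j → j * z₀ y ≤ j * z t y := by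
  have hM := hg.nonneg
  have hx := (h.z_deriv.const_sub (z 0)).const_smul j
  have hx_eq : ∀ t, ((j • (z 0 - z t) : L2) : Seg → ℝ) =ᵐ[volume]
      fun y => j * (z₀ y - z t y) := by
    intro t
    filter_upwards [Lp.coeFn_smul j (z 0 - z t), Lp.coeFn_sub (z 0) (z t), h.z_zero] with y h1 h2 h3
    rw [h1, Pi.smul_apply, h2, Pi.sub_apply, h3, smul_eq_mul]
  have hf_eq : ∀ t, ((j • (-zDot t) : L2) : Seg → ℝ) =ᵐ[volume] fun y => -(j * zDot t y) := by
    intro t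
    filter_upwards [Lp.coeFn_smul j (-zDot t), Lp.coeFn_neg (zDot t)] with y h1 h2
    rw [h1, Pi.smul_apply, h2, Pi.neg_apply, smul_eq_mul, mul_neg]
  have hn := hx.nonpos_on (Seg.measurableSet_side j) (L := 1 / ε * M) (by positivity) (by
      filter_upwards [hx_eq 0, h.z_zero] with y h1 h2 _
      rw [h1, h2, sub_self, mul_zero]) (by
      filter_upwards [h.flow] with s hs
      filter_upwards [hs, hx_eq s, hf_eq s] with y h1 h2 h3 hy
      rw [h2, h3]
      obtain ⟨hz1, hz2, -⟩ := hz₀.side hj hy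
      have hm := le_max_right (j * (z₀ y - z s y)) 0
      -- Where `j * z ≤ 0`, the rate is controlled by `|z| ≤ j * (z₀ - z)`.
      rcases le_total 0 (j * z s y) with h4 | h4
      · have h5 : 0 ≤ j * g (z s y) := by
          rw [hg.sign_mul hj]
          exact hg.apply_nonneg h4
        obtain ⟨b, hb, -, -, hb'⟩ := h1.2 j hj h5
        have h6 : j * zDot s y = 1 / ε * b := by
          rw [hb', show j * (1 / ε * (j * b)) = (j * j) * (1 / ε * b) by ring,
            mul_self_of_sign hj, one_mul]
        rw [h6]
        have : 0 ≤ 1 / ε * b := by positivity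
        have : 0 ≤ 1 / ε * M * max (j * (z₀ y - z s y)) 0 := by positivity
        linarith
      · have hj' : -j = 1 ∨ -j = -1 := by rcases hj with rfl | rfl <;> norm_num
        have h5 : 0 ≤ -j * g (z s y) := by
          rw [hg.sign_mul hj']
          exact hg.apply_nonneg (by linarith)
        obtain ⟨b, hb, hb1, -, hb'⟩ := h1.2 (-j) hj' h5
        have h6 : j * zDot s y = -(1 / ε * b) := by
          rw [hb', show j * (1 / ε * (-j * b)) = -((j * j) * (1 / ε * b)) by ring,
            mul_self_of_sign hj, one_mul]
        rw [h6, neg_neg, mul_assoc]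
        refine mul_le_mul_of_nonneg_left ?_ (by positivity)
        have h7 : -j * g (z s y) ≤ M * (-j * z s y) := by
          rw [hg.sign_mul hj']
          have := hg.lipschitz (-j * z s y) 0
          rw [hg.zero, sub_zero, sub_zero, abs_of_nonneg (by linarith : 0 ≤ -j * z s y)] at this
          exact (le_abs_self _).trans this
        refine (hb1.trans h7).trans (mul_le_mul_of_nonneg_left ?_ hM)
        refine le_trans ?_ (le_max_left _ _)
        linarith) ht
  filter_upwards [hn, hx_eq t] with y h1 h2 hy
  have := h1 hy
  rw [h2] at this
  linarith

theorem abs_le_abs (h : IsReducedEvolution g z₀ ε c p z pDot zDot) (hg : IsSofteningForce g M)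
    (hz₀ : IsInitialProfile z₀) (hε : 0 < ε) {t : ℝ} (ht : 0 ≤ t) : ∀ᵐ y : Seg, |z₀ y| ≤ |z t y| := by
  refine ae_seg_of_side fun j hj => ?_
  filter_upwards [h.sign_mul_le hg hz₀ hε hj ht] with y h1 hy
  rw [(hz₀.side hj hy).2.2]
  refine (h1 hy).trans ((le_abs_self _).trans_eq ?_)
  rw [abs_mul, abs_of_sign hj, one_mul]

/-- The stress exceeds `1` only slightly: at stress `1 + 2δ` the points where the initial force is
at least `1 - δ` flow at a rate of order `1 / ε`, and they fill a set of positive measure. -/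
theorem stress_le (h : IsReducedEvolution g z₀ ε c p z pDot zDot) (hg : IsSofteningForce g M)
    (hz₀ : IsInitialProfile z₀) (hε : 0 < ε) {δ : ℝ} (hδ : 0 < δ) (hδ' : δ ≤ 1 / 2)
    {A : Set Seg} (hA : MeasurableSet A) (hAg : ∀ y ∈ A, 1 - δ ≤ |g (z₀ y)|)
    (hεA : ε < volume.real A * (δ / 2)) {t : ℝ} (ht : 0 ≤ t) : c t ≤ 1 + 2 * δ := by
  obtain ⟨D, hD, hD'⟩ := h.exists_hasDerivAt hg
  have h0 : ∫ y, p 0 y = 0 := integral_eq_zero_of_ae h.p_zero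
  have h1 := image_le_of_deriv_right_lt_deriv_boundary (f := D) (a := 0) (b := t)
    (B := fun _ => 1 + 2 * δ) (B' := fun _ => 0)
    (fun s hs => (hD' s hs.1).continuousAt.continuousWithinAt)
    (fun s hs => (hD' s hs.1).hasDerivWithinAt)
    (by rw [hD 0 le_rfl, h.c_eq 0 le_rfl, h0]; linarith)
    (fun s => hasDerivAt_const s (1 + 2 * δ)) (fun s hs hs' => by
      rw [hD s hs.1] at hs'
      have h2 : volume.real A * (δ / 2) ≤ ∫ y, signedFlowRate (c s) |g (z s y)| := by
        have h3 : volume.real A * (δ / 2) = ∫ y, A.indicator (fun _ => δ / 2) y := by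
          rw [integral_indicator hA, setIntegral_const, smul_eq_mul]
        rw [h3]
        refine integral_mono_ae ((integrable_const _).indicator hA) (flow_integrable hg _ _) ?_
        filter_upwards [h.abs_le_abs hg hz₀ hε hs.1] with y hy
        rw [signedFlowRate_of_nonneg (by rw [hs']; linarith) (hg.abs_le_one _)]
        by_cases hyA : y ∈ A
        · rw [indicator_of_mem hyA, flowRate_of_le_two (by rw [hs']; linarith)]
          refine le_trans ?_ (le_max_right _ _)
          have h4 := hg.mono hy
          rw [← hg.abs_apply, ← hg.abs_apply] at h4
          have := hAg y hyA
          rw [hs']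
          linarith
        · rw [indicator_of_notMem hyA]
          exact flowRate_nonneg _ _
      have h5 : 1 < 1 / ε * ∫ y, signedFlowRate (c s) |g (z s y)| := by
        rw [one_div, ← div_eq_inv_mul, one_lt_div hε]
        exact hεA.trans_le h2
      linarith) ⟨ht, le_rfl⟩
  rwa [hD t ht] at h1

theorem pDot_eq (h : IsReducedEvolution g z₀ ε c p z pDot zDot) (hg : IsSofteningForce g M)
    (hε : 0 < ε) : ∀ᵐ t ∂volume.restrict (Ioi (0 : ℝ)), ∀ᵐ y,
      pDot t y = 1 / ε * flowRate (c t) |g (z t y)| := by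
  filter_upwards [h.flow, ae_restrict_mem measurableSet_Ioi] with t h1 ht
  filter_upwards [h1] with y h2
  rw [h2.1, signedFlowRate_of_nonneg (h.stress_nonneg hg hε (le_of_lt ht)) (hg.abs_le_one _)]

theorem p_mono (h : IsReducedEvolution g z₀ ε c p z pDot zDot) (hg : IsSofteningForce g M)
    (hε : 0 < ε) {s t : ℝ} (hs : 0 ≤ s) (hst : s ≤ t) : ∀ᵐ y, p s y ≤ p t y := by
  refine h.p_deriv.mono ?_ hs hst
  filter_upwards [h.pDot_eq hg hε] with t h1
  filter_upwards [h1] with y h2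
  rw [h2]
  exact mul_nonneg (by positivity) (flowRate_nonneg _ _)

theorem p_nonneg (h : IsReducedEvolution g z₀ ε c p z pDot zDot) (hg : IsSofteningForce g M)
    (hε : 0 < ε) {t : ℝ} (ht : 0 ≤ t) : ∀ᵐ y, 0 ≤ p t y := by
  filter_upwards [h.p_mono hg hε le_rfl ht, h.p_zero] with y h1 h2
  rwa [h2] at h1

/-- The internal variable and the plastic strain evolve at the same speed. The proof compares
`j z - p`, whose time derivative vanishes on the side `j`, with its initial value, from both sides. -/
theorem z_eq (h : IsReducedEvolution g z₀ ε c p z pDot zDot) (hg : IsSofteningForce g M)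
    (hz₀ : IsInitialProfile z₀) (hε : 0 < ε) (hc : ∀ t, 0 ≤ t → c t ≤ 2) {j : ℝ}
    (hj : j = 1 ∨ j = -1) {t : ℝ} (ht : 0 ≤ t) :
    ∀ᵐ y, y ∈ Seg.side j → z t y = z₀ y + j * p t y := by
  have hf : ∀ᵐ s ∂volume.restrict (Ioi (0 : ℝ)), ∀ᵐ y, y ∈ Seg.side j → j * zDot s y = pDot s y := by
    filter_upwards [h.flow, h.pDot_eq hg hε, ae_restrict_mem measurableSet_Ioi] with s hs hs2 hs0
    have hs0' : 0 ≤ s := le_of_lt hs0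
    filter_upwards [hs, hs2, h.sign_mul_le hg hz₀ hε hj hs0'] with y h1 h2 h3 hy
    have h4 : 0 ≤ j * g (z s y) := by
      rw [hg.sign_mul hj]
      exact hg.apply_nonneg ((hz₀.side hj hy).1.trans (h3 hy))
    obtain ⟨b, -, -, hb, hb'⟩ := h1.2 j hj h4
    rw [h2, hb', ← hb (h.stress_nonneg hg hε hs0') (hc s hs0'),
      show j * (1 / ε * (j * b)) = (j * j) * (1 / ε * b) by ring, mul_self_of_sign hj, one_mul]
  have hx := (h.z_deriv.const_smul j).sub h.p_deriv
  have hx_eq : ∀ v w : L2, ((j • v - w : L2) : Seg → ℝ) =ᵐ[volume] fun y => j * v y - w y := by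
    intro v w
    filter_upwards [Lp.coeFn_sub (j • v) w, Lp.coeFn_smul j v] with y h1 h2
    rw [h1, Pi.sub_apply, h2, Pi.smul_apply, smul_eq_mul]
  have hy_eq : ∀ v w : L2, ((j • z 0 - (j • v - w) : L2) : Seg → ℝ) =ᵐ[volume]
      fun y => j * z₀ y - (j * v y - w y) := by
    intro v w
    filter_upwards [Lp.coeFn_sub (j • z 0) (j • v - w), hx_eq v w, Lp.coeFn_smul j (z 0),
      h.z_zero] with y h1 h2 h3 h4
    rw [h1, Pi.sub_apply, h2, h3, Pi.smul_apply, h4, smul_eq_mul]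
  have hy_eq' : ∀ v w : L2, (((-1 : ℝ) • (j • z 0 - (j • v - w)) : L2) : Seg → ℝ) =ᵐ[volume]
      fun y => -(j * z₀ y - (j * v y - w y)) := by
    intro v w
    filter_upwards [Lp.coeFn_smul (-1 : ℝ) (j • z 0 - (j • v - w)), hy_eq v w] with y h1 h2
    rw [h1, Pi.smul_apply, h2, smul_eq_mul, neg_one_mul]
  have hneg : ∀ v w : L2, ((-(j • v - w) : L2) : Seg → ℝ) =ᵐ[volume]
      fun y => -(j * v y - w y) := by
    intro v w
    filter_upwards [Lp.coeFn_neg (j • v - w), hx_eq v w] with y h1 h2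
    rw [h1, Pi.neg_apply, h2]
  have hneg' : ∀ v w : L2, (((-1 : ℝ) • -(j • v - w) : L2) : Seg → ℝ) =ᵐ[volume]
      fun y => j * v y - w y := by
    intro v w
    filter_upwards [Lp.coeFn_smul (-1 : ℝ) (-(j • v - w)), hneg v w] with y h1 h2
    rw [h1, Pi.smul_apply, h2, smul_eq_mul, neg_one_mul, neg_neg]
  have hY := hx.const_sub (j • z 0)
  have hY' := hY.const_smul (-1)
  have n1 := hY.nonpos_on (Seg.measurableSet_side j) (L := 0) le_rfl (by
      filter_upwards [hy_eq (z 0) (p 0), h.z_zero, h.p_zero] with y h1 h2 h3 _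
      rw [h1, h2, h3]
      simp) (by
      filter_upwards [hf] with s hs
      filter_upwards [hs, hneg (zDot s) (pDot s)] with y h1 h2 hy
      rw [h2, h1 hy]
      simp) ht
  have n2 := hY'.nonpos_on (Seg.measurableSet_side j) (L := 0) le_rfl (by
      filter_upwards [hy_eq' (z 0) (p 0), h.z_zero, h.p_zero] with y h1 h2 h3 _
      rw [h1, h2, h3]
      simp) (by
      filter_upwards [hf] with s hs
      filter_upwards [hs, hneg' (zDot s) (pDot s)] with y h1 h2 hy
      rw [h2, h1 hy]
      simp) ht
  filter_upwards [n1, n2, hy_eq (z t) (p t), hy_eq' (z t) (p t)] with y h1 h2 h3 h4 hy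
  have h5 := h1 hy
  have h6 := h2 hy
  rw [h3] at h5
  rw [h4] at h6
  have h7 : j * z t y = j * z₀ y + p t y := by linarith
  have h8 := congrArg (fun x => j * x) h7
  have h9 : j * (j * z t y) = (j * j) * z t y := by ring
  have h10 : j * (j * z₀ y + p t y) = (j * j) * z₀ y + j * p t y := by ring
  simp only [h9, h10, mul_self_of_sign hj, one_mul] at h8
  exact h8

theorem abs_z_eq (h : IsReducedEvolution g z₀ ε c p z pDot zDot) (hg : IsSofteningForce g M)
    (hz₀ : IsInitialProfile z₀) (hε : 0 < ε) (hc : ∀ t, 0 ≤ t → c t ≤ 2) {t : ℝ} (ht : 0 ≤ t) :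
    ∀ᵐ y : Seg, |z t y| = |z₀ y| + p t y := by
  refine ae_seg_of_side fun j hj => ?_
  filter_upwards [h.z_eq hg hz₀ hε hc hj ht, h.p_nonneg hg hε ht] with y h1 h2 hy
  obtain ⟨h3, -, h4⟩ := hz₀.side hj hy
  have h5 : |z t y| = |j * z t y| := by rw [abs_mul, abs_of_sign hj, one_mul]
  have h6 : j * z t y = j * z₀ y + p t y := by
    rw [h1 hy, mul_add, ← mul_assoc, mul_self_of_sign hj, one_mul]
  rw [h5, h6, abs_of_nonneg (by linarith), h4]

/-- No plastic strain appears where the initial force stays away from `1`: there the flow vanishes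
for `z = z₀`, so that it is at most a multiple of `|z| - |z₀| = p`. -/
theorem p_eq_zero (h : IsReducedEvolution g z₀ ε c p z pDot zDot) (hg : IsSofteningForce g M)
    (hz₀ : IsInitialProfile z₀) (hε : 0 < ε) {η : ℝ} (hη : η ≤ 1)
    (hc : ∀ t, 0 ≤ t → c t ≤ 1 + η) {B : Set Seg} (hB : MeasurableSet B)
    (hBg : ∀ y ∈ B, |g (z₀ y)| ≤ 1 - η) {t : ℝ} (ht : 0 ≤ t) : ∀ᵐ y, y ∈ B → p t y = 0 := by
  have hM := hg.nonneg
  have hc2 : ∀ t, 0 ≤ t → c t ≤ 2 := fun t ht => (hc t ht).trans (by linarith)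
  have n := h.p_deriv.nonpos_on hB (L := 1 / ε * (M / 2)) (by positivity) (by
      filter_upwards [h.p_zero] with y h1 _
      rw [h1]
      rfl) (by
      filter_upwards [h.pDot_eq hg hε, ae_restrict_mem measurableSet_Ioi] with s hs hs0
      have hs0' : 0 ≤ s := le_of_lt hs0
      filter_upwards [hs, h.abs_z_eq hg hz₀ hε hc2 hs0', h.p_nonneg hg hε hs0']
        with y h1 h2 h3 hy
      rw [h1, mul_assoc]
      refine mul_le_mul_of_nonneg_left ?_ (by positivity)
      have h4 := flowRate_sub_le (s := c s) (r := |g (z s y)|) (r' := |g (z₀ y)|) (hc2 s hs0')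
      have h5 : flowRate (c s) |g (z₀ y)| = 0 := by
        rw [flowRate_of_le_two (hc2 s hs0'), max_eq_left]
        linarith [hc s hs0', hBg y hy]
      have h6 : |g (z s y)| - |g (z₀ y)| ≤ M * p s y := by
        rw [hg.abs_apply, hg.abs_apply]
        refine (le_abs_self _).trans ((hg.lipschitz _ _).trans_eq ?_)
        rw [h2, add_sub_cancel_left, abs_of_nonneg h3]
      have h7 : max (|g (z s y)| - |g (z₀ y)|) 0 ≤ M * p s y := max_le h6 (by positivity)
      rw [max_eq_left h3]
      linarith) ht
  filter_upwards [n, h.p_nonneg hg hε ht] with y h1 h2 hy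
  exact le_antisymm (h1 hy) h2

end IsReducedEvolution

/-! ### Symmetry and concentration -/

/-- The reflection `y ↦ -y`. -/
def Seg.reflect (y : Seg) : Seg := ⟨-y, by linarith [y.2.2], by linarith [y.2.1]⟩

theorem Seg.measurePreserving_reflect : MeasurePreserving Seg.reflect := by
  have hm : Measurable Seg.reflect := measurable_subtype_coe.neg.subtype_mk
  refine ⟨hm, Measure.ext fun s hs => ?_⟩
  have key : ∀ s : Set Seg, (volume : Measure Seg) s = volume (Subtype.val '' s) := fun s =>
    comap_subtype_coe_apply measurableSet_Icc volume s
  rw [Measure.map_apply hm hs, key, key]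
  have h2 : Subtype.val '' (Seg.reflect ⁻¹' s) = Neg.neg ⁻¹' (Subtype.val '' s) := by
    ext x
    constructor
    · rintro ⟨y, hy, rfl⟩
      exact ⟨Seg.reflect y, hy, rfl⟩
    · rintro ⟨y, hy, hyx⟩
      refine ⟨Seg.reflect y, ?_, ?_⟩
      · change Seg.reflect (Seg.reflect y) ∈ s
        rwa [show Seg.reflect (Seg.reflect y) = y from Subtype.ext (neg_neg _)]
      · change -(y : ℝ) = x
        rw [hyx, neg_neg]
  rw [h2, Measure.measure_preimage_neg]

theorem IsInitialProfile.abs_reflect {z₀ : ℝ → ℝ} (h : IsInitialProfile z₀) (y : Seg) :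
    |z₀ (Seg.reflect y)| = |z₀ y| := by
  rw [show ((Seg.reflect y : Seg) : ℝ) = -(y : ℝ) from rfl, h.odd y y.2, abs_neg]

namespace IsReducedEvolution

variable {g : ℝ → ℝ} {M : ℝ} {z₀ : ℝ → ℝ} {ε : ℝ} {c : ℝ → ℝ} {p z pDot zDot : ℝ → L2}

/-- The plastic strain is even: it solves, together with its reflection, the differential equation
`ṗ = N(c, g(|z₀| + p)) / ε`, whose right-hand side is Lipschitz in `p`. -/
theorem p_reflect (h : IsReducedEvolution g z₀ ε c p z pDot zDot) (hg : IsSofteningForce g M)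
    (hz₀ : IsInitialProfile z₀) (hε : 0 < ε) (hc : ∀ t, 0 ≤ t → c t ≤ 2) {t : ℝ} (ht : 0 ≤ t) :
    ∀ᵐ y, p t (Seg.reflect y) = p t y := by
  have hM := hg.nonneg
  have hR := Seg.measurePreserving_reflect
  have hRae : ∀ {P : Seg → Prop}, (∀ᵐ y, P y) → ∀ᵐ y, P (Seg.reflect y) := fun hP =>
    hR.quasiMeasurePreserving.ae hP
  let R : L2 →L[ℝ] L2 :=
    (Lp.compMeasurePreservingₗᵢ ℝ (E := ℝ) (p := 2) Seg.reflect hR).toContinuousLinearMap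
  have hRv : ∀ v : L2, (R v : Seg → ℝ) =ᵐ[volume] fun y => v (Seg.reflect y) := fun v =>
    Lp.coeFn_compMeasurePreserving v hR
  have hdiff : ∀ v : L2, ((R v - v : L2) : Seg → ℝ) =ᵐ[volume] fun y => v (Seg.reflect y) - v y := by
    intro v
    filter_upwards [Lp.coeFn_sub (R v) v, hRv v] with y h1 h2
    rw [h1, Pi.sub_apply, h2]
  have hx := (h.p_deriv.clm R).sub h.p_deriv
  have n := hx.nonpos_on MeasurableSet.univ (L := 1 / ε * (M / 2)) (by positivity) (by
      filter_upwards [hdiff (p 0), h.p_zero, hRae h.p_zero] with y h1 h2 h3 _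
      rw [h1, h2, h3]
      simp) (by
      filter_upwards [h.pDot_eq hg hε, ae_restrict_mem measurableSet_Ioi] with s hs hs0
      have hs0' : 0 ≤ s := le_of_lt hs0
      filter_upwards [hdiff (p s), hdiff (pDot s), hs, hRae hs,
        h.abs_z_eq hg hz₀ hε hc hs0', hRae (h.abs_z_eq hg hz₀ hε hc hs0')]
        with y h1 h2 h3 h4 h5 h6 _
      rw [h1, h2, h3, h4, hg.abs_apply, hg.abs_apply, h5, h6, hz₀.abs_reflect, ← mul_sub, mul_assoc]
      refine mul_le_mul_of_nonneg_left ?_ (by positivity)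
      refine (flowRate_sub_le (hc s hs0')).trans ?_
      have h7 : max (g (|z₀ y| + p s (Seg.reflect y)) - g (|z₀ y| + p s y)) 0 ≤
          M * max (p s (Seg.reflect y) - p s y) 0 := by
        refine max_le ?_ (mul_nonneg hM (le_max_right _ _))
        rcases le_total (p s (Seg.reflect y)) (p s y) with h8 | h8
        · have h9 := hg.mono (by linarith : |z₀ y| + p s (Seg.reflect y) ≤ |z₀ y| + p s y)
          have := mul_nonneg hM (le_max_right (p s (Seg.reflect y) - p s y) 0)
          linarith
        · refine (le_abs_self _).trans ((hg.lipschitz _ _).trans ?_)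
          rw [add_sub_add_left_eq_sub, abs_of_nonneg (by linarith)]
          exact mul_le_mul_of_nonneg_left (le_max_left _ _) hM
      linarith) ht
  have h1 : ∀ᵐ y, p t (Seg.reflect y) ≤ p t y := by
    filter_upwards [n, hdiff (p t)] with y h1 h2
    have := h1 (mem_univ y)
    rw [h2] at this
    linarith
  filter_upwards [h1, hRae h1] with y h2 h3
  rw [show Seg.reflect (Seg.reflect y) = y from Subtype.ext (neg_neg _)] at h3
  exact le_antisymm h2 h3

theorem integral_side (h : IsReducedEvolution g z₀ ε c p z pDot zDot) (hg : IsSofteningForce g M)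
    (hz₀ : IsInitialProfile z₀) (hε : 0 < ε) (hc : ∀ t, 0 ≤ t → c t ≤ 2) {j : ℝ}
    (hj : j = 1 ∨ j = -1) {t : ℝ} (ht : 0 ≤ t) :
    ∫ y in Seg.side j, p t y = (t - c t) / 2 := by
  have h1 : ∫ y in Seg.side (-1), p t y = ∫ y in Seg.side 1, p t y := by
    have hpre : Seg.reflect ⁻¹' Seg.side (-1) = Seg.side 1 := by
      ext y
      change 0 < -1 * -(y : ℝ) ↔ 0 < 1 * (y : ℝ)
      rw [neg_mul_neg]
    have hemb : MeasurableEmbedding Seg.reflect :=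
      (MeasurableEquiv.mk ⟨Seg.reflect, Seg.reflect, fun y => Subtype.ext (neg_neg _),
        fun y => Subtype.ext (neg_neg _)⟩ Seg.measurePreserving_reflect.measurable
        Seg.measurePreserving_reflect.measurable).measurableEmbedding
    rw [← Seg.measurePreserving_reflect.setIntegral_preimage_emb hemb, hpre]
    exact setIntegral_congr_ae (Seg.measurableSet_side 1)
      ((h.p_reflect hg hz₀ hε hc ht).mono fun y hy _ => hy)
  have h2 := integral_eq_add_side (L2.integrable (p t))
  have h3 := h.c_eq t ht
  rcases hj with rfl | rfl <;> linarith

end IsReducedEvolution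

/-- The plastic strain `p` is concentrated in `|y| < κ` and has mass `a`, one half on each side of
the origin, and the internal variable is `z = z₀ + sgn(y) p`. -/
structure IsSymmetricSlip (z₀ : ℝ → ℝ) (κ a : ℝ) (p z : L2) : Prop where
  nonneg : ∀ᵐ y, 0 ≤ p y
  concentrated : ∀ᵐ y : Seg, κ ≤ |(y : ℝ)| → p y = 0
  z_eq : ∀ j : ℝ, (j = 1 ∨ j = -1) → ∀ᵐ y, y ∈ Seg.side j → z y = z₀ y + j * p y
  integral_side : ∀ j : ℝ, (j = 1 ∨ j = -1) → ∫ y in Seg.side j, p y = a / 2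

/-- For small `ε` the regularized evolutions concentrate near the origin, and their stress is close
to `min t 1`. -/
theorem exists_forall_reduced {g : ℝ → ℝ} {M : ℝ} (hg : IsSofteningForce g M) {z₀ : ℝ → ℝ}
    (hz₀ : IsInitialProfile z₀) {κ η : ℝ} (hκ : 0 < κ) (hη : 0 < η) :
    ∃ ε₀ > 0, ∀ (ε : ℝ) (c : ℝ → ℝ) (p z pDot zDot : ℝ → L2), 0 < ε → ε < ε₀ →
      IsReducedEvolution g z₀ ε c p z pDot zDot → ∀ t, 0 ≤ t →
        |c t - min t 1| ≤ η ∧ IsSymmetricSlip z₀ κ (t - c t) (p t) (z t) := by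
  -- `w` bounds the initial force outside the `κ`-neighbourhood of the origin.
  obtain ⟨w, hw, hwB⟩ : ∃ w < 1, ∀ y : Seg, κ ≤ |(y : ℝ)| → |g (z₀ y)| ≤ w := by
    rcases lt_or_ge (1 / 2) κ with h | h
    · refine ⟨0, zero_lt_one, fun y hy => ?_⟩
      have := abs_le.2 ⟨by linarith [y.2.1], y.2.2⟩
      linarith
    · have hsub : Icc κ (1 / 2) ⊆ Ico (-1 / 2 : ℝ) 0 ∪ Ioc 0 (1 / 2) := fun x hx =>
        Or.inr ⟨hκ.trans_le hx.1, hx.2⟩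
      obtain ⟨x, hx, hmax⟩ := isCompact_Icc.exists_isMaxOn (nonempty_Icc.2 h)
        (hg.continuous.comp_continuousOn (hz₀.continuousOn.mono hsub))
      have hx0 := hz₀.range x ⟨hκ.trans_le hx.1, hx.2⟩
      refine ⟨g (z₀ x), hg.lt_one hx0.2, fun y hy => ?_⟩
      have hmem : |(y : ℝ)| ∈ Icc κ (1 / 2) := ⟨hy, abs_le.2 ⟨by linarith [y.2.1], y.2.2⟩⟩
      have h1 : |z₀ y| = z₀ |(y : ℝ)| := by
        have h2 := hz₀.range |(y : ℝ)| ⟨hκ.trans_le hmem.1, hmem.2⟩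
        rcases abs_cases (y : ℝ) with ⟨h3, -⟩ | ⟨h3, -⟩ <;> rw [h3] at h2 ⊢
        · exact abs_of_nonneg h2.1
        · rw [hz₀.odd y y.2] at h2 ⊢
          exact abs_of_nonpos (by linarith)
      rw [hg.abs_apply, h1]
      exact hmax hmem
  obtain ⟨δ, hδ, hδ2, hδη, hδw⟩ : ∃ δ > 0, δ ≤ 1 / 2 ∧ 2 * δ ≤ η ∧ w ≤ 1 - 2 * δ := by
    refine ⟨min (1 / 2) (min (η / 2) ((1 - w) / 2)), lt_min (by norm_num) (lt_min (by linarith)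
      (by linarith)), min_le_left _ _, ?_, ?_⟩
    · have := (min_le_right (1 / 2) (min (η / 2) ((1 - w) / 2))).trans (min_le_left _ _)
      linarith
    · have := (min_le_right (1 / 2) (min (η / 2) ((1 - w) / 2))).trans (min_le_right _ _)
      linarith
  -- Near the origin the initial force exceeds `1 - δ`.
  have hlim : ∀ᶠ x in 𝓝[>] (0 : ℝ), 1 - δ < g (z₀ x) := by
    have h1 : Tendsto (fun x => g (z₀ x)) (𝓝[>] 0) (𝓝 (g 1)) :=
      (hg.continuous.tendsto 1).comp hz₀.tendsto
    rw [(hg.eq_one_iff 1).2 le_rfl] at h1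
    exact h1.eventually_const_lt (by linarith)
  obtain ⟨r, hr, hrs⟩ := (mem_nhdsGT_iff_exists_Ioo_subset (a := (0 : ℝ))).1 hlim
  have hr0 : 0 < r := hr
  let A : Set Seg := {y | (y : ℝ) ∈ Ioo 0 (min r (1 / 2))}
  have hA : MeasurableSet A := measurable_subtype_coe measurableSet_Ioo
  have hAvol : 0 < volume.real A := by
    have h1 : (volume : Measure Seg) A = volume (Ioo 0 (min r (1 / 2))) := by
      have h2 : (volume : Measure Seg) A = volume (Subtype.val '' A) :=
        comap_subtype_coe_apply measurableSet_Icc volume A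
      rw [h2]
      congr 1
      ext x
      constructor
      · rintro ⟨y, hy, rfl⟩
        exact hy
      · intro hx
        have := min_le_right r (1 / 2)
        exact ⟨⟨x, by linarith [hx.1], by linarith [hx.2]⟩, hx, rfl⟩
    rw [measureReal_def, h1, Real.volume_Ioo, sub_zero, ENNReal.toReal_ofReal]
    · exact lt_min hr0 (by norm_num)
    · exact (lt_min hr0 (by norm_num)).le
  have hAg : ∀ y ∈ A, 1 - δ ≤ |g (z₀ y)| := fun y hy => by
    have h1 : (y : ℝ) ∈ Ioo 0 r := ⟨hy.1, hy.2.trans_le (min_le_left _ _)⟩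
    exact (le_of_lt (hrs h1)).trans (le_abs_self _)
  refine ⟨volume.real A * (δ / 2), by positivity, fun ε c p z pDot zDot hε hεA h t ht => ?_⟩
  have hc : ∀ t, 0 ≤ t → c t ≤ 1 + 2 * δ := fun t ht =>
    h.stress_le hg hz₀ hε hδ hδ2 hA hAg hεA ht
  have hc2 : ∀ t, 0 ≤ t → c t ≤ 2 := fun t ht => (hc t ht).trans (by linarith)
  refine ⟨?_, h.p_nonneg hg hε ht, ?_, fun j hj => h.z_eq hg hz₀ hε hc2 hj ht,
    fun j hj => h.integral_side hg hz₀ hε hc2 hj ht⟩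
  · rcases le_total t 1 with h1 | h1
    · rw [h.stress_eq hg hε ⟨ht, h1⟩, min_eq_left h1, sub_self, abs_zero]
      exact hη.le
    · rw [min_eq_right h1, abs_of_nonneg (by linarith [h.one_le_stress hg hε h1])]
      linarith [hc t ht]
  · have hB : MeasurableSet {y : Seg | κ ≤ |(y : ℝ)|} :=
      measurableSet_le measurable_const measurable_subtype_coe.abs
    exact h.p_eq_zero hg hz₀ hε (η := 2 * δ) (by linarith) hc hB
      (fun y hy => (hwB y hy).trans hδw) ht

/-! ### Homogeneous functions of measures with densities -/

theorem withDensity_ofReal_div {X : Type*} [MeasurableSpace X] (ν : Measure X) {a W : X → ℝ}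
    (ha : Measurable a) (hW : Measurable W) (ha0 : ∀ x, 0 ≤ a x) (haW : ∀ x, a x ≤ W x) :
    (ν.withDensity fun x => ENNReal.ofReal (W x)).withDensity (fun x => ENNReal.ofReal (a x / W x)) =
      ν.withDensity fun x => ENNReal.ofReal (a x) := by
  have hm : Measurable fun x => ENNReal.ofReal (a x / W x) := (ha.div hW).ennreal_ofReal
  rw [← withDensity_mul ν hW.ennreal_ofReal hm]
  congr 1
  funext x
  have hW0 : 0 ≤ W x := (ha0 x).trans (haW x)
  rw [Pi.mul_apply, ← ENNReal.ofReal_mul hW0]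
  congr 1
  rcases hW0.eq_or_lt with h | h
  · rw [← h, zero_mul]
    linarith [ha0 x, haW x]
  · rw [mul_div_cancel₀ _ h.ne']

/-- The density of `a ν` with respect to `W ν` is `a / W`, also where `W = 0`, since there `a = 0`. -/
theorem rnDeriv_withDensityᵥ {X : Type*} [MeasurableSpace X] (ν : Measure X) {a W : X → ℝ}
    (ha : Integrable a ν) (hW : Measurable W) (haW : ∀ x, |a x| ≤ W x) :
    SignedMeasure.rnDeriv (ν.withDensityᵥ a) (ν.withDensity fun x => ENNReal.ofReal (W x))
      =ᵐ[ν.withDensity fun x => ENNReal.ofReal (W x)] fun x => a x / W x := by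
  have hW0 : ∀ x, 0 ≤ W x := fun x => (abs_nonneg _).trans (haW x)
  have e : ∀ x, (ENNReal.ofReal (W x)).toReal • (a x / W x) = a x := by
    intro x
    rw [ENNReal.toReal_ofReal (hW0 x), smul_eq_mul]
    rcases (hW0 x).eq_or_lt with h | h
    · have := haW x
      rw [← h] at this ⊢
      rw [zero_mul, abs_nonpos_iff.1 this]
    · rw [mul_div_cancel₀ _ h.ne']
  have hint : Integrable (fun x => (ENNReal.ofReal (W x)).toReal • (a x / W x)) ν := by
    simpa only [e] using ha
  have h1 := withDensityᵥ_smul_eq_withDensityᵥ_withDensity' hW.ennreal_ofReal.aemeasurable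
    (ae_of_all _ fun x => ENNReal.ofReal_lt_top) hint
  simp only [e] at h1
  refine (SignedMeasure.eq_rnDeriv 0 _ ?_ VectorMeasure.MutuallySingular.zero_left ?_).symm
  · rw [integrable_withDensity_iff_integrable_smul' hW.ennreal_ofReal
      (ae_of_all _ fun x => ENNReal.ofReal_lt_top)]
    exact hint
  · rw [zero_add, h1]

theorem totalVariation_withDensityᵥ {X : Type*} [MeasurableSpace X] {ν : Measure X} {a : X → ℝ}
    (ha : Integrable a ν) :
    SignedMeasure.totalVariation (ν.withDensityᵥ a) = ν.withDensity fun x => ENNReal.ofReal |a x| := by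
  rw [SignedMeasure.totalVariation_eq_variation, Measure.variation_withDensityᵥ ha]
  congr 1
  funext x
  rw [← Real.norm_eq_abs, ofReal_norm]

theorem Chom.apply_smul {Ξ : Type*} [NormedAddCommGroup Ξ] [NormedSpace ℝ Ξ] (f : Chom Ξ) (x : Seg)
    (ξ : Ξ) (η : ℝ) {c : ℝ} (hc : 0 < c) : f.1 (x, c • ξ, c * η) = c * f.1 (x, ξ, η) :=
  f.2 x ξ η c hc

theorem Chom.apply_zero {Ξ : Type*} [NormedAddCommGroup Ξ] [NormedSpace ℝ Ξ] (f : Chom Ξ) (x : Seg) :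
    f.1 (x, 0, 0) = 0 := by
  have := Chom.apply_smul f x 0 0 (two_pos)
  rw [smul_zero, mul_zero] at this
  linarith

/-- Functions in `C^hom` have linear growth. -/
theorem Chom.exists_bound {Ξ : Type*} [NormedAddCommGroup Ξ] [NormedSpace ℝ Ξ] [ProperSpace Ξ]
    (f : Chom Ξ) : ∃ C, 0 ≤ C ∧ ∀ x ξ η, |f.1 (x, ξ, η)| ≤ C * ‖((ξ, η) : Ξ × ℝ)‖ := by
  obtain ⟨C, hC⟩ := (isCompact_univ.prod (isCompact_sphere (0 : Ξ × ℝ) 1) :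
    IsCompact ((univ : Set Seg) ×ˢ Metric.sphere (0 : Ξ × ℝ) 1)).exists_bound_of_continuousOn
    f.1.continuous.continuousOn
  refine ⟨max C 0, le_max_right _ _, fun x ξ η => ?_⟩
  rcases (norm_nonneg ((ξ, η) : Ξ × ℝ)).eq_or_lt with h | h
  · have h1 : ((ξ, η) : Ξ × ℝ) = 0 := norm_eq_zero.1 h.symm
    obtain ⟨rfl, rfl⟩ := Prod.mk.inj h1
    rw [Chom.apply_zero f]
    simp
  · set n := ‖((ξ, η) : Ξ × ℝ)‖ with hn
    have h1 := Chom.apply_smul f x (n⁻¹ • ξ) (n⁻¹ * η) h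
    rw [smul_inv_smul₀ h.ne', mul_inv_cancel_left₀ h.ne'] at h1
    have h2 : ‖((n⁻¹ • ξ, n⁻¹ * η) : Ξ × ℝ)‖ = 1 := by
      have : ((n⁻¹ • ξ, n⁻¹ * η) : Ξ × ℝ) = n⁻¹ • (ξ, η) := rfl
      rw [this, norm_smul, ← hn, norm_inv, Real.norm_of_nonneg h.le, inv_mul_cancel₀ h.ne']
    have h3 := hC (x, n⁻¹ • ξ, n⁻¹ * η) ⟨mem_univ _, by simpa using h2⟩
    rw [Real.norm_eq_abs] at h3
    rw [h1, abs_mul, abs_of_pos h, mul_comm]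
    exact mul_le_mul_of_nonneg_right (h3.trans (le_max_left _ _)) h.le

theorem youngDelta_eq_integral (p z : SignedMeasure Seg) {lam : Measure Seg}
    (hlam : (volume : Measure Seg) + (p.totalVariation + z.totalVariation) = lam)
    {α β γ : Seg → ℝ} (hα : p.rnDeriv lam =ᵐ[lam] α) (hβ : z.rnDeriv lam =ᵐ[lam] β)
    (hγ : (fun x => ((volume : Measure Seg).rnDeriv lam x).toReal) =ᵐ[lam] γ)
    (f : Chom (Fin 1 → ℝ × ℝ)) :
    youngDelta (fun _ => (p, z)) f = ∫ x, f.1 (x, fun _ => (α x, β x), γ x) ∂lam := by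
  have h : (volume : Measure Seg) + ∑ _i : Fin 1, (p.totalVariation + z.totalVariation) = lam := by
    rw [Fin.sum_univ_one, hlam]
  simp only [youngDelta]
  rw [h]
  refine integral_congr_ae ?_
  filter_upwards [hα, hβ, hγ] with x h1 h2 h3
  rw [h1, h2, h3]

/-- Homogeneity, including the case of the factor `W = 0`. -/
theorem Chom.mul_apply_div (f : Chom (Fin 1 → ℝ × ℝ)) (x : Seg) {a b ℓ W : ℝ} (ha : |a| ≤ W)
    (hb : |b| ≤ W) (hℓ : |ℓ| ≤ W) :
    W * f.1 (x, fun _ => (a / W, b / W), ℓ / W) = f.1 (x, fun _ => (a, b), ℓ) := by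
  rcases ((abs_nonneg a).trans ha).eq_or_lt with h | h
  · rw [← h] at ha hb hℓ
    rw [abs_nonpos_iff.1 ha, abs_nonpos_iff.1 hb, abs_nonpos_iff.1 hℓ, ← h, zero_mul]
    exact (Chom.apply_zero f x).symm
  · have h1 := Chom.apply_smul f x (fun _ => (a / W, b / W)) (ℓ / W) h
    have h2 : (W • (fun _ => (a / W, b / W)) : Fin 1 → ℝ × ℝ) = fun _ => (a, b) := by
      funext i
      change (W * (a / W), W * (b / W)) = _
      rw [mul_div_cancel₀ _ h.ne', mul_div_cancel₀ _ h.ne']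
    rw [h2, mul_div_cancel₀ _ h.ne'] at h1
    exact h1.symm

/-- If the Lebesgue measure, `p` and `z` have the densities `ℓ`, `a` and `b` with respect to `ν`,
then `⟨f, δ_(p, z)⟩ = ∫ f(x, (a, b), ℓ) dν`. -/
theorem youngDelta_withDensityᵥ (ν : Measure Seg) [IsFiniteMeasure ν] {a b ℓ : Seg → ℝ}
    (ha : Measurable a) (hb : Measurable b) (hℓ : Measurable ℓ) (hℓ0 : ∀ x, 0 ≤ ℓ x)
    (hai : Integrable a ν) (hbi : Integrable b ν)
    (hvol : (volume : Measure Seg) = ν.withDensity fun x => ENNReal.ofReal (ℓ x))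
    (f : Chom (Fin 1 → ℝ × ℝ)) :
    youngDelta (fun _ => (ν.withDensityᵥ a, ν.withDensityᵥ b)) f =
      ∫ x, f.1 (x, fun _ => (a x, b x), ℓ x) ∂ν := by
  -- `W` is the density of the measure `λ` in the definition of `youngDelta`.
  obtain ⟨W, hWdef⟩ : ∃ W : Seg → ℝ, W = fun x => ℓ x + (|a x| + |b x|) := ⟨_, rfl⟩
  have hW : Measurable W := hWdef ▸ hℓ.add (ha.abs.add hb.abs)
  have hlam : (volume : Measure Seg) + (SignedMeasure.totalVariation (ν.withDensityᵥ a) +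
      SignedMeasure.totalVariation (ν.withDensityᵥ b)) =
      ν.withDensity fun x => ENNReal.ofReal (W x) := by
    rw [totalVariation_withDensityᵥ hai, totalVariation_withDensityᵥ hbi]
    conv_lhs => rw [hvol]
    rw [← withDensity_add_left ha.abs.ennreal_ofReal, ← withDensity_add_left hℓ.ennreal_ofReal]
    congr 1
    funext x
    simp only [Pi.add_apply, hWdef]
    rw [← ENNReal.ofReal_add (abs_nonneg _) (abs_nonneg _),
      ← ENNReal.ofReal_add (hℓ0 x) (by positivity)]
  have hW0 : ∀ x, 0 ≤ W x := fun x => by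
    have := hℓ0 x
    have := abs_nonneg (a x)
    have := abs_nonneg (b x)
    simp only [hWdef]
    linarith
  have haW : ∀ x, |a x| ≤ W x := fun x => by
    have := hℓ0 x
    have := abs_nonneg (b x)
    simp only [hWdef]
    linarith
  have hbW : ∀ x, |b x| ≤ W x := fun x => by
    have := hℓ0 x
    have := abs_nonneg (a x)
    simp only [hWdef]
    linarith
  have hℓW : ∀ x, ℓ x ≤ W x := fun x => by
    have := abs_nonneg (a x)
    have := abs_nonneg (b x)
    simp only [hWdef]
    linarith
  have r1 := rnDeriv_withDensityᵥ ν hai hW haW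
  have r2 := rnDeriv_withDensityᵥ ν hbi hW hbW
  have r3 : (volume : Measure Seg).rnDeriv (ν.withDensity fun x => ENNReal.ofReal (W x))
      =ᵐ[ν.withDensity fun x => ENNReal.ofReal (W x)] fun x => ENNReal.ofReal (ℓ x / W x) := by
    have hm : Measurable fun x => ENNReal.ofReal (ℓ x / W x) := (hℓ.div hW).ennreal_ofReal
    have h1 := Measure.rnDeriv_withDensity (ν.withDensity fun x => ENNReal.ofReal (W x))
      (f := fun x => ENNReal.ofReal (ℓ x / W x)) hm
    rwa [withDensity_ofReal_div ν hℓ hW hℓ0 hℓW, ← hvol] at h1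
  rw [youngDelta_eq_integral _ _ hlam r1 r2 (γ := fun x => ℓ x / W x) (by
      filter_upwards [r3] with x h3
      rw [h3, ENNReal.toReal_ofReal (div_nonneg (hℓ0 x) (hW0 x))]),
    integral_withDensity_eq_integral_toReal_smul hW.ennreal_ofReal
      (ae_of_all _ fun x => ENNReal.ofReal_lt_top)]
  refine integral_congr_ae (ae_of_all _ fun x => ?_)
  simp only [ENNReal.toReal_ofReal (hW0 x), smul_eq_mul]
  exact Chom.mul_apply_div f x (haW x) (hbW x) ((abs_of_nonneg (hℓ0 x)).trans_le (hℓW x))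

theorem measurableSet_origin : MeasurableSet ({Seg.origin} : Set Seg) := measurableSet_singleton _

theorem volume_origin : (volume : Measure Seg) {Seg.origin} = 0 := by
  have := ae_seg_ne_zero
  refine measure_mono_null (fun y hy => ?_) this
  rw [mem_singleton_iff.1 hy]
  change ¬ ((0 : ℝ) ≠ 0)
  simp

/-- The densities with respect to `volume + dirac origin`, in this lemma and in the next two, live
on the origin and on its complement respectively. -/
theorem dirac_eq_withDensityᵥ (c : ℝ) :
    VectorMeasure.dirac Seg.origin c = ((volume : Measure Seg) + Measure.dirac Seg.origin).withDensityᵥ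
      (indicator {Seg.origin} fun _ => c) := by
  have hi : Integrable (indicator {Seg.origin} fun _ => c)
      ((volume : Measure Seg) + Measure.dirac Seg.origin) :=
    (integrable_const c).indicator measurableSet_origin
  ext s hs
  rw [withDensityᵥ_apply hi hs, setIntegral_indicator measurableSet_origin, setIntegral_const,
    smul_eq_mul]
  by_cases h : Seg.origin ∈ s
  · rw [VectorMeasure.dirac_apply_of_mem hs h, inter_eq_right.2 (singleton_subset_iff.2 h),
      measureReal_def, Measure.add_apply, volume_origin]
    simp
  · rw [VectorMeasure.dirac_apply_of_notMem h, inter_singleton_eq_empty.2 h]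
    simp

theorem densityMeasure_eq_withDensityᵥ {z : Seg → ℝ} (hz : Integrable z) :
    Integrable (indicator {Seg.origin}ᶜ z) ((volume : Measure Seg) + Measure.dirac Seg.origin) ∧
    densityMeasure z = ((volume : Measure Seg) + Measure.dirac Seg.origin).withDensityᵥ
      (indicator {Seg.origin}ᶜ z) := by
  have h0 : indicator {Seg.origin}ᶜ z =ᵐ[Measure.dirac Seg.origin] 0 := by
    rw [ae_dirac_eq]
    exact eventually_pure.2 (by simp)
  have h1 : indicator {Seg.origin}ᶜ z =ᵐ[volume] z := by
    filter_upwards [compl_mem_ae_iff.2 volume_origin] with y hy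
    exact indicator_of_mem hy z
  have i0 : Integrable (indicator {Seg.origin}ᶜ z) (Measure.dirac Seg.origin) :=
    (integrable_congr h0).2 (integrable_zero _ _ _)
  have i1 : Integrable (indicator {Seg.origin}ᶜ z) := (integrable_congr h1).2 hz
  have hi : Integrable (indicator {Seg.origin}ᶜ z)
      ((volume : Measure Seg) + Measure.dirac Seg.origin) := integrable_add_measure.2 ⟨i1, i0⟩
  refine ⟨hi, ?_⟩
  ext s hs
  rw [densityMeasure, withDensityᵥ_apply hz hs, withDensityᵥ_apply hi hs, Measure.restrict_add,
    integral_add_measure i1.restrict i0.restrict,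
    integral_congr_ae (ae_restrict_of_ae h1), integral_congr_ae (ae_restrict_of_ae h0)]
  simp

theorem volume_eq_withDensity : (volume : Measure Seg) =
    ((volume : Measure Seg) + Measure.dirac Seg.origin).withDensity
      fun x => ENNReal.ofReal (indicator {Seg.origin}ᶜ (fun _ => 1) x) := by
  have h0 : (fun x => ENNReal.ofReal (indicator {Seg.origin}ᶜ (fun _ => (1 : ℝ)) x)) =
      indicator {Seg.origin}ᶜ 1 := by
    funext x
    by_cases h : x ∈ ({Seg.origin}ᶜ : Set Seg)
    · rw [indicator_of_mem h, indicator_of_mem h, ENNReal.ofReal_one, Pi.one_apply]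
    · rw [indicator_of_notMem h, indicator_of_notMem h, ENNReal.ofReal_zero]
  rw [h0, withDensity_indicator_one measurableSet_origin.compl, Measure.restrict_add,
    Measure.restrict_eq_self_of_ae_mem (s := {Seg.origin}ᶜ) (compl_mem_ae_iff.2 volume_origin),
    restrict_dirac' measurableSet_origin.compl]
  simp

theorem Chom.integrable {f : Chom (Fin 1 → ℝ × ℝ)} {ν : Measure Seg} [IsFiniteMeasure ν]
    {a b ℓ : Seg → ℝ} (ha : Integrable a ν) (hb : Integrable b ν) (hℓ : Integrable ℓ ν) :
    Integrable (fun x => f.1 (x, fun _ => (a x, b x), ℓ x)) ν := by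
  obtain ⟨C, hC0, hC⟩ := Chom.exists_bound f
  have hm : AEStronglyMeasurable
      (fun x : Seg => ((x, fun _ => (a x, b x), ℓ x) : Seg × (Fin 1 → ℝ × ℝ) × ℝ)) ν := by
    refine (measurable_id.aemeasurable.prodMk (AEMeasurable.prodMk (aemeasurable_pi_lambda _
      fun i => ha.aemeasurable.prodMk hb.aemeasurable) hℓ.aemeasurable)).aestronglyMeasurable
  refine (((ha.abs.add hb.abs).add hℓ.abs).const_mul C).mono'
    (f.1.continuous.comp_aestronglyMeasurable hm) (ae_of_all _ fun x => ?_)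
  refine (hC _ _ _).trans (mul_le_mul_of_nonneg_left ?_ hC0)
  simp only [Pi.add_apply]
  have h1 := abs_nonneg (a x)
  have h2 := abs_nonneg (b x)
  have h3 := abs_nonneg (ℓ x)
  rw [Prod.norm_def]
  refine max_le ?_ (by simpa using by linarith)
  refine (pi_norm_le_iff_of_nonneg (by positivity)).2 fun i => ?_
  rw [Prod.norm_def]
  exact max_le (by simpa using by linarith) (by simpa using by linarith)

/-- The duality with the Young measure of a density and a concentrated slip. -/
theorem youngDelta_slip {z : Seg → ℝ} (hz : Integrable z) (c d : ℝ) (f : Chom (Fin 1 → ℝ × ℝ)) :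
    youngDelta (fun _ => (VectorMeasure.dirac Seg.origin c,
      densityMeasure z + VectorMeasure.dirac Seg.origin d)) f =
      (∫ x, f.1 (x, fun _ => (0, z x), 1)) + f.1 (Seg.origin, fun _ => (c, d), 0) := by
  -- Densities that are measurable everywhere are needed.
  set z' := hz.1.mk z with hz'
  have hzz : z =ᵐ[volume] z' := hz.1.ae_eq_mk
  have hz'm : Measurable z' := hz.1.measurable_mk
  have hz'i : Integrable z' := (integrable_congr hzz).1 hz
  have hd : densityMeasure z = densityMeasure z' := WithDensityᵥEq.congr_ae hzz
  obtain ⟨hi, hde⟩ := densityMeasure_eq_withDensityᵥ hz'i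
  have hm0 := measurableSet_origin
  have hci : ∀ c : ℝ, Integrable (indicator {Seg.origin} fun _ => c)
      ((volume : Measure Seg) + Measure.dirac Seg.origin) := fun c =>
    (integrable_const c).indicator hm0
  have hbi := hi.add (hci d)
  have hli : Integrable (indicator {Seg.origin}ᶜ fun _ => (1 : ℝ))
      ((volume : Measure Seg) + Measure.dirac Seg.origin) :=
    (integrable_const 1).indicator hm0.compl
  rw [hd, hde, dirac_eq_withDensityᵥ, dirac_eq_withDensityᵥ, ← withDensityᵥ_add hi (hci d),
    youngDelta_withDensityᵥ _ (ℓ := indicator {Seg.origin}ᶜ fun _ => 1)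
      (measurable_const.indicator hm0) ((hz'm.indicator hm0.compl).add
      (measurable_const.indicator hm0)) (measurable_const.indicator hm0.compl)
      (fun x => indicator_nonneg (fun _ _ => zero_le_one) x) (hci c) hbi volume_eq_withDensity f]
  have hI := Chom.integrable (f := f) (hci c) hbi hli
  rw [integrable_add_measure] at hI
  rw [integral_add_measure hI.1 hI.2, integral_dirac]
  congr 1
  · refine integral_congr_ae ?_
    filter_upwards [compl_mem_ae_iff.2 volume_origin, hzz] with x hx hx'
    have hx2 : x ∉ ({Seg.origin} : Set Seg) := hx
    rw [indicator_of_notMem hx2, indicator_of_mem hx, Pi.add_apply, indicator_of_mem hx,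
      indicator_of_notMem hx2, add_zero, hx']
  · have h1 : Seg.origin ∈ ({Seg.origin} : Set Seg) := rfl
    have h2 : Seg.origin ∉ ({Seg.origin}ᶜ : Set Seg) := fun h => h h1
    rw [indicator_of_mem h1, indicator_of_notMem h2, Pi.add_apply, indicator_of_notMem h2,
      indicator_of_mem h1, zero_add]

/-- The dissipation of a slip concentrated at the origin. -/
theorem dissipationFunctional_dirac (c : ℝ) :
    dissipationFunctional diamond (VectorMeasure.dirac Seg.origin c) 0 = 2 * |c| := by
  have hc : VectorMeasure.dirac Seg.origin c =
      (Measure.dirac Seg.origin).withDensityᵥ fun _ => c := by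
    ext s hs
    rw [withDensityᵥ_apply (integrable_const c) hs, setIntegral_const, smul_eq_mul]
    by_cases h : Seg.origin ∈ s
    · simp [VectorMeasure.dirac_apply_of_mem hs h, measureReal_def, h]
    · simp [VectorMeasure.dirac_apply_of_notMem h, measureReal_def, h, hs]
  have h0 : (0 : SignedMeasure Seg) = (Measure.dirac Seg.origin).withDensityᵥ fun _ => (0 : ℝ) :=
    (withDensityᵥ_zero).symm
  have hlam : SignedMeasure.totalVariation (VectorMeasure.dirac Seg.origin c) +
      SignedMeasure.totalVariation 0 =
      (Measure.dirac Seg.origin).withDensity fun _ => ENNReal.ofReal |c| := by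
    rw [SignedMeasure.totalVariation_zero, add_zero, hc,
      totalVariation_withDensityᵥ (integrable_const c)]
  unfold dissipationFunctional
  rw [hlam]
  have r1 := rnDeriv_withDensityᵥ (Measure.dirac Seg.origin) (a := fun _ => c) (W := fun _ => |c|)
    (integrable_const c) measurable_const (fun _ => le_rfl)
  have r2 := rnDeriv_withDensityᵥ (Measure.dirac Seg.origin) (a := fun _ => 0) (W := fun _ => |c|)
    (integrable_const 0) measurable_const (fun _ => by simp)
  rw [← hc] at r1
  rw [← h0] at r2
  have e1 := integral_congr_ae (g := fun _ : Seg => 2 * |c / (|c|)|)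
    (f := fun x => supportFn diamond (SignedMeasure.rnDeriv (VectorMeasure.dirac Seg.origin c)
      ((Measure.dirac Seg.origin).withDensity fun _ => ENNReal.ofReal |c|) x,
      SignedMeasure.rnDeriv 0
      ((Measure.dirac Seg.origin).withDensity fun _ => ENNReal.ofReal |c|) x))
    (by
      filter_upwards [r1, r2] with x h1 h2
      rw [h1, h2, supportFn_diamond, zero_div, abs_zero, max_eq_left (abs_nonneg _)])
  rw [e1, integral_withDensity_eq_integral_toReal_smul measurable_const
    (ae_of_all _ fun x => ENNReal.ofReal_lt_top), integral_dirac,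
    ENNReal.toReal_ofReal (abs_nonneg _), smul_eq_mul, abs_div, abs_abs]
  rcases eq_or_ne c 0 with rfl | h
  · simp
  · have : |c| ≠ 0 := abs_ne_zero.2 h
    field_simp

/-- Integration of a continuous function against an absolutely continuous signed measure. -/
theorem vectorIntegral_densityMeasure {z : Seg → ℝ} (hz : Integrable z) (ψ : C(Seg, ℝ)) :
    ∫ᵛ y, ψ y ∂•(densityMeasure z) = ∫ y, ψ y * z y := by
  have key : ∀ (μ : Measure Seg) [IsFiniteMeasure μ],
      ∫ᵛ y, ψ y ∂•(μ.toSignedMeasure) = ∫ y, ψ y ∂μ := by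
    intro μ _
    have hflip : (ContinuousLinearMap.lsmul ℝ ℝ : ℝ →L[ℝ] ℝ →L[ℝ] ℝ) =
        (ContinuousLinearMap.lsmul ℝ ℝ : ℝ →L[ℝ] ℝ →L[ℝ] ℝ).flip := by
      ext
      simp
    rw [hflip]
    exact VectorMeasure.integral_toSignedMeasure
  have hint : ∀ (μ : Measure Seg) [IsFiniteMeasure μ],
      VectorMeasure.Integrable μ.toSignedMeasure (fun y => ψ y) := by
    intro μ _
    rw [VectorMeasure.Integrable, Measure.variation_toSignedMeasure]
    exact ψ.continuous.integrable_of_hasCompactSupport (HasCompactSupport.of_compactSpace _)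
  have := isFiniteMeasure_withDensity_ofReal hz.2
  have := isFiniteMeasure_withDensity_ofReal hz.neg.2
  obtain ⟨B, hB⟩ : ∃ B, ∀ y : Seg, ‖ψ y‖ ≤ B := ⟨‖ψ‖, ψ.norm_coe_le_norm⟩
  have hmul : ∀ v : Seg → ℝ, Integrable v →
      Integrable (fun y => (ENNReal.ofReal (v y)).toReal • ψ y) := by
    intro v hv
    simp only [ENNReal.toReal_ofReal', smul_eq_mul]
    exact hv.pos_part.mul_bdd ψ.continuous.aestronglyMeasurable (ae_of_all _ hB)
  have hzn : AEMeasurable (fun y => ENNReal.ofReal (-z y)) :=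
    hz.1.aemeasurable.neg.ennreal_ofReal
  rw [densityMeasure, withDensityᵥ_eq_withDensity_pos_part_sub_withDensity_neg_part hz,
    VectorMeasure.integral_sub_vectorMeasure (hint _) (hint _), key, key,
    integral_withDensity_eq_integral_toReal_smul₀ hz.1.aemeasurable.ennreal_ofReal
      (ae_of_all _ fun x => ENNReal.ofReal_lt_top),
    integral_withDensity_eq_integral_toReal_smul₀ hzn
      (ae_of_all _ fun x => ENNReal.ofReal_lt_top),
    ← integral_sub (hmul z hz) (hmul (fun y => -z y) hz.neg)]
  refine integral_congr_ae (ae_of_all _ fun y => ?_)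
  simp only [ENNReal.toReal_ofReal', smul_eq_mul]
  rw [← sub_mul, mul_comm]
  congr 1
  rcases le_total 0 (z y) with h | h
  · rw [max_eq_left h, max_eq_right (by linarith), sub_zero]
  · rw [max_eq_right h, max_eq_left (by linarith)]
    ring

theorem vectorIntegral_dirac (ψ : C(Seg, ℝ)) (c : ℝ) :
    ∫ᵛ y, ψ y ∂•(VectorMeasure.dirac Seg.origin c) = ψ Seg.origin * c := by
  rw [VectorMeasure.integral_dirac]
  simp

/-! ### Concentration of the plastic strain -/

/-- Near the origin, a function in `C^hom` behaves along `(r, θ + j r)` like `r` times its value in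
the direction `(1, j)` at infinity: for large `r` by homogeneity and continuity, while bounded `r`
only contribute a bounded error. -/
theorem Chom.exists_abs_sub_le (f : Chom (Fin 1 → ℝ × ℝ)) (j : ℝ) {η : ℝ} (hη : 0 < η) :
    ∃ κ > 0, ∃ C, 0 ≤ C ∧ ∀ y : Seg, |(y : ℝ)| < κ → ∀ r, 0 ≤ r → ∀ θ, |θ| ≤ 1 →
      |f.1 (y, fun _ => (r, θ + j * r), 1) - r * f.1 (Seg.origin, fun _ => (1, j), 0)| ≤
        η * r + C := by
  let G : Seg × ℝ × ℝ → ℝ := fun q => f.1 (q.1, fun _ => (1, q.2.1 + j), q.2.2)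
  have hG : Continuous G := f.1.continuous.comp (by fun_prop)
  obtain ⟨τ, hτ, hτG⟩ := Metric.continuous_iff.1 hG (Seg.origin, 0, 0) η hη
  obtain ⟨C₀, hC₀, hf⟩ := Chom.exists_bound f
  set F := f.1 (Seg.origin, fun _ => (1, j), 0) with hF
  have hGF : G (Seg.origin, 0, 0) = F := by simp [G, hF]
  refine ⟨τ, hτ, C₀ * ((2 / τ) * (1 + |j|) + 2) + 2 / τ * |F|, by positivity,
    fun y hy r hr θ hθ => ?_⟩
  -- Beyond the threshold `2 / τ` both `|θ| / r` and `1 / r` are less than `τ`.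
  rcases le_or_gt r (2 / τ) with h | h
  · have h1 : ‖((fun _ => (r, θ + j * r), 1) : (Fin 1 → ℝ × ℝ) × ℝ)‖ ≤
        (2 / τ) * (1 + |j|) + 2 := by
      have e1 : |θ + j * r| ≤ 1 + |j| * (2 / τ) := by
        refine (abs_add_le _ _).trans (add_le_add hθ ?_)
        rw [abs_mul, abs_of_nonneg hr]
        gcongr
      have e2 : 0 ≤ |j| * (2 / τ) := by positivity
      have e3 : 0 ≤ 2 / τ := by positivity
      rw [Prod.norm_def]
      refine max_le ((pi_norm_le_iff_of_nonneg (by positivity)).2 fun i => ?_) ?_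
      · rw [Prod.norm_def]
        refine max_le ?_ ?_
        · change |r| ≤ _
          rw [abs_of_nonneg hr]
          nlinarith
        · change |θ + j * r| ≤ _
          nlinarith
      · change ‖(1 : ℝ)‖ ≤ _
        rw [norm_one]
        nlinarith
    have h2 := (hf y (fun _ => (r, θ + j * r)) 1).trans (mul_le_mul_of_nonneg_left h1 hC₀)
    have h3 : |r * F| ≤ 2 / τ * |F| := by
      rw [abs_mul, abs_of_nonneg hr]
      gcongr
    have h4 : 0 ≤ η * r := by positivity
    exact (abs_sub _ _).trans (by linarith)
  · have hr0 : 0 < r := lt_of_le_of_lt (by positivity) h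
    have h1 := Chom.apply_smul f y (fun _ => (1, θ / r + j)) (1 / r) hr0
    have h2 : (r • (fun _ => (1, θ / r + j)) : Fin 1 → ℝ × ℝ) = fun _ => (r, θ + j * r) := by
      funext i
      change (r * 1, r * (θ / r + j)) = _
      rw [mul_one, mul_add, mul_div_cancel₀ _ hr0.ne', mul_comm j]
    rw [h2, mul_one_div_cancel hr0.ne'] at h1
    have hrτ : 1 / r < τ := by
      rw [div_lt_iff₀ hr0]
      rw [div_lt_iff₀ hτ] at h
      linarith
    have h3 := hτG (y, θ / r, 1 / r) (by
      rw [Prod.dist_eq, Prod.dist_eq]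
      refine max_lt ?_ (max_lt ?_ ?_)
      · change |(y : ℝ) - 0| < τ
        rwa [sub_zero]
      · change |θ / r - 0| < τ
        rw [sub_zero, abs_div, abs_of_pos hr0]
        exact (div_le_div_of_nonneg_right hθ hr0.le).trans_lt hrτ
      · change |1 / r - 0| < τ
        rw [sub_zero, abs_of_pos (by positivity)]
        exact hrτ)
    rw [hGF, Real.dist_eq] at h3
    rw [h1, ← mul_sub, abs_mul, abs_of_pos hr0, mul_comm η]
    have h4 : r * |G (y, θ / r, 1 / r) - F| ≤ r * η := mul_le_mul_of_nonneg_left h3.le hr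
    have h5 : 0 ≤ C₀ * ((2 / τ) * (1 + |j|) + 2) + 2 / τ * |F| := by positivity
    exact h4.trans (by linarith)

theorem volume_real_abs_lt_le {κ : ℝ} (hκ : 0 ≤ κ) :
    volume.real {y : Seg | |(y : ℝ)| < κ} ≤ 2 * κ := by
  have h : (volume : Measure Seg) {y : Seg | |(y : ℝ)| < κ} ≤ ENNReal.ofReal (2 * κ) := by
    change (volume : Measure ℝ).comap Subtype.val _ ≤ _
    rw [comap_subtype_coe_apply measurableSet_Icc]
    refine (measure_mono (t := Ioo (-κ) κ) ?_).trans_eq ?_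
    · rintro _ ⟨y, hy, rfl⟩
      exact abs_lt.1 hy
    · rw [Real.volume_Ioo]
      congr 1
      ring
  exact ENNReal.toReal_le_of_le_ofReal (by positivity) h

namespace IsSymmetricSlip

variable {z₀ : ℝ → ℝ} {κ a : ℝ} {p z : L2}

theorem integral (h : IsSymmetricSlip z₀ κ a p z) : ∫ y, p y = a := by
  rw [integral_eq_add_side (L2.integrable p), h.integral_side 1 (Or.inl rfl),
    h.integral_side (-1) (Or.inr rfl), add_halves]

/-- A density whose mass `a` splits equally between the two sides of the origin, with opposite
signs of the internal variable, is close to the average of the two concentrated slips. -/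
theorem abs_integral_sub_le (hz₀ : IsInitialProfile z₀) (hi : Integrable fun y : Seg => z₀ y)
    (f : Chom (Fin 1 → ℝ × ℝ)) {η : ℝ} (hη : 0 < η) : ∃ κ > 0, ∀ (a : ℝ) (p z : L2),
      IsSymmetricSlip z₀ κ a p z →
      |(∫ y, f.1 (y, fun _ => (p y, z y), 1)) - ((∫ y : Seg, f.1 (y, fun _ => (0, z₀ y), 1)) +
        a / 2 * (f.1 (Seg.origin, fun _ => (1, 1), 0) + f.1 (Seg.origin, fun _ => (1, -1), 0)))| ≤
        η * (a + 1) := by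
  obtain ⟨κ₁, hκ₁, C₁, hC₁, H₁⟩ := Chom.exists_abs_sub_le f 1 hη
  obtain ⟨κ₂, hκ₂, C₂, hC₂, H₂⟩ := Chom.exists_abs_sub_le f (-1) hη
  set C := max C₁ C₂
  have hC : 0 ≤ C := hC₁.trans (le_max_left _ _)
  -- The bounded errors, at most `2 C`, are made on a set of measure at most `2 κ`.
  obtain ⟨κ, hκ0, hκ1, hκ2, hκC⟩ : ∃ κ > 0, κ ≤ κ₁ ∧ κ ≤ κ₂ ∧ 2 * C * (2 * κ) ≤ η := by
    refine ⟨min (min κ₁ κ₂) (η / (4 * C + 1)), by positivity,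
      (min_le_left _ _).trans (min_le_left _ _), (min_le_left _ _).trans (min_le_right _ _), ?_⟩
    have h1 : 2 * C * (2 * min (min κ₁ κ₂) (η / (4 * C + 1))) ≤
        2 * C * (2 * (η / (4 * C + 1))) := by
      gcongr
      exact min_le_right _ _
    refine h1.trans ?_
    have h2 : 2 * C * (2 * (η / (4 * C + 1))) = η * (4 * C) / (4 * C + 1) := by ring
    rw [h2, div_le_iff₀ (by positivity)]
    nlinarith
  refine ⟨κ, hκ0, fun a p z h => ?_⟩
  set F : ℝ → ℝ := fun j => f.1 (Seg.origin, fun _ => (1, j), 0) with hF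
  have hH : ∀ j : ℝ, (j = 1 ∨ j = -1) → ∀ y : Seg, |(y : ℝ)| < κ → ∀ r, 0 ≤ r → ∀ θ, |θ| ≤ 1 →
      |f.1 (y, fun _ => (r, θ + j * r), 1) - r * F j| ≤ η * r + C := by
    rintro j (rfl | rfl) y hy r hr θ hθ
    · exact (H₁ y (hy.trans_le hκ1) r hr θ hθ).trans (by gcongr; exact le_max_left _ _)
    · exact (H₂ y (hy.trans_le hκ2) r hr θ hθ).trans (by gcongr; exact le_max_right _ _)
  have i1 : Integrable fun y => f.1 (y, fun _ => (p y, z y), 1) :=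
    Chom.integrable (f := f) (L2.integrable p) (L2.integrable z) (integrable_const 1)
  have i0 : Integrable fun y : Seg => f.1 (y, fun _ => (0, z₀ y), 1) :=
    Chom.integrable (f := f) (integrable_zero _ _ _) hi (integrable_const 1)
  have hp := L2.integrable p
  let D : Seg → ℝ := fun y => f.1 (y, fun _ => (p y, z y), 1) - f.1 (y, fun _ => (0, z₀ y), 1)
  have iD : Integrable D := i1.sub i0
  have hD : ∀ j : ℝ, (j = 1 ∨ j = -1) → ∀ᵐ y, y ∈ Seg.side j →
      |D y - p y * F j| ≤ η * p y + 2 * C * indicator {y : Seg | |(y : ℝ)| < κ} 1 y := by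
    intro j hj
    filter_upwards [h.nonneg, h.concentrated, h.z_eq j hj, ae_seg_ne_zero] with y h1 h2 h3 h4 hy
    rcases lt_or_ge |(y : ℝ)| κ with hyκ | hyκ
    · have hθ := (hz₀.abs_lt_one h4).le
      have e1 := hH j hj y hyκ (p y) h1 (z₀ y) hθ
      have e2 := hH j hj y hyκ 0 le_rfl (z₀ y) hθ
      simp only [mul_zero, add_zero, zero_mul, sub_zero, zero_add] at e2
      rw [indicator_of_mem (show y ∈ {y : Seg | |(y : ℝ)| < κ} from hyκ), Pi.one_apply]
      simp only [D]
      rw [h3 hy]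
      rw [show f.1 (y, fun _ => (p y, z₀ y + j * p y), 1) - f.1 (y, fun _ => (0, z₀ y), 1) -
        p y * F j = f.1 (y, fun _ => (p y, z₀ y + j * p y), 1) - p y * F j -
        f.1 (y, fun _ => (0, z₀ y), 1) by ring]
      exact (abs_sub _ _).trans (by linarith)
    · rw [indicator_of_notMem (show y ∉ {y : Seg | |(y : ℝ)| < κ} from not_lt.2 hyκ)]
      simp only [D]
      rw [h3 hy, h2 hyκ]
      simp
  have hms : MeasurableSet {y : Seg | |(y : ℝ)| < κ} :=
    measurableSet_lt measurable_subtype_coe.abs measurable_const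
  have iI : Integrable fun y : Seg => 2 * C * indicator {y : Seg | |(y : ℝ)| < κ} (1 : Seg → ℝ) y :=
    ((integrable_const (1 : ℝ)).indicator hms).const_mul _
  have iB : Integrable fun y : Seg =>
      η * p y + 2 * C * indicator {y : Seg | |(y : ℝ)| < κ} 1 y :=
    (hp.const_mul η).add iI
  have hside : ∀ j : ℝ, (j = 1 ∨ j = -1) → |(∫ y in Seg.side j, D y) - a / 2 * F j| ≤
      ∫ y in Seg.side j, (η * p y + 2 * C * indicator {y : Seg | |(y : ℝ)| < κ} 1 y) := by
    intro j hj
    have e1 : (∫ y in Seg.side j, D y) - a / 2 * F j = ∫ y in Seg.side j, (D y - p y * F j) := by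
      rw [integral_sub iD.integrableOn (hp.mul_const _).integrableOn, integral_mul_const,
        h.integral_side j hj]
    rw [e1]
    refine abs_integral_le_integral_abs.trans (integral_mono_ae
      (iD.sub (hp.mul_const _)).abs.integrableOn iB.integrableOn ?_)
    rw [EventuallyLE, ae_restrict_iff' (Seg.measurableSet_side j)]
    exact hD j hj
  have hsum := add_le_add (hside 1 (Or.inl rfl)) (hside (-1) (Or.inr rfl))
  rw [← integral_eq_add_side iB, integral_add (hp.const_mul η) iI, integral_const_mul,
    integral_const_mul, h.integral, integral_indicator_one hms] at hsum
  have hvol := volume_real_abs_lt_le hκ0.le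
  have hDint : (∫ y, f.1 (y, fun _ => (p y, z y), 1)) - (∫ y : Seg, f.1 (y, fun _ => (0, z₀ y), 1))
      = (∫ y in Seg.side 1, D y) + ∫ y in Seg.side (-1), D y := by
    rw [← integral_eq_add_side iD, ← integral_sub i1 i0]
  have e3 : (∫ y, f.1 (y, fun _ => (p y, z y), 1)) - ((∫ y : Seg, f.1 (y, fun _ => (0, z₀ y), 1)) +
      a / 2 * (F 1 + F (-1))) = ((∫ y in Seg.side 1, D y) - a / 2 * F 1) +
      ((∫ y in Seg.side (-1), D y) - a / 2 * F (-1)) := by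
    rw [← sub_sub, hDint]
    ring
  change |_ - ((∫ y : Seg, f.1 (y, fun _ => (0, z₀ y), 1)) + a / 2 * (F 1 + F (-1)))| ≤ _
  rw [e3]
  refine (abs_add_le _ _).trans (hsum.trans ?_)
  have e4 : 2 * C * volume.real {y : Seg | |(y : ℝ)| < κ} ≤ 2 * C * (2 * κ) := by gcongr
  linarith

/-- The dissipation between two states with increasing plastic strain is twice the increment of
the total slip, since the internal variable moves at the same speed as the plastic strain. -/
theorem integral_supportFn {b : ℝ} {p' z' : L2} (h : IsSymmetricSlip z₀ κ a p z)
    (h' : IsSymmetricSlip z₀ κ b p' z') (hp : ∀ᵐ y, p y ≤ p' y) :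
    ∫ y, supportFn diamond ((p' y, z' y) - (p y, z y)) = 2 * (b - a) := by
  have e : ∀ᵐ y, supportFn diamond ((p' y, z' y) - (p y, z y)) = 2 * (p' y - p y) := by
    refine ae_seg_of_side fun j hj => ?_
    filter_upwards [h.z_eq j hj, h'.z_eq j hj, hp] with y h1 h2 h3 hy
    rw [supportFn_diamond, Prod.mk_sub_mk, h1 hy, h2 hy, add_sub_add_left_eq_sub, ← mul_sub,
      abs_mul, abs_of_sign hj, one_mul, max_self, abs_of_nonneg (sub_nonneg.2 h3)]
  rw [integral_congr_ae e, integral_const_mul, integral_sub (L2.integrable p') (L2.integrable p),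
    h.integral, h'.integral]

end IsSymmetricSlip

/-- Along a vanishing sequence of viscosities, the stress tends to `min t 1`, and the Young measures
of the states to the average of the two concentrated slips. -/
theorem tendsto_reduced {g : ℝ → ℝ} {M : ℝ} (hg : IsSofteningForce g M) {z₀ : ℝ → ℝ}
    (hz₀ : IsInitialProfile z₀) (hi : Integrable fun y : Seg => z₀ y) {ε : ℕ → ℝ}
    (hε : ∀ k, 0 < ε k) (hε0 : Tendsto ε atTop (𝓝 0)) {c : ℕ → ℝ → ℝ} {p z pDot zDot : ℕ → ℝ → L2}
    (h : ∀ k, IsReducedEvolution g z₀ (ε k) (c k) (p k) (z k) (pDot k) (zDot k)) {t : ℝ}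
    (ht : 0 ≤ t) :
    Tendsto (fun k => c k t) atTop (𝓝 (min t 1)) ∧
    ∀ f : Chom (Fin 1 → ℝ × ℝ), Tendsto (fun k => ∫ y, f.1 (y, fun _ => (p k t y, z k t y), 1)) atTop
      (𝓝 ((∫ y : Seg, f.1 (y, fun _ => (0, z₀ y), 1)) + max (t - 1) 0 / 2 *
        (f.1 (Seg.origin, fun _ => (1, 1), 0) + f.1 (Seg.origin, fun _ => (1, -1), 0)))) := by
  have hev : ∀ κ > 0, ∀ η > 0, ∀ᶠ k in atTop, |c k t - min t 1| ≤ η ∧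
      IsSymmetricSlip z₀ κ (t - c k t) (p k t) (z k t) := by
    intro κ hκ η hη
    obtain ⟨ε₀, hε₀, H⟩ := exists_forall_reduced hg hz₀ hκ hη
    filter_upwards [hε0.eventually (gt_mem_nhds hε₀)] with k hk
    exact H _ _ _ _ _ _ (hε k) hk (h k) t ht
  have hc : Tendsto (fun k => c k t) atTop (𝓝 (min t 1)) := by
    refine Metric.tendsto_nhds.2 fun η hη => ?_
    filter_upwards [hev 1 one_pos (η / 2) (half_pos hη)] with k hk
    exact (hk.1 : dist _ _ ≤ _).trans_lt (half_lt_self hη)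
  refine ⟨hc, fun f => ?_⟩
  have ha : Tendsto (fun k => t - c k t) atTop (𝓝 (max (t - 1) 0)) := by
    have h1 : max (t - 1) 0 = t - min t 1 := by
      rcases le_total t 1 with h | h
      · rw [min_eq_left h, max_eq_right (by linarith)]
        ring
      · rw [min_eq_right h, max_eq_left (by linarith)]
    rw [h1]
    exact hc.const_sub t
  set F := f.1 (Seg.origin, fun _ => (1, 1), 0) + f.1 (Seg.origin, fun _ => (1, -1), 0)
  set I := ∫ y : Seg, f.1 (y, fun _ => (0, z₀ y), 1)
  have hlim : Tendsto (fun k => I + (t - c k t) / 2 * F) atTop (𝓝 (I + max (t - 1) 0 / 2 * F)) :=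
    ((ha.div_const 2).mul_const F).const_add I
  have hdiff : Tendsto (fun k => (∫ y, f.1 (y, fun _ => (p k t y, z k t y), 1)) -
      (I + (t - c k t) / 2 * F)) atTop (𝓝 0) := by
    refine Metric.tendsto_nhds.2 fun η hη => ?_
    have hm : 0 ≤ max (t - 1) 0 := le_max_right _ _
    obtain ⟨κ, hκ, H⟩ := IsSymmetricSlip.abs_integral_sub_le hz₀ hi f
      (η := η / (2 * (max (t - 1) 0 + 2))) (by positivity)
    filter_upwards [hev κ hκ 1 one_pos,
      ha.eventually (gt_mem_nhds (lt_add_one (max (t - 1) 0)))] with k hk hk2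
    rw [Real.dist_eq, sub_zero]
    refine (H _ _ _ hk.2).trans_lt ?_
    have : η / (2 * (max (t - 1) 0 + 2)) * (t - c k t + 1) ≤
        η / (2 * (max (t - 1) 0 + 2)) * (max (t - 1) 0 + 2) :=
      mul_le_mul_of_nonneg_left (by linarith) (by positivity)
    refine this.trans_lt ?_
    rw [div_mul_eq_mul_div, div_lt_iff₀ (by positivity)]
    nlinarith
  simpa using hdiff.add hlim

/-! ### The limit Young measure -/

/-- `⟨f, ½ δ_(a δ₀, z₀ + a δ₀) + ½ δ_(a δ₀, z₀ - a δ₀)⟩`, written without reference to measures. -/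
def averageSlip (z₀ : ℝ → ℝ) (a : ℝ) (f : Chom (Fin 1 → ℝ × ℝ)) : ℝ :=
  (∫ y : Seg, f.1 (y, fun _ => (0, z₀ y), 1)) +
    a / 2 * (f.1 (Seg.origin, fun _ => (1, 1), 0) + f.1 (Seg.origin, fun _ => (1, -1), 0))

theorem sub_slip (ν : SignedMeasure Seg) (t : ℝ) :
    ν - slip t = ν + VectorMeasure.dirac Seg.origin (-max (t - 1) 0) := by
  rw [sub_eq_add_neg]
  congr 1
  ext s hs
  rw [neg_apply, slip]
  by_cases h : Seg.origin ∈ s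
  · rw [VectorMeasure.dirac_apply_of_mem hs h, VectorMeasure.dirac_apply_of_mem hs h]
  · rw [VectorMeasure.dirac_apply_of_notMem h, VectorMeasure.dirac_apply_of_notMem h, neg_zero]

theorem slip_sub_slip (s t : ℝ) :
    slip t - slip s = VectorMeasure.dirac Seg.origin (max (t - 1) 0 - max (s - 1) 0) := by
  ext A hA
  rw [sub_apply, slip, slip]
  by_cases h : Seg.origin ∈ A
  · rw [VectorMeasure.dirac_apply_of_mem hA h, VectorMeasure.dirac_apply_of_mem hA h,
      VectorMeasure.dirac_apply_of_mem hA h]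
  · rw [VectorMeasure.dirac_apply_of_notMem h, VectorMeasure.dirac_apply_of_notMem h,
      VectorMeasure.dirac_apply_of_notMem h, sub_zero]

theorem Chom.apply_ray (f : Chom (Fin 1 → ℝ × ℝ)) (x : Seg) {a : ℝ} (ha : 0 ≤ a) (j : ℝ) :
    f.1 (x, fun _ => (a, a * j), 0) = a * f.1 (x, fun _ => (1, j), 0) := by
  rcases ha.eq_or_lt with rfl | h
  · rw [zero_mul, zero_mul]
    exact Chom.apply_zero f x
  · have h1 := Chom.apply_smul f x (fun _ => (1, j)) 0 h
    rw [mul_zero] at h1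
    rw [← h1]
    congr 3
    funext i
    change (a, a * j) = (a * 1, a * j)
    rw [mul_one]

theorem averageSlip_eq_youngDelta {z₀ : ℝ → ℝ} (hi : Integrable fun y : Seg => z₀ y) (t : ℝ)
    (f : Chom (Fin 1 → ℝ × ℝ)) : averageSlip z₀ (max (t - 1) 0) f =
      1 / 2 * youngDelta (fun _ => (slip t, densityMeasure (fun y => z₀ y) + slip t)) f +
      1 / 2 * youngDelta (fun _ => (slip t, densityMeasure (fun y => z₀ y) - slip t)) f := by
  have ha : 0 ≤ max (t - 1) 0 := le_max_right _ _
  have h1 := Chom.apply_ray f Seg.origin ha 1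
  have h2 := Chom.apply_ray f Seg.origin ha (-1)
  rw [mul_one] at h1
  rw [mul_neg_one] at h2
  rw [sub_slip, slip, youngDelta_slip hi, youngDelta_slip hi, h1, h2, averageSlip]
  ring

theorem averageSlip_barycentre {z₀ : ℝ → ℝ} (hi : Integrable fun y : Seg => z₀ y) (t : ℝ)
    (φ ψ : C(Seg, ℝ)) {f : Chom (Fin 1 → ℝ × ℝ)}
    (hf : ∀ q, f.1 q = φ q.1 * (q.2.1 0).1 + ψ q.1 * (q.2.1 0).2) :
    averageSlip z₀ (max (t - 1) 0) f =
      (∫ᵛ y, φ y ∂•(slip t)) + ∫ᵛ y, ψ y ∂•(densityMeasure fun y => z₀ y) := by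
  rw [slip, vectorIntegral_dirac, vectorIntegral_densityMeasure hi, averageSlip]
  simp only [hf, mul_zero, zero_add]
  ring

theorem youngDelta_slip_ne {z₀ : ℝ → ℝ} (hi : Integrable fun y : Seg => z₀ y) {t : ℝ}
    (ht : 1 < t) : ∃ f : Chom (Fin 1 → ℝ × ℝ),
      youngDelta (fun _ => (slip t, densityMeasure (fun y => z₀ y) + slip t)) f ≠
        youngDelta (fun _ => (slip t, densityMeasure (fun y => z₀ y) - slip t)) f := by
  -- The two measures are distinguished by the barycentre of the internal variable.
  let f : Chom (Fin 1 → ℝ × ℝ) := ⟨⟨fun q => (q.2.1 0).2, by fun_prop⟩, fun x ξ η c _ => rfl⟩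
  have hf : ∀ q, f.1 q = (q.2.1 0).2 := fun q => rfl
  refine ⟨f, ?_⟩
  rw [sub_slip, slip, youngDelta_slip hi, youngDelta_slip hi, max_eq_left (by linarith)]
  simp only [hf]
  intro h
  linarith

theorem GY.pair_eq {Ξ : Type*} [NormedAddCommGroup Ξ] [NormedSpace ℝ Ξ] (μ : GY Ξ)
    {F : Seg × Ξ × ℝ → ℝ} (f : Chom Ξ) (hf : ∀ q, f.1 q = F q) : μ.pair F = μ.toFun f := by
  have h : ∃ f : Chom Ξ, ∀ q, f.1 q = F q := ⟨f, hf⟩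
  rw [GY.pair, dif_pos h]
  congr 1
  exact Subtype.ext (ContinuousMap.ext fun q => (h.choose_spec q).trans (hf q).symm)

/-! ### The homogenized potential -/

/-- An even potential with slope `-1` beyond `1` differs from `-|θ|` by a bounded function. -/
theorem exists_abs_add_abs_le {V : ℝ → ℝ} (hVc : Continuous V) (hVeven : ∀ θ, V θ = V (-θ))
    (hV1 : ∀ θ, 1 ≤ θ → V θ = V 1 + 1 - θ) : ∃ C, 0 ≤ C ∧ ∀ θ, |V θ + (|θ|)| ≤ C := by
  obtain ⟨C, hC⟩ := (isCompact_Icc (a := (-1 : ℝ)) (b := 1)).exists_bound_of_continuousOn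
    (f := fun θ => V θ + |θ|) (by fun_prop)
  refine ⟨max C |V 1 + 1|, le_max_of_le_right (abs_nonneg _), fun θ => ?_⟩
  rcases le_or_gt |θ| 1 with h | h
  · exact (hC θ (abs_le.1 h)).trans (le_max_left _ _)
  · have h1 : V θ = V |θ| := by
      rcases abs_choice θ with h | h
      · rw [h]
      · rw [h, ← hVeven]
    rw [h1, hV1 _ h.le, sub_add_cancel]
    exact le_max_right _ _

theorem recession_eq {V : ℝ → ℝ} {C : ℝ} (hC : ∀ θ, |V θ + (|θ|)| ≤ C) (θ : ℝ) :
    recession V θ = -|θ| := by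
  refine Tendsto.limUnder_eq ?_
  have h1 : Tendsto (fun s : ℝ => (V (s * θ) + |s * θ|) / s) atTop (𝓝 0) :=
    tendsto_bdd_div_atTop_nhds_zero (b := -C) (B := C)
      (Eventually.of_forall fun s => (abs_le.1 (hC (s * θ))).1)
      (Eventually.of_forall fun s => (abs_le.1 (hC (s * θ))).2) tendsto_id
  have h2 := h1.add_const (-|θ|)
  rw [zero_add] at h2
  refine h2.congr' ?_
  filter_upwards [eventually_gt_atTop 0] with s hs
  rw [abs_mul, abs_of_pos hs]
  field_simp
  ring

theorem homogenized_continuous {V : ℝ → ℝ} (hVc : Continuous V) {C : ℝ} (hC0 : 0 ≤ C)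
    (hC : ∀ θ, |V θ + (|θ|)| ≤ C) : Continuous fun q : ℝ × ℝ => homogenized V q.1 q.2 := by
  have e : (fun q : ℝ × ℝ => homogenized V q.1 q.2) = fun q =>
      -|q.1| + if 0 < q.2 then q.2 * (V (q.1 / q.2) + |q.1 / q.2|) else 0 := by
    funext q
    rw [homogenized, recession_eq hC]
    split_ifs with h
    · rw [abs_div, abs_of_pos h, mul_add, mul_div_cancel₀ _ h.ne']
      ring
    · rw [add_zero]
  rw [e]
  refine (by fun_prop : Continuous fun q : ℝ × ℝ => -|q.1|).add
    (continuous_iff_continuousAt.2 fun q => ?_)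
  rcases lt_or_ge 0 q.2 with h | h
  · have h1 : ContinuousAt (fun q : ℝ × ℝ => q.2 * (V (q.1 / q.2) + |q.1 / q.2|)) q := by
      have h2 : ContinuousAt (fun q : ℝ × ℝ => q.1 / q.2) q :=
        continuousAt_fst.div continuousAt_snd h.ne'
      exact continuousAt_snd.mul ((hVc.continuousAt.comp h2).add h2.abs)
    refine h1.congr ?_
    filter_upwards [continuousAt_snd.eventually (lt_mem_nhds h)] with x hx
    rw [if_pos hx]
  · rw [ContinuousAt, if_neg (not_lt.2 h)]
    have h1 : Tendsto (fun q : ℝ × ℝ => max q.2 0 * C) (𝓝 q) (𝓝 0) := by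
      have : Continuous fun q : ℝ × ℝ => max q.2 0 * C := by fun_prop
      simpa [max_eq_right h] using this.tendsto q
    refine squeeze_zero_norm (fun x => ?_) h1
    split_ifs with hx
    · rw [norm_mul, Real.norm_of_nonneg hx.le, max_eq_left hx.le]
      exact mul_le_mul_of_nonneg_left (hC _) hx.le
    · rw [norm_zero]
      exact mul_nonneg (le_max_right _ _) hC0

theorem exists_chom_homogenized {V : ℝ → ℝ} (hVc : Continuous V) {C : ℝ} (hC0 : 0 ≤ C)
    (hC : ∀ θ, |V θ + (|θ|)| ≤ C) :
    ∃ f : Chom (Fin 1 → ℝ × ℝ), ∀ q, f.1 q = homogenized V (q.2.1 0).2 q.2.2 := by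
  refine ⟨⟨⟨fun q => homogenized V (q.2.1 0).2 q.2.2, ?_⟩, ?_⟩, fun q => rfl⟩
  · exact (homogenized_continuous hVc hC0 hC).comp
      (by fun_prop : Continuous fun q : Seg × (Fin 1 → ℝ × ℝ) × ℝ => ((q.2.1 0).2, q.2.2))
  · intro x ξ η c hc
    change homogenized V (c * (ξ 0).2) (c * η) = c * homogenized V (ξ 0).2 η
    rw [homogenized, homogenized, recession_eq hC, recession_eq hC]
    by_cases h : 0 < η
    · rw [if_pos h, if_pos (by positivity), mul_div_mul_left _ _ hc.ne', mul_assoc]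
    · rw [if_neg h, if_neg fun h' => h (pos_of_mul_pos_right h' hc.le), abs_mul, abs_of_pos hc]
      ring

theorem averageSlip_homogenized {V : ℝ → ℝ} {C : ℝ} (hC : ∀ θ, |V θ + (|θ|)| ≤ C) (z₀ : ℝ → ℝ)
    (a : ℝ) {f : Chom (Fin 1 → ℝ × ℝ)} (hf : ∀ q, f.1 q = homogenized V (q.2.1 0).2 q.2.2) :
    averageSlip z₀ a f = softeningEnergy V (fun y => z₀ y) - a := by
  simp only [averageSlip, hf, homogenized, if_pos one_pos, lt_irrefl, if_false, recession_eq hC,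
    div_one, one_mul, softeningEnergy, abs_neg, abs_one]
  ring

/-! ### Sums over subdivisions -/

theorem sum_succ_sub_castSucc {k : ℕ} (b : Fin (k + 1) → ℝ) :
    ∑ i : Fin k, (b i.succ - b i.castSucc) = b (Fin.last k) - b 0 := by
  induction k with
  | zero => simp
  | succ k ih =>
    rw [Fin.sum_univ_castSucc]
    have := ih fun i => b i.castSucc
    simp only [Fin.succ_castSucc, Fin.castSucc_zero] at this ⊢
    rw [this, Fin.succ_last]
    ring

/-- If all the sums over subdivisions agree, their set is a singleton. -/
theorem setOf_subdivision_eq {T S₀ : ℝ} (hT : 0 < T) (S : (k : ℕ) → (Fin (k + 1) → ℝ) → ℝ)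
    (h : ∀ k t, StrictMono t → t 0 = 0 → t (Fin.last k) = T → S k t = S₀) :
    {x | ∃ (k : ℕ) (t : Fin (k + 1) → ℝ), StrictMono t ∧ t 0 = 0 ∧ t (Fin.last k) = T ∧
      x = S k t} = {S₀} := by
  ext x
  constructor
  · rintro ⟨k, t, h1, h2, h3, rfl⟩
    exact h k t h1 h2 h3
  · rintro rfl
    have h1 : StrictMono (![0, T] : Fin 2 → ℝ) := by
      intro i j hij
      fin_cases i <;> fin_cases j <;> simp_all
    exact ⟨1, ![0, T], h1, rfl, rfl, (h 1 _ h1 rfl rfl).symm⟩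

theorem pathDissipationSums_slip {T : ℝ} (hT : 1 < T) (ζ : SignedMeasure Seg) :
    pathDissipationSums diamond slip (fun _ => ζ) 0 T = {2 * (T - 1)} := by
  refine setOf_subdivision_eq (by linarith) _ fun k t ht h0 hT' => ?_
  have h : ∀ i : Fin k, dissipationFunctional diamond (slip (t i.succ) - slip (t i.castSucc))
      (ζ - ζ) = 2 * max (t i.succ - 1) 0 - 2 * max (t i.castSucc - 1) 0 := by
    intro i
    have h1 : t i.castSucc ≤ t i.succ := ht.monotone Fin.castSucc_lt_succ.le
    rw [sub_self, slip_sub_slip, dissipationFunctional_dirac, abs_of_nonneg, mul_sub]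
    exact sub_nonneg.2 (max_le_max_right _ (by linarith))
  rw [Finset.sum_congr rfl fun i _ => h i,
    sum_succ_sub_castSucc fun i => 2 * max (t i - 1) 0, h0, hT', max_eq_left (by linarith),
    max_eq_right (by norm_num)]
  ring

/-! ### Approximation from the left by a set of full measure -/

theorem neBot_nhdsWithin_inter_Iic {Θ : Set ℝ} (h0 : 0 ∈ Θ) (hΘ : volume (Ici 0 \ Θ) = 0) {t : ℝ}
    (ht : 0 ≤ t) : (𝓝[Θ ∩ Iic t] t).NeBot := by
  rcases ht.eq_or_lt with rfl | ht
  · exact mem_closure_iff_nhdsWithin_neBot.1 (subset_closure ⟨h0, le_refl (0 : ℝ)⟩)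
  · refine mem_closure_iff_nhdsWithin_neBot.1 (Metric.mem_closure_iff.2 fun δ hδ => ?_)
    by_contra! hno
    have h1 : Ioo (max 0 (t - δ)) t ⊆ Ici 0 \ Θ := by
      intro s hs
      have hs1 := max_lt_iff.1 hs.1
      refine ⟨hs1.1.le, fun hsΘ => ?_⟩
      have := hno s ⟨hsΘ, hs.2.le⟩
      rw [Real.dist_eq, abs_of_pos (by linarith [hs.2])] at this
      linarith [hs1.2]
    have h2 := measure_mono_null h1 hΘ
    rw [Real.volume_Ioo, ENNReal.ofReal_eq_zero] at h2
    have : max 0 (t - δ) < t := max_lt ht (by linarith)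
    linarith

/-- Increasing finite sequences of times are limits from the left of increasing sequences of times
in a set of full measure. -/
theorem exists_filter_left {Θ : Set ℝ} (hΘ0 : Θ ⊆ Ici 0) (h0 : 0 ∈ Θ)
    (hΘ : volume (Ici 0 \ Θ) = 0) {m : ℕ} {t : Fin m → ℝ} (ht : StrictMono t) (ht0 : ∀ i, 0 ≤ t i) :
    ∃ l : Filter (Fin m → ℝ), l.NeBot ∧ l ≤ 𝓝 t ∧
      l ≤ 𝓝[{s | StrictMono s ∧ ∀ i, 0 ≤ s i ∧ s i ≤ t i}] t ∧
      ∀ᶠ s in l, StrictMono s ∧ ∀ i, s i ∈ Θ := by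
  have hne : ∀ i, (𝓝[Θ ∩ Iic (t i)] (t i)).NeBot := fun i =>
    neBot_nhdsWithin_inter_Iic h0 hΘ (ht0 i)
  have hmono : ∀ᶠ s in 𝓝 t, StrictMono s := by
    have : ∀ᶠ s in 𝓝 t, ∀ i j, i < j → s i < s j := by
      simp only [eventually_all]
      intro i j hij
      exact ((continuous_apply i).tendsto t).eventually_lt ((continuous_apply j).tendsto t) (ht hij)
    exact this.mono fun s hs i j hij => hs i j hij
  have hmem : ∀ᶠ s in 𝓝[univ.pi fun i => Θ ∩ Iic (t i)] t, ∀ i, s i ∈ Θ ∩ Iic (t i) := by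
    filter_upwards [self_mem_nhdsWithin] with s hs i
    exact hs i (mem_univ i)
  have hle : 𝓝[univ.pi fun i => Θ ∩ Iic (t i)] t ≤ 𝓝 t := nhdsWithin_le_nhds
  refine ⟨𝓝[univ.pi fun i => Θ ∩ Iic (t i)] t, ?_, hle, ?_, ?_⟩
  · rw [nhdsWithin_pi_univ_eq]
    change (Filter.pi fun i => 𝓝[Θ ∩ Iic (t i)] (t i)).NeBot
    infer_instance
  · refine le_inf hle (le_principal_iff.2 ?_)
    filter_upwards [hle hmono, hmem] with s h1 h2
    exact ⟨h1, fun i => ⟨hΘ0 (h2 i).1, (h2 i).2⟩⟩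
  · filter_upwards [hle hmono, hmem] with s h1 h2
    exact ⟨h1, fun i => (h2 i).1⟩

/-! ### The limit evolution -/

/-- Integration by parts against `y ↦ y`, which has derivative `1` and boundary values `±1/2`. -/
theorem integral_id_mul {f : Seg → ℝ} (hf : Integrable f) :
    ∫ y : Seg, (y : ℝ) * f y = 1 / 2 * (∫ y, f y) -
      ∫ y : Seg, ∫ s in (-1 / 2 : ℝ)..y, segExtend f s := by
  have h1 := isWeakDeriv_smul 1
  rw [one_smul, one_smul] at h1
  have htr : SameTrace (idL2 : L2) ((1 : ℝ) • idL2 : L2) := by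
    rw [one_smul]
    exact ⟨⟨fun y : Seg => (y : ℝ), by fun_prop⟩, ⟨fun y : Seg => (y : ℝ), by fun_prop⟩,
      idL2_ae, idL2_ae, rfl, rfl⟩
  have h2 := (h1.of_sameTrace (L2.integrable idL2) (L2.integrable oneL2) htr).2 f hf
  have e1 : ∫ y, idL2 y * f y = ∫ y : Seg, (y : ℝ) * f y := by
    refine integral_congr_ae ?_
    filter_upwards [idL2_ae] with y hy
    rw [hy]
  have e2 : ∫ y : Seg, oneL2 y * (∫ s in (-1 / 2 : ℝ)..y, segExtend f s) =
      ∫ y : Seg, ∫ s in (-1 / 2 : ℝ)..y, segExtend f s := by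
    refine integral_congr_ae ?_
    filter_upwards [oneL2_ae] with y hy
    rw [hy, one_mul]
  rw [e1, e2] at h2
  exact h2

theorem integral_primitive_origin (f : Seg → ℝ) :
    ∫ s in (-1 / 2 : ℝ)..0, segExtend f s = ∫ y in Seg.side (-1), f y := by
  have h1 : ∫ y in Seg.side (-1), f y =
      ∫ y : Seg, indicator (Iio (0 : ℝ)) (segExtend f) y := by
    rw [← integral_indicator (Seg.measurableSet_side _)]
    refine integral_congr_ae (ae_of_all _ fun y => ?_)
    by_cases h : (y : ℝ) < 0
    · have h' : y ∈ Seg.side (-1) := show 0 < -1 * (y : ℝ) by linarith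
      simp only [indicator_of_mem h', indicator_of_mem (show (y : ℝ) ∈ Iio (0 : ℝ) from h),
        segExtend_coe]
    · have h' : y ∉ Seg.side (-1) := fun h' => h (by
        have : 0 < -1 * (y : ℝ) := h'
        linarith)
      simp only [indicator_of_notMem h', indicator_of_notMem (show (y : ℝ) ∉ Iio (0 : ℝ) from h)]
  rw [h1, integral_seg, intervalIntegral.integral_of_le (by norm_num),
    intervalIntegral.integral_of_le neg_half_le_half, setIntegral_indicator measurableSet_Iio,
    ← setIntegral_congr_set (Ioo_ae_eq_Ioc (α := ℝ))]
  congr 2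
  ext s
  simp only [mem_Ioo, mem_inter_iff, mem_Ioc, mem_Iio]
  constructor
  · rintro ⟨h1, h2⟩
    exact ⟨⟨h1, by linarith⟩, h2⟩
  · rintro ⟨⟨h1, -⟩, h2⟩
    exact ⟨h1, h2⟩

theorem min_one_add_max_sub_one (t : ℝ) : min t 1 + max (t - 1) 0 = t := by
  rcases le_total t 1 with h | h
  · rw [min_eq_left h, max_eq_right (by linarith), add_zero]
  · rw [min_eq_right h, max_eq_left (by linarith)]
    ring

/-- The displacement is a combination of the affine function `y` and of the step function with
jump `1` at the origin. -/
theorem displacement_eq {t : ℝ} {y : Seg} {j : ℝ} (hj : j = 1 ∨ j = -1) (hy : y ∈ Seg.side j) :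
    displacement t y = min t 1 * y + max (t - 1) 0 * (j / 2) := by
  have hy' : 0 < j * (y : ℝ) := hy
  unfold displacement
  split_ifs with h1 h2
  · rw [min_eq_left h1, max_eq_right (by linarith), zero_mul, add_zero]
  · rw [min_eq_right (not_le.1 h1).le, max_eq_left (by linarith [not_le.1 h1])]
    rcases hj with rfl | rfl
    · ring
    · linarith
  · rw [min_eq_right (not_le.1 h1).le, max_eq_left (by linarith [not_le.1 h1])]
    rcases hj with rfl | rfl
    · linarith
    · ring

theorem abs_displacement_le (t : ℝ) : ∃ C, ∀ᵐ y : Seg, ‖displacement t y‖ ≤ C := by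
  refine ⟨|min t 1| + |max (t - 1) 0|, ae_seg_of_side fun j hj => ae_of_all _ fun y hy => ?_⟩
  rw [displacement_eq hj hy, Real.norm_eq_abs]
  refine (abs_add_le _ _).trans (add_le_add ?_ ?_)
  · rw [abs_mul]
    refine mul_le_of_le_one_right (abs_nonneg _) (abs_le.2 ⟨?_, ?_⟩)
    · linarith [y.2.1]
    · linarith [y.2.2]
  · rw [abs_mul, abs_div, abs_of_sign hj]
    exact mul_le_of_le_one_right (abs_nonneg _) (by norm_num)

theorem measurable_displacement (t : ℝ) : Measurable (displacement t) := by
  unfold displacement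
  refine Measurable.ite (MeasurableSet.const _) (by fun_prop) (Measurable.ite ?_ (by fun_prop)
    (by fun_prop))
  exact measurableSet_lt measurable_const measurable_subtype_coe

theorem integrable_displacement (t : ℝ) : Integrable (displacement t) := by
  obtain ⟨C, hC⟩ := abs_displacement_le t
  exact (integrable_const C).mono' (measurable_displacement t).aestronglyMeasurable hC

theorem integral_displacement_mul (t : ℝ) {f : Seg → ℝ} (hf : Integrable f) :
    ∫ y, displacement t y * f y = min t 1 * (∫ y : Seg, (y : ℝ) * f y) +
      max (t - 1) 0 * ((∫ y in Seg.side 1, f y) - ∫ y in Seg.side (-1), f y) / 2 := by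
  have hyf : Integrable fun y : Seg => (y : ℝ) * f y :=
    hf.bdd_mul (c := 1) (by fun_prop) (ae_of_all _ fun y => abs_le.2
      ⟨by linarith [y.2.1], by linarith [y.2.2]⟩)
  obtain ⟨C, hC⟩ := abs_displacement_le t
  have hdf : Integrable fun y : Seg => displacement t y * f y :=
    hf.bdd_mul (measurable_displacement t).aestronglyMeasurable hC
  have key : ∀ j : ℝ, (j = 1 ∨ j = -1) → ∫ y in Seg.side j, displacement t y * f y =
      min t 1 * (∫ y in Seg.side j, (y : ℝ) * f y) +
        max (t - 1) 0 * (j / 2) * ∫ y in Seg.side j, f y := by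
    intro j hj
    rw [← integral_const_mul, ← integral_const_mul,
      ← integral_add (hyf.const_mul _).integrableOn (hf.const_mul _).integrableOn]
    refine setIntegral_congr_fun (Seg.measurableSet_side j) fun y hy => ?_
    simp only [displacement_eq hj hy]
    ring
  rw [integral_eq_add_side hdf, integral_eq_add_side hyf, key 1 (Or.inl rfl),
    key (-1) (Or.inr rfl)]
  ring

/-- The values at time `t` of the limit evolution. The displacement is tested against bounded
functions, as this is the form in which it passes to the limit. -/
structure IsLimitAt (z₀ : ℝ → ℝ) (u : Seg → ℝ) (e : L2) (μ : GY (Fin 1 → ℝ × ℝ)) (t : ℝ) :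
    Prop where
  u_eq : ∀ f : Seg → ℝ, MemLp f ∞ → ∫ y, u y * f y = ∫ y, displacement t y * f y
  e_eq : e = min t 1 • oneL2
  μ_eq : ∀ f, μ.toFun f = averageSlip z₀ (max (t - 1) 0) f

section

variable {V : ℝ → ℝ} {M : ℝ} {z₀ : ℝ → ℝ} {u : ℝ → Seg → ℝ} {e : ℝ → L2} {μ : SGY}

theorem IsRegularizedEvolution.integral_u_zero {ε : ℝ} {u e p z : ℝ → L2}
    (h : IsRegularizedEvolution (1 / 2) diamond V linearDatum 0 0 0 (fun y => z₀ y) ε u e p z)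
    (f : Seg → ℝ) : ∫ y, u 0 y * f y = 0 := by
  obtain ⟨Du, uDot, DuDot, eDot, pDot, zDot, -, -, -, -, -, -, h0, -⟩ := h
  refine integral_eq_zero_of_ae ?_
  filter_upwards [h0] with y hy
  rw [hy, Pi.zero_apply, zero_mul]

/-- The limits at the times of convergence of the regularized evolutions. -/
theorem IsApproximableEvolution.exists_fullMeasure
    (hg : IsSofteningForce (fun θ => -deriv V θ) M) (hz₀ : IsInitialProfile z₀)
    (hev : IsApproximableEvolution (1 / 2) diamond V linearDatum 0 0 0 (fun y => z₀ y) u e μ) :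
    ∃ Θ : Set ℝ, Θ ⊆ Ici 0 ∧ 0 ∈ Θ ∧ volume (Ici 0 \ Θ) = 0 ∧
      (∀ t ∈ Θ, IsLimitAt z₀ (u t) (e t) (μ.meas 1 fun _ => t) t) ∧
      ∀ (k : ℕ) (t : Fin (k + 1) → ℝ), StrictMono t → (∀ i, t i ∈ Θ) →
        ∀ (i : Fin k) (f : Chom (Fin (k + 1) → ℝ × ℝ)),
        (∀ q, f.1 q = supportFn diamond (q.2.1 i.succ - q.2.1 i.castSucc)) →
        (μ.meas (k + 1) t).toFun f = 2 * (max (t i.succ - 1) 0 - max (t i.castSucc - 1) 0) := by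
  have hi : Integrable fun y : Seg => z₀ y := hev.memLp_initial.2.2.2.integrable one_le_two
  obtain ⟨ε, Θ, uε, eε, pε, zε, hε, hε0, hΘ0, h0, hΘ, hreg, hu, he, hμ⟩ := hev.approximable
  choose c pDot zDot hred hec huc using fun k =>
    IsRegularizedEvolution.exists_reduced hg (hreg k)
  refine ⟨Θ, hΘ0, h0, hΘ, fun t ht => ⟨fun f hf => ?_, ?_, fun f => ?_⟩,
    fun k t htm ht i f hf => ?_⟩
  · have ht0 : 0 ≤ t := hΘ0 ht
    obtain ⟨N, ν, -, -, hlim, -⟩ := hu t ht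
    have hfi : Integrable f := hf.integrable le_top
    refine tendsto_nhds_unique (hlim f hf) ?_
    rcases ht0.eq_or_lt with rfl | ht1
    · have e0 : ∫ y, displacement 0 y * f y = 0 := by
        rw [integral_displacement_mul 0 hfi, min_eq_left zero_le_one, max_eq_right (by norm_num)]
        simp
      simp only [e0, fun k => (hreg k).integral_u_zero f]
      exact tendsto_const_nhds
    · set G : Seg → ℝ := fun y => ∫ s in (-1 / 2 : ℝ)..y, segExtend f s with hG
      have hGc : Continuous G := continuous_primitive hfi
      have hGi : Integrable G := integrable_seg_of_continuous hGc
      obtain ⟨B, hB⟩ := (isCompact_univ (X := Seg)).exists_bound_of_continuousOn hGc.continuousOn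
      obtain ⟨hc, hY⟩ := tendsto_reduced hg hz₀ hi hε hε0 hred ht0
      -- The limit of `∫ G p` is that of the Young measures on the test function `G(x) ξ`.
      let F : Chom (Fin 1 → ℝ × ℝ) := ⟨⟨fun q => G q.1 * (q.2.1 0).1, by fun_prop⟩, by
        intro x ξ η c _
        change G x * (c * (ξ 0).1) = c * (G x * (ξ 0).1)
        ring⟩
      have hF : ∀ q, F.1 q = G q.1 * (q.2.1 0).1 := fun q => rfl
      have h1 := hY F
      simp only [hF, mul_zero, integral_zero, zero_add, mul_one] at h1
      have h2 : ∀ k, ∫ y, uε k t y * f y =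
          t / 2 * (∫ y, f y) - (c k t * (∫ y, G y) + ∫ y, G y * pε k t y) := by
        intro k
        have hp : Integrable fun y => G y * pε k t y :=
          (L2.integrable (pε k t)).bdd_mul hGc.aestronglyMeasurable
            (ae_of_all _ fun y => hB y (mem_univ y))
        have e1 : c k t * (∫ y, G y) + ∫ y, G y * pε k t y =
            ∫ y, (c k t * G y + G y * pε k t y) := by
          rw [integral_add (hGi.const_mul _) hp, integral_const_mul]
        rw [huc k t ht1 f hfi, e1]
        congr 1
        refine integral_congr_ae (ae_of_all _ fun y => ?_)
        simp only [hG]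
        ring
      simp only [h2]
      have h3 := ((hc.mul_const (∫ y, G y)).add h1).const_sub (t / 2 * ∫ y, f y)
      convert h3 using 2
      have h4 : G Seg.origin = ∫ y in Seg.side (-1), f y := integral_primitive_origin f
      rw [integral_displacement_mul t hfi, integral_id_mul hfi, h4]
      have h5 := integral_eq_add_side hfi
      have h6 := min_one_add_max_sub_one t
      change _ * (_ - ∫ y, G y) + _ = _
      rw [h5]
      linear_combination (1 / 2 * ((∫ y in Seg.side 1, f y) + ∫ y in Seg.side (-1), f y)) * h6
  · have ht0 : 0 ≤ t := hΘ0 ht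
    refine ext_inner_right ℝ fun g => tendsto_nhds_unique (he t ht g) ?_
    have hc := (tendsto_reduced hg hz₀ hi hε hε0 hred ht0).1
    simp only [fun k => hec k t ht0, real_inner_smul_left]
    exact hc.mul_const _
  · have h1 := hμ 1 (fun _ => t) (Subsingleton.strictMono _) (fun _ => ht) f
    exact tendsto_nhds_unique h1 ((tendsto_reduced hg hz₀ hi hε hε0 hred (hΘ0 ht)).2 f)
  · refine tendsto_nhds_unique (hμ (k + 1) t htm ht f) ?_
    have hs0 : 0 ≤ t i.castSucc := hΘ0 (ht _)
    have ht0 : 0 ≤ t i.succ := hΘ0 (ht _)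
    have hst : t i.castSucc ≤ t i.succ := htm.monotone Fin.castSucc_lt_succ.le
    have hlim : ∀ r, 0 ≤ r → Tendsto (fun n => r - c n r) atTop (𝓝 (max (r - 1) 0)) := by
      intro r hr
      rw [show max (r - 1) 0 = r - min r 1 by linarith [min_one_add_max_sub_one r]]
      exact (tendsto_reduced hg hz₀ hi hε hε0 hred hr).1.const_sub r
    refine (((hlim _ ht0).sub (hlim _ hs0)).const_mul 2).congr' ?_
    obtain ⟨ε₀, hε₀, H⟩ := exists_forall_reduced hg hz₀ one_pos one_pos
    filter_upwards [hε0.eventually (gt_mem_nhds hε₀)] with n hn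
    have hS := fun r hr => (H _ _ _ _ _ _ (hε n) hn (hred n) r hr).2
    rw [← (hS _ hs0).integral_supportFn (hS _ ht0) ((hred n).p_mono hg (hε n) hs0 hst)]
    refine integral_congr_ae (ae_of_all _ fun y => ?_)
    exact (hf (y, fun j => (pε n (t j) y, zε n (t j) y), 1)).symm

/-- Each of the limits depends continuously on time, so that left continuity extends it from a set
of full measure to all times. -/
theorem IsApproximableEvolution.isLimitAt
    (hg : IsSofteningForce (fun θ => -deriv V θ) M) (hz₀ : IsInitialProfile z₀)
    (hev : IsApproximableEvolution (1 / 2) diamond V linearDatum 0 0 0 (fun y => z₀ y) u e μ)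
    {t : ℝ} (ht : 0 ≤ t) : IsLimitAt z₀ (u t) (e t) (μ.meas 1 fun _ => t) t := by
  obtain ⟨Θ, hΘ0, h0, hΘ, hlim, -⟩ := hev.exists_fullMeasure hg hz₀
  have := neBot_nhdsWithin_inter_Iic h0 hΘ ht
  have hle : 𝓝[Θ ∩ Iic t] t ≤ 𝓝[Icc 0 t] t :=
    nhdsWithin_mono t fun s hs => ⟨hΘ0 hs.1, hs.2⟩
  have hmem : ∀ᶠ s in 𝓝[Θ ∩ Iic t] t, s ∈ Θ := by
    filter_upwards [self_mem_nhdsWithin] with s hs using hs.1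
  have hmin : Tendsto (fun s : ℝ => min s 1) (𝓝[Θ ∩ Iic t] t) (𝓝 (min t 1)) :=
    ((by fun_prop : Continuous fun s : ℝ => min s 1).tendsto t).mono_left nhdsWithin_le_nhds
  have hmax : Tendsto (fun s : ℝ => max (s - 1) 0) (𝓝[Θ ∩ Iic t] t) (𝓝 (max (t - 1) 0)) :=
    ((by fun_prop : Continuous fun s : ℝ => max (s - 1) 0).tendsto t).mono_left nhdsWithin_le_nhds
  refine ⟨fun f hf => ?_, ?_, fun f => ?_⟩
  · obtain ⟨N, ν, -, -, hu, -⟩ := hev.u_leftContinuous t ht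
    have hfi : Integrable f := hf.integrable le_top
    refine tendsto_nhds_unique ((hu f hf).mono_left hle) ?_
    rw [integral_displacement_mul t hfi]
    refine ((hmin.mul_const _).add ((hmax.mul_const _).div_const 2)).congr' ?_
    filter_upwards [hmem] with s hs
    rw [(hlim s hs).u_eq f hf, integral_displacement_mul s hfi]
  · refine ext_inner_right ℝ fun g =>
      tendsto_nhds_unique ((hev.e_leftContinuous t ht g).mono_left hle) ?_
    rw [real_inner_smul_left]
    refine (hmin.mul_const _).congr' ?_
    filter_upwards [hmem] with s hs
    rw [(hlim s hs).e_eq, real_inner_smul_left]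
  · have h1 := hev.μ_leftContinuous 1 (fun _ => t) (Subsingleton.strictMono _) (fun _ => ht) f
    have h2 : Tendsto (fun s : ℝ => (fun _ => s : Fin 1 → ℝ)) (𝓝[Θ ∩ Iic t] t)
        (𝓝[{s | StrictMono s ∧ ∀ i, 0 ≤ s i ∧ s i ≤ t}] fun _ => t) := by
      refine tendsto_nhdsWithin_iff.2 ⟨?_, ?_⟩
      · exact ((by fun_prop : Continuous fun s : ℝ => (fun _ => s : Fin 1 → ℝ)).tendsto t).mono_left
          nhdsWithin_le_nhds
      · filter_upwards [self_mem_nhdsWithin] with s hs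
        exact ⟨Subsingleton.strictMono _, fun _ => ⟨hΘ0 hs.1, hs.2⟩⟩
    refine tendsto_nhds_unique (h1.comp h2) ?_
    refine (((hmax.div_const 2).mul_const _).const_add _).congr' ?_
    filter_upwards [hmem] with s hs
    exact ((hlim s hs).μ_eq f).symm

theorem IsLimitAt.u_ae_eq {u : Seg → ℝ} {e : L2} {μ : GY (Fin 1 → ℝ × ℝ)} {t : ℝ}
    (h : IsLimitAt z₀ u e μ t) (hu : Integrable u) : u =ᵐ[volume] displacement t := by
  refine hu.ae_eq_of_forall_setIntegral_eq _ _ (integrable_displacement t) fun s hs _ => ?_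
  have h1 : ∀ v : Seg → ℝ, ∫ y, v y * indicator s (fun _ => (1 : ℝ)) y = ∫ y in s, v y := by
    intro v
    rw [← integral_indicator hs]
    refine integral_congr_ae (ae_of_all _ fun y => ?_)
    by_cases hy : y ∈ s
    · simp [hy]
    · simp [hy]
  rw [← h1, ← h1]
  exact h.u_eq _ ((memLp_const 1).indicator hs)

theorem exists_chom_supportFn {k : ℕ} (i j : Fin k) : ∃ f : Chom (Fin k → ℝ × ℝ),
    ∀ q, f.1 q = supportFn diamond (q.2.1 i - q.2.1 j) := by
  refine ⟨⟨⟨fun q => supportFn diamond (q.2.1 i - q.2.1 j), ?_⟩, ?_⟩, fun q => rfl⟩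
  · simp only [supportFn_diamond]
    fun_prop
  · intro x ξ η c hc
    change supportFn diamond (c • ξ i - c • ξ j) = c * supportFn diamond (ξ i - ξ j)
    rw [← smul_sub, supportFn_diamond, supportFn_diamond]
    simp only [Prod.smul_fst, Prod.smul_snd, smul_eq_mul, abs_mul, abs_of_pos hc]
    rw [← mul_max_of_nonneg _ _ hc.le]
    ring

theorem IsApproximableEvolution.dissipationSums_eq
    (hg : IsSofteningForce (fun θ => -deriv V θ) M) (hz₀ : IsInitialProfile z₀)
    (hev : IsApproximableEvolution (1 / 2) diamond V linearDatum 0 0 0 (fun y => z₀ y) u e μ)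
    {T : ℝ} (hT : 0 < T) : μ.dissipationSums diamond 0 T = {2 * max (T - 1) 0} := by
  obtain ⟨Θ, hΘ0, h0, hΘ, -, hlim⟩ := hev.exists_fullMeasure hg hz₀
  refine setOf_subdivision_eq hT _ fun k t ht ht0 htT => ?_
  have hnn : ∀ i, 0 ≤ t i := fun i => by
    rw [← ht0]
    exact ht.monotone (Fin.zero_le i)
  obtain ⟨l, hl, hl1, hl2, hl3⟩ := exists_filter_left hΘ0 h0 hΘ ht hnn
  have h : ∀ i : Fin k, (μ.meas (k + 1) t).pair
      (fun q => supportFn diamond (q.2.1 i.succ - q.2.1 i.castSucc)) =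
      2 * max (t i.succ - 1) 0 - 2 * max (t i.castSucc - 1) 0 := by
    intro i
    obtain ⟨f, hf⟩ := exists_chom_supportFn i.succ i.castSucc
    rw [GY.pair_eq _ f hf]
    refine tendsto_nhds_unique ((hev.μ_leftContinuous _ t ht hnn f).mono_left hl2) ?_
    have hc : Continuous fun s : Fin (k + 1) → ℝ =>
        2 * max (s i.succ - 1) 0 - 2 * max (s i.castSucc - 1) 0 := by fun_prop
    refine ((hc.tendsto t).mono_left hl1).congr' ?_
    filter_upwards [hl3] with s hs
    rw [hlim k s hs.1 hs.2 i f hf, mul_sub]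
  rw [Finset.sum_congr rfl fun i _ => h i,
    sum_succ_sub_castSucc fun i => 2 * max (t i - 1) 0, ht0, htT,
    max_eq_right (by norm_num : (0 : ℝ) - 1 ≤ 0)]
  ring

end

/-! ### The energies -/

theorem integral_min_one {T : ℝ} (hT : 0 ≤ T) :
    ∫ t in (0 : ℝ)..T, min t 1 = 1 / 2 * min T 1 ^ 2 + max (T - 1) 0 := by
  have hi : ∀ a b : ℝ, IntervalIntegrable (fun t : ℝ => min t 1) volume a b := fun a b =>
    (by fun_prop : Continuous fun t : ℝ => min t 1).intervalIntegrable a b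
  have h1 : ∀ S, 0 ≤ S → S ≤ 1 → ∫ t in (0 : ℝ)..S, min t 1 = 1 / 2 * S ^ 2 := by
    intro S hS hS1
    have : ∫ t in (0 : ℝ)..S, min t 1 = ∫ t in (0 : ℝ)..S, t := by
      refine intervalIntegral.integral_congr fun t ht => ?_
      rw [uIcc_of_le hS] at ht
      exact min_eq_left (ht.2.trans hS1)
    rw [this, integral_id]
    ring
  rcases le_total T 1 with h | h
  · rw [h1 T hT h, min_eq_left h, max_eq_right (by linarith), add_zero]
  · have : ∫ t in (1 : ℝ)..T, min t 1 = ∫ t in (1 : ℝ)..T, 1 := by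
      refine intervalIntegral.integral_congr fun t ht => ?_
      rw [uIcc_of_le h] at ht
      exact min_eq_right ht.1
    rw [← intervalIntegral.integral_add_adjacent_intervals (hi 0 1) (hi 1 T),
      h1 1 zero_le_one le_rfl, this, intervalIntegral.integral_const, min_eq_right h,
      max_eq_left (by linarith), smul_eq_mul]
    ring

theorem smul_oneL2_ae (c : ℝ) : ((c • oneL2 : L2) : Seg → ℝ) =ᵐ[volume] fun _ => c := by
  filter_upwards [Lp.coeFn_smul c oneL2, oneL2_ae] with y h1 h2
  rw [h1, Pi.smul_apply, h2, smul_eq_mul, mul_one]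

theorem elasticEnergy_of_ae_eq {e : Seg → ℝ} {c : ℝ} (h : e =ᵐ[volume] fun _ => c) :
    elasticEnergy (1 / 2) e = 1 / 2 * c ^ 2 := by
  have : elasticEnergy (1 / 2) e = ∫ _y : Seg, 1 / 2 * c ^ 2 := by
    refine integral_congr_ae ?_
    filter_upwards [h] with y hy
    rw [hy]
    ring
  rw [this, integral_const, volume_seg_univ, one_smul]

theorem work_eq {e : ℝ → L2} (he : ∀ t, 0 ≤ t → e t = min t 1 • oneL2) {T : ℝ} (hT : 0 ≤ T) :
    work (1 / 2) e linearDatum T = 1 / 2 * min T 1 ^ 2 + max (T - 1) 0 := by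
  rw [← integral_min_one hT]
  refine intervalIntegral.integral_congr fun t ht => ?_
  rw [uIcc_of_le hT] at ht
  have h1 : inner ℝ oneL2 oneL2 = (1 : ℝ) := by
    rw [L2.inner_one, integral_congr_ae oneL2_ae, integral_const, volume_seg_univ, one_smul]
  change inner ℝ ((2 * (1 / 2) : ℝ) • e t) oneL2 = min t 1
  rw [he t ht.1, real_inner_smul_left, real_inner_smul_left, h1]
  ring

end

theorem mainTheorem8
    -- the softening potential
    (V : ℝ → ℝ) (hV : ContDiff ℝ 2 V)
    (hV2 : ∃ M : ℝ, 0 ≤ M ∧ ∀ θ, -M ≤ deriv (deriv V) θ ∧ deriv (deriv V) θ ≤ 0)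
    (hVeven : ∀ θ, V θ = V (-θ)) (hV1 : ∀ θ, deriv V θ = -1 ↔ 1 ≤ θ)
    -- the initial value of the internal variable
    (z₀ : ℝ → ℝ) (hodd : ∀ y ∈ Icc (-1 / 2 : ℝ) (1 / 2), z₀ (-y) = -z₀ y)
    (hcont : ContinuousOn z₀ (Ico (-1 / 2 : ℝ) 0 ∪ Ioc 0 (1 / 2)))
    (hlim : Tendsto z₀ (𝓝[>] 0) (𝓝 1))
    (hrange : ∀ y ∈ Ioc (0 : ℝ) (1 / 2), 0 ≤ z₀ y ∧ z₀ y < 1)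
    -- an approximable evolution with `2G = 1`
    (u : ℝ → Seg → ℝ) (e : ℝ → L2) (μ : SGY)
    (hev : IsApproximableEvolution (1 / 2) diamond V linearDatum 0 0 0 (fun y => z₀ y) u e μ) :
    (∀ t, 0 ≤ t →
      u t =ᵐ[volume] displacement t ∧
      e t =ᵐ[volume] (fun _ => min t 1) ∧
      (∀ f : Chom (Fin 1 → ℝ × ℝ), (μ.meas 1 fun _ => t).toFun f =
        1 / 2 * youngDelta (fun _ => (slip t, densityMeasure (fun y => z₀ y) + slip t)) f +
        1 / 2 * youngDelta (fun _ => (slip t, densityMeasure (fun y => z₀ y) - slip t)) f) ∧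
      IsBarycentre (μ.meas 1 fun _ => t) (slip t) (densityMeasure fun y => z₀ y)) ∧
    -- for `t > 1` the two measures that are averaged are different
    (∀ t, 1 < t → ∃ f : Chom (Fin 1 → ℝ × ℝ),
      youngDelta (fun _ => (slip t, densityMeasure (fun y => z₀ y) + slip t)) f ≠
        youngDelta (fun _ => (slip t, densityMeasure (fun y => z₀ y) - slip t)) f) ∧
    -- the dissipation, and the energy balance
    (∀ T, 0 < T →
      BddAbove (μ.dissipationSums diamond 0 T) ∧
      μ.dissipation diamond 0 T = 2 * max (T - 1) 0 ∧
      elasticEnergy (1 / 2) (e T) + μ.dissipation diamond 0 T +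
          (μ.meas 1 fun _ => T).pair (fun q => homogenized V (q.2.1 0).2 q.2.2) =
        elasticEnergy (1 / 2) 0 + softeningEnergy V (fun y => z₀ y) +
          work (1 / 2) e linearDatum T) ∧
    -- the barycentres `((t - 1)⁺ δ₀, z₀)` violate the classical energy inequality
    (∀ T, 1 < T →
      BddAbove (pathDissipationSums diamond slip (fun _ => densityMeasure fun y => z₀ y) 0 T) ∧
      pathDissipation diamond slip (fun _ => densityMeasure fun y => z₀ y) 0 T = 2 * (T - 1) ∧
      ¬ (elasticEnergy (1 / 2) (e T) +
            pathDissipation diamond slip (fun _ => densityMeasure fun y => z₀ y) 0 T +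
            softeningEnergy V (fun y => z₀ y) ≤
          elasticEnergy (1 / 2) 0 + softeningEnergy V (fun y => z₀ y) +
            work (1 / 2) e linearDatum T)) := by
  obtain ⟨M, hM, hV2⟩ := hV2
  have hg := isSofteningForce_neg_deriv hV hM hV2 hVeven hV1
  have hz₀ : IsInitialProfile z₀ := ⟨hodd, hcont, hlim, hrange⟩
  have hi : Integrable fun y : Seg => z₀ y := hev.memLp_initial.2.2.2.integrable one_le_two
  have hL := fun t ht => hev.isLimitAt hg hz₀ (t := t) ht
  obtain ⟨C, hC0, hC⟩ := exists_abs_add_abs_le hV.continuous hVeven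
    fun θ hθ => softening_eq_of_one_le hV hV1 hθ
  obtain ⟨F, hF⟩ := exists_chom_homogenized hV.continuous hC0 hC
  have hE : ∀ t, 0 ≤ t → elasticEnergy (1 / 2) (e t) = 1 / 2 * min t 1 ^ 2 := fun t ht =>
    elasticEnergy_of_ae_eq (by rw [(hL t ht).e_eq]; exact smul_oneL2_ae _)
  have hE0 : elasticEnergy (1 / 2) 0 = 0 := by simp [elasticEnergy]
  have hW := fun T hT => work_eq (fun t ht => (hL t ht).e_eq) (T := T) hT
  refine ⟨fun t ht => ⟨?_, ?_, fun f => ?_, fun φ ψ => ?_⟩, fun t ht => youngDelta_slip_ne hi ht,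
    fun T hT => ?_, fun T hT => ?_⟩
  · obtain ⟨N, ν, -, hν, -⟩ := hev.u_leftContinuous t ht
    exact (hL t ht).u_ae_eq hν.1
  · rw [(hL t ht).e_eq]
    exact smul_oneL2_ae _
  · rw [(hL t ht).μ_eq, averageSlip_eq_youngDelta hi]
  · let f : Chom (Fin 1 → ℝ × ℝ) :=
      ⟨⟨fun q => φ q.1 * (q.2.1 0).1 + ψ q.1 * (q.2.1 0).2, by fun_prop⟩, by
        intro x ξ η c _
        change φ x * (c * (ξ 0).1) + ψ x * (c * (ξ 0).2) = c * (φ x * (ξ 0).1 + ψ x * (ξ 0).2)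
        ring⟩
    refine (GY.pair_eq _ f fun q => rfl).trans ?_
    rw [(hL t ht).μ_eq, averageSlip_barycentre hi t φ ψ fun q => rfl]
  · have hD := hev.dissipationSums_eq hg hz₀ hT
    have hD' : μ.dissipation diamond 0 T = 2 * max (T - 1) 0 := by
      rw [SGY.dissipation, hD, csSup_singleton]
    refine ⟨hD ▸ bddAbove_singleton, hD', ?_⟩
    rw [hD', GY.pair_eq _ F hF, (hL T hT.le).μ_eq, averageSlip_homogenized hC z₀ _ hF, hE T hT.le,
      hE0, hW T hT.le]
    ring
  · have hT0 : 0 ≤ T := by linarith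
    have hD := pathDissipationSums_slip hT (densityMeasure fun y => z₀ y)
    have hD' : pathDissipation diamond slip (fun _ => densityMeasure fun y => z₀ y) 0 T =
        2 * (T - 1) := by
      rw [pathDissipation, hD, csSup_singleton]
    refine ⟨hD ▸ bddAbove_singleton, hD', ?_⟩
    rw [hD', hE T hT0, hE0, hW T hT0, max_eq_left (by linarith)]
    linarith
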